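/- Work over $\mathbb{C}$. Let $s=(s_1,s_2)$ and $\varepsilon=(\varepsilon_1,\varepsilon_2)$ be pairs of signs $\pm1$ with $s_1\neq s_2$, and let $s_i=(-1)^{|i|}$. **Algebras.** The super Yangian $\mathscr{Y}_s$ is the superalgebra with generators $t_{ij}^{(r)}$ ($1\le i,j\le 2$, $r\geq 1$) of parity $|i|+|j|$ and, for $t_{ij}(u)=\delta_{ij}+\sum_{r\ge1}t_{ij}^{(r)}u^{-r}$, the defining relations $$(u-v)[t_{ij}(u),t_{kl}(v)]=(-1)^{|i||j|+|i||k|+|j||k|}\big(t_{kj}(u)t_{il}(v)-t_{kj}(v)t_{il}(u)\big),$$ where $[\cdot,\cdot]$ is the supercommutator. The twisted super Yangian $\mathscr{B}_{s,\varepsilon}$ of type AIII is the superalgebra with generators $b_{ij}^{(r)}$ of parity $|i|+|j|$ and, for $b_{ij}(u)=\delta_{ij}\varepsilon_i+\sum_{r\geq1}b_{ij}^{(r)}u^{-r}$, the defining relations $$\begin{aligned}{}[b_{ij}(u),b_{kl}(v)]={}&\tfrac{(-1)^{|i||j|+|i||k|+|j||k|}}{u-v}\big(b_{kj}(u)b_{il}(v)-b_{kj}(v)b_{il}(u)\big)\\&+\tfrac{(-1)^{|i||j|+|i||k|+|j||k|}}{u+v}\Big(\delta_{kj}\sum_{a}b_{ia}(u)b_{al}(v)-\delta_{il}\sum_a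 b_{ka}(v)b_{aj}(u)\Big)\\&-\tfrac{1}{u^2-v^2}\delta_{ij}\Big(\sum_a b_{ka}(u)b_{al}(v)-\sum_a b_{ka}(v)b_{al}(u)\Big)\end{aligned}$$ and $\sum_a b_{ia}(u)b_{aj}(-u)=\delta_{ij}$. With $(t'_{ij}(u))$ the inverse of the matrix $(t_{ij}(u))$, the map $b_{ij}(u)\mapsto\sum_a\varepsilon_a t_{ia}(u)t'_{aj}(-u)$ is a homomorphism $\mathscr{B}_{s,\varepsilon}\to\mathscr{Y}_s$, along which $\mathscr{Y}_s$-modules are restricted. **Modules.** For $\mathcal a,\mathcal b\in\mathbb{C}$ with $\mathcal a+\mathcal b\ne0$, let $L(\mathcal a,\mathcal b)$ be the two-dimensional evaluation module with basis $v^+$ (even) and $v^-$ (odd): $t_{ij}(u)$ acts by $\delta_{ij}+s_ie_{ij}u^{-1}$, where $e_{11}=\mathrm{diag}(\mathcal a,\mathcal a-1)$, $e_{22}=\mathrm{diag}(\mathcal b,\mathcal b+1)$, $e_{21}v^+=v^-$, $e_{21}v^-=0$, $e_{12}v^-=(\mathcal a+\mathcal b)v^+$, $e_{12}v^+=0$.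 Tensor products of $\mathscr{Y}_s$-modules are formed with $\Delta(t_{ij}(u))=\sum_k t_{ik}(u)\otimes t_{kj}(u)$, and the tensor product of a $\mathscr{Y}_s$-module with a $\mathscr{B}_{s,\varepsilon}$-module is the $\mathscr{B}_{s,\varepsilon}$-module given by $\Delta(b_{ij}(u))=\sum_{a,c}(-1)^{(|c|+|j|)(|a|+|c|)}t_{ia}(u)t'_{cj}(-u)\otimes b_{ac}(u)$; an empty tensor product is the one-dimensional trivial module. For $\gamma\in\mathbb{C}$, let $\mathbb{C}_\gamma$ be the one-dimensional $\mathscr{B}_{s,\varepsilon}$-module on which $b_{ij}(u)$ acts by $\delta_{ij}\frac{\varepsilon_iu+\gamma}{u-\gamma}$. Two $\mathscr{B}_{s,\varepsilon}$-modules are *almost isomorphic* if one is isomorphic, up to a parity shift, to the pullback of the other through an automorphism $b_{ij}(u)\mapsto h(u)b_{ij}(u)$ with $h(u)\in1+u^{-1}\mathbb{C}[[u^{-1}]]$ and $h(u)h(-u)=1$. A $\mathscr{B}_{s,\varepsilon}$-module has highest weight $(\mu_1(u),\mu_2(u))$ if it is generated by a nonzero vector $\eta$ with $b_{12}(u)\eta=0$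 and $b_{ii}(u)\eta=\mu_i(u)\eta$; put $\tilde\mu_1(u)=(2u-s_2)\mu_1(u)+s_2\mu_2(u)$ and $\tilde\mu_2(u)=2u\mu_2(u)$. **Statement.** Let $P(u)=\prod_{i=1}^l(u+s_1\mathcal a_i)$ be a monic polynomial of degree $l\geq0$ such that $P(u)$ and $P(-u-s_1)$ are coprime. 1. Let $\varepsilon_1=\varepsilon_2$ and $k=\lfloor\frac{l+1}{2}\rfloor$. For $1\le i\le k$ put $\mathcal b_i=\mathcal a_{i+k}-1$, except that $\mathcal b_k=-\frac12$ if $l$ is odd. Then the restriction to $\mathscr{B}_{s,\varepsilon}$ of the $\mathscr{Y}_s$-module $L(\mathcal a_1,\mathcal b_1)\otimes\cdots\otimes L(\mathcal a_k,\mathcal b_k)$ is irreducible. Every finite-dimensional irreducible $\mathscr{B}_{s,\varepsilon}$-module $V$ with a highest weight such that $$\frac{\tilde\mu_1(u)}{\tilde\mu_2(u)}=(-1)^{\deg P}\frac{P(u)}{P(-u-s_1)}$$ is almost isomorphic to this module; in particular, $\dim V=2^k$. 2. Let $\varepsilon_1\ne\varepsilon_2$ and $k=\lfloor\frac{l}{2}\rfloor$.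 For $1\le i\le k$ put $\mathcal b_i=\mathcal a_{i+k}-1$, except that $\mathcal b_k=-\frac12$ if $l$ is even. Put $\gamma=\varepsilon_1s_1(\mathcal a_l-1)$ if $l\ge1$, and $\gamma=-\frac12\varepsilon_1s_1$ if $l=0$. Then the $\mathscr{B}_{s,\varepsilon}$-module $L(\mathcal a_1,\mathcal b_1)\otimes\cdots\otimes L(\mathcal a_k,\mathcal b_k)\otimes\mathbb{C}_\gamma$ is irreducible. Every finite-dimensional irreducible $\mathscr{B}_{s,\varepsilon}$-module $V$ with a highest weight such that $$\frac{\tilde\mu_1(u)}{\tilde\mu_2(u)}=(-1)^{\deg P+1}\frac{P(u)}{P(-u-s_1)}$$ is almost isomorphic to this module; in particular, $\dim V=2^k$. -/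

import Mathlib

open scoped TensorProduct

/-! Conventions. A parity sequence `s` and a sign sequence `ε` are functions to `ℤˣ = {1, -1}`;
indices run over `Fin κ`, so that for `κ = 2` the index `0` is the first and `1` the second one.
A power series always stands for a formal series in `u⁻¹`: the coefficient of `X ^ r` is the
coefficient of `u ^ (-r)`. -/

namespace TwistedSuperYangian

variable {κ : ℕ}

/-- A sign, as a complex number. -/
noncomputable def sgn (x : ℤˣ) : ℂ := ((x : ℤ) : ℂ)

/-- The parity `|i|`, with `s i = (-1) ^ |i|`. -/
def par (s : Fin κ → ℤˣ) (i : Fin κ) : ℕ := if s i = 1 then 0 else 1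

/-- The sign `(-1) ^ (|i||j| + |i||k| + |j||k|)`. -/
noncomputable def sgn3 (s : Fin κ → ℤˣ) (i j k : Fin κ) : ℂ :=
  (-1) ^ (par s i * par s j + par s i * par s k + par s j * par s k)

/-! ### The super Yangian and the twisted super Yangian, by generators and relations -/

/-- The free algebra on symbols `x i j r` with `r ≥ 1`; the generator `(i, j, r)` is
`x i j (r + 1)`. -/
abbrev FreeGen (κ : ℕ) : Type := FreeAlgebra ℂ (Fin κ × Fin κ × ℕ)

/-- The coefficient of `u ^ (-r)`, for an integer `r`, in
`x i j (u) = δ i j * g i + ∑_{r ≥ 1} (x i j r) u ^ (-r)`. -/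
noncomputable def gen (g : Fin κ → ℂ) (i j : Fin κ) (r : ℤ) : FreeGen κ :=
  if r = 0 then (if i = j then algebraMap ℂ (FreeGen κ) (g i) else 0)
  else if 0 < r then FreeAlgebra.ι ℂ (i, j, (r - 1).toNat) else 0

/-- The supercommutator of `x i j r` and `x k l p`; `x i j r` has parity `|i| + |j|`. -/
noncomputable def scomm (s : Fin κ → ℤˣ) (g : Fin κ → ℂ) (i j : Fin κ) (r : ℤ) (k l : Fin κ)
    (p : ℤ) : FreeGen κ :=
  gen g i j r * gen g k l p
    - ((-1 : ℂ) ^ ((par s i + par s j) * (par s k + par s l))) • (gen g k l p * gen g i j r)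

/-- The coefficient of `u ^ (-r) v ^ (-p)` in `x k j (u) x i l (v) - x k j (v) x i l (u)`. -/
noncomputable def exch (g : Fin κ → ℂ) (i j k l : Fin κ) (r p : ℤ) : FreeGen κ :=
  gen g k j r * gen g i l p - gen g k j p * gen g i l r

/-- The coefficient of `u ^ (-r) v ^ (-p)` in `∑ a, x i a (u) x a l (v)`. -/
noncomputable def prodCoeff (g : Fin κ → ℂ) (i l : Fin κ) (r p : ℤ) : FreeGen κ :=
  ∑ a, gen g i a r * gen g a l p

/-- The coefficient of `u ^ (-r) v ^ (-p)` in
`δ k j * ∑ a, x i a (u) x a l (v) - δ i l * ∑ a, x k a (v) x a j (u)`. -/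
noncomputable def contr (g : Fin κ → ℂ) (i j k l : Fin κ) (r p : ℤ) : FreeGen κ :=
  (if k = j then prodCoeff g i l r p else 0) - (if i = l then prodCoeff g k j p r else 0)

/-- The defining relations of the super Yangian: the coefficients of
`(u - v) [t i j (u), t k l (v)] = ± (t k j (u) t i l (v) - t k j (v) t i l (u))`. -/
inductive YangianRel (s : Fin κ → ℤˣ) : FreeGen κ → FreeGen κ → Prop
  | comm (i j k l : Fin κ) (r p : ℤ) : YangianRel s
      (scomm s (fun _ => 1) i j (r + 1) k l p - scomm s (fun _ => 1) i j r k l (p + 1))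
      (sgn3 s i j k • exch (fun _ => 1) i j k l r p)

/-- The constant terms `ε i` of the diagonal series `b i i (u)`. -/
noncomputable def signs (ε : Fin κ → ℤˣ) (i : Fin κ) : ℂ := sgn (ε i)

/-- The defining relations of the twisted super Yangian of type AIII: the coefficients of the
supercommutation relation, multiplied by `u ^ 2 - v ^ 2`,
`(u² - v²) [b i j (u), b k l (v)] = ± (u + v) (b k j (u) b i l (v) - b k j (v) b i l (u))`
`  ± (u - v) (δ k j ∑ a, b i a (u) b a l (v) - δ i l ∑ a, b k a (v) b a j (u))`
`  - δ i j (∑ a, b k a (u) b a l (v) - ∑ a, b k a (v) b a l (u))`,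
and of the unitary condition `∑ a, b i a (u) b a j (-u) = δ i j`. -/
inductive TwistedRel (s ε : Fin κ → ℤˣ) : FreeGen κ → FreeGen κ → Prop
  | comm (i j k l : Fin κ) (r p : ℤ) : TwistedRel s ε
      (scomm s (signs ε) i j (r + 2) k l p - scomm s (signs ε) i j r k l (p + 2))
      (sgn3 s i j k • (exch (signs ε) i j k l (r + 1) p + exch (signs ε) i j k l r (p + 1))
        + sgn3 s i j k •
          (contr (signs ε) i j k l (r + 1) p - contr (signs ε) i j k l r (p + 1))
        - (if i = j then prodCoeff (signs ε) k l r p - prodCoeff (signs ε) k l p r else 0))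
  | unitary (i j : Fin κ) (r : ℕ) : TwistedRel s ε
      (∑ m ∈ Finset.HasAntidiagonal.antidiagonal r,
        ((-1 : ℂ) ^ m.2) • prodCoeff (signs ε) i j (m.1 : ℤ) (m.2 : ℤ))
      (if i = j ∧ r = 0 then 1 else 0)

/-- The super Yangian `Y_s`. -/
abbrev Yangian (s : Fin κ → ℤˣ) : Type := RingQuot (YangianRel s)

/-- The twisted super Yangian `B_{s,ε}` of type AIII. -/
abbrev Twisted (s ε : Fin κ → ℤˣ) : Type := RingQuot (TwistedRel s ε)

/-- The coefficient of `u ^ (-r)` in `t i j (u)`; for `r = 0` it is `δ i j`. -/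
noncomputable def tCoeff (s : Fin κ → ℤˣ) (i j : Fin κ) (r : ℕ) : Yangian s :=
  RingQuot.mkAlgHom ℂ (YangianRel s) (gen (fun _ => 1) i j (r : ℤ))

/-- The coefficient of `u ^ (-r)` in `b i j (u)`; for `r = 0` it is `δ i j * ε i`. -/
noncomputable def bCoeff (s ε : Fin κ → ℤˣ) (i j : Fin κ) (r : ℕ) : Twisted s ε :=
  RingQuot.mkAlgHom ℂ (TwistedRel s ε) (gen (signs ε) i j (r : ℤ))

/-! ### Series of matrices, and the embedding of the twisted super Yangian -/

/-- `κ × κ` matrices of formal series in `u⁻¹` over `A`. -/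
abbrev MatSeries (κ : ℕ) (A : Type*) : Type _ := PowerSeries (Matrix (Fin κ) (Fin κ) A)

/-- The matrix with entries `∑ r, (x i j r) u ^ (-r)`. -/
def series {A : Type*} (x : Fin κ → Fin κ → ℕ → A) : MatSeries κ A :=
  PowerSeries.mk fun r => Matrix.of fun i j => x i j r

/-- The `(i, j)` entry of the coefficient of `u ^ (-r)`. -/
noncomputable def entry {A : Type*} [Semiring A] (F : MatSeries κ A) (i j : Fin κ) (r : ℕ) : A :=
  PowerSeries.coeff r F i j

/-- `F (u) ↦ F (-u)`. -/
noncomputable def negArg {A : Type*} [Ring A] (F : MatSeries κ A) : MatSeries κ A :=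
  PowerSeries.mk fun r => (-1) ^ r * PowerSeries.coeff r F

/-- The inverse matrix `T(u)⁻¹ = (t' i j (u))` of a matrix series with constant term `1`. -/
noncomputable def inverse {A : Type*} [Ring A] (T : MatSeries κ A) : MatSeries κ A :=
  PowerSeries.invOfUnit T 1

/-- `T(u) G T(-u)⁻¹`, where `G` is the diagonal matrix with entries `ε i`. -/
noncomputable def reflect {A : Type*} [Ring A] [Algebra ℂ A] (ε : Fin κ → ℤˣ)
    (T : MatSeries κ A) : MatSeries κ A :=
  T * PowerSeries.C (Matrix.diagonal fun i => algebraMap ℂ A (sgn (ε i))) * negArg (inverse T)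

/-- `φ` is the homomorphism `B(u) ↦ T(u) G T(-u)⁻¹`, along which modules over the super Yangian
are restricted to the twisted super Yangian. -/
def IsTwistedEmbedding {s ε : Fin κ → ℤˣ} (φ : Twisted s ε →ₐ[ℂ] Yangian s) : Prop :=
  ∀ i j r, φ (bCoeff s ε i j r) = entry (reflect ε (series (tCoeff s))) i j r

/-! ### Modules

A vector superspace is a complex vector space `V` with its parity involution `σ`, which is `1` on
the even part and `-1` on the odd part. -/

section Modules

variable {A : Type*} [Ring A] [Algebra ℂ A] {V : Type*} [AddCommGroup V] [Module ℂ V]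

/-- `ρ` makes the superspace `(V, σ)` a module over a superalgebra that is generated by elements
`x i j r` of parity `|i| + |j|`: each of them acts by an operator of this parity. -/
structure IsSuperModule (s : Fin κ → ℤˣ) (x : Fin κ → Fin κ → ℕ → A) (σ : Module.End ℂ V)
    (ρ : A →ₐ[ℂ] Module.End ℂ V) : Prop where
  sq : σ * σ = 1
  homogeneous : ∀ i j r,
    σ * ρ (x i j r) = ((-1 : ℂ) ^ (par s i + par s j)) • (ρ (x i j r) * σ)

/-- A subspace that is stable under the action. -/
def IsInvariant (ρ : A →ₐ[ℂ] Module.End ℂ V) (W : Submodule ℂ V) : Prop :=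
  ∀ x, ∀ v ∈ W, ρ x v ∈ W

/-- Irreducibility as a supermodule: no graded submodules but `0` and `V`. -/
def IsSuperIrreducible (σ : Module.End ℂ V) (ρ : A →ₐ[ℂ] Module.End ℂ V) : Prop :=
  Nontrivial V ∧
    ∀ W : Submodule ℂ V, (∀ v ∈ W, σ v ∈ W) → IsInvariant ρ W → W = ⊥ ∨ W = ⊤

/-- Irreducibility in the strongest sense: no invariant subspaces, graded or not, but `0` and
`V`. -/
def IsStronglyIrreducible (ρ : A →ₐ[ℂ] Module.End ℂ V) : Prop :=
  Nontrivial V ∧ ∀ W : Submodule ℂ V, IsInvariant ρ W → W = ⊥ ∨ W = ⊤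

/-- `η` is a highest weight vector of weight `μ (u)`, and generates the module `V`. -/
structure IsHighestWeightVector {s ε : Fin κ → ℤˣ} (ρ : Twisted s ε →ₐ[ℂ] Module.End ℂ V)
    (μ : Fin κ → PowerSeries ℂ) (η : V) : Prop where
  ne_zero : η ≠ 0
  raising : ∀ i j, i < j → ∀ r, ρ (bCoeff s ε i j r) η = 0
  diagonal : ∀ i r, ρ (bCoeff s ε i i r) η = PowerSeries.coeff r (μ i) • η
  generates : ∀ W : Submodule ℂ V, IsInvariant ρ W → η ∈ W → W = ⊤

/-- `M` is the automorphism `B(u) ↦ h(u) B(u)`. -/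
def IsRescaling {s ε : Fin κ → ℤˣ} (h : PowerSeries ℂ) (M : Twisted s ε ≃ₐ[ℂ] Twisted s ε) :
    Prop :=
  ∀ i j r, M (bCoeff s ε i j r) =
    ∑ m ∈ Finset.HasAntidiagonal.antidiagonal r, PowerSeries.coeff m.1 h • bCoeff s ε i j m.2

/-- Two modules are almost isomorphic if the first is isomorphic to the pullback of the second
through an automorphism `B(u) ↦ h(u) B(u)` with `h(u) ∈ 1 + u⁻¹ℂ[[u⁻¹]]` and `h(u) h(-u) = 1`.
Modules that differ by a parity shift only are not distinguished, so that an isomorphism either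
preserves or exchanges the parities. -/
def AlmostIsomorphic {s ε : Fin κ → ℤˣ} {W : Type*} [AddCommGroup W] [Module ℂ W]
    (σ : Module.End ℂ V) (ρ : Twisted s ε →ₐ[ℂ] Module.End ℂ V)
    (σ' : Module.End ℂ W) (ρ' : Twisted s ε →ₐ[ℂ] Module.End ℂ W) : Prop :=
  ∃ (h : PowerSeries ℂ) (M : Twisted s ε ≃ₐ[ℂ] Twisted s ε) (f : V ≃ₗ[ℂ] W),
    PowerSeries.constantCoeff h = 1 ∧ h * PowerSeries.evalNegHom h = 1 ∧ IsRescaling h M ∧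
    (∀ x v, f (ρ x v) = ρ' (M x) (f v)) ∧
    ((∀ v, f (σ v) = σ' (f v)) ∨ (∀ v, f (σ v) = -σ' (f v)))

end Modules

/-! ### Highest weights and polynomials, compared as Laurent series in `u⁻¹` -/

/-- The variable `u` in the field of Laurent series in `u⁻¹`. -/
noncomputable def uVar : LaurentSeries ℂ := HahnSeries.single (-1) 1

/-- `(2 u - ∑_{a > i} s a) μ i (u) + ∑_{a > i} (s a) μ a (u)`. -/
noncomputable def tildeWeight (s : Fin κ → ℤˣ) (μ : Fin κ → PowerSeries ℂ) (i : Fin κ) :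
    LaurentSeries ℂ :=
  (2 * uVar - HahnSeries.C (∑ a ∈ Finset.Ioi i, sgn (s a))) * HahnSeries.ofPowerSeries ℤ ℂ (μ i)
    + ∑ a ∈ Finset.Ioi i, HahnSeries.C (sgn (s a)) * HahnSeries.ofPowerSeries ℤ ℂ (μ a)

/-- The Laurent series of `P(u) / P(-u - c)`. -/
noncomputable def polyRatio (c : ℂ) (P : Polynomial ℂ) : LaurentSeries ℂ :=
  Polynomial.aeval uVar P / Polynomial.aeval (-uVar - HahnSeries.C c) P

/-! ### Tensor products -/

section Tensor

variable {V W : Type*} [AddCommGroup V] [Module ℂ V] [AddCommGroup W] [Module ℂ W]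

/-- The tensor product of two modules over the super Yangian: `t i j (u)` acts on `V ⊗ W` by
`∑ k, t i k (u) ⊗ t k j (u)`, with `(x ⊗ y) (v ⊗ w) = (-1) ^ (|y||v|) (x v ⊗ y w)`. Here `σ` is
the parity involution of `V`. -/
noncomputable def tensorSeries (s : Fin κ → ℤˣ) (σ : Module.End ℂ V)
    (T : MatSeries κ (Module.End ℂ V)) (T' : MatSeries κ (Module.End ℂ W)) :
    MatSeries κ (Module.End ℂ (V ⊗[ℂ] W)) :=
  series fun i j r => ∑ m ∈ Finset.HasAntidiagonal.antidiagonal r, ∑ k,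
    TensorProduct.map (entry T i k m.1 * σ ^ (par s k + par s j)) (entry T' k j m.2)

/-- The tensor product of a module over the super Yangian and a module over the twisted super
Yangian: `b i j (u)` acts on `V ⊗ W` by
`∑ a c, (-1) ^ ((|c| + |j|) (|a| + |c|)) t i a (u) t' c j (-u) ⊗ b a c (u)`, with the same rule
of signs. -/
noncomputable def coidealSeries (s : Fin κ → ℤˣ) (σ : Module.End ℂ V)
    (T : MatSeries κ (Module.End ℂ V)) (B : MatSeries κ (Module.End ℂ W)) :
    MatSeries κ (Module.End ℂ (V ⊗[ℂ] W)) :=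
  series fun i j r => ∑ m ∈ Finset.HasAntidiagonal.antidiagonal r, ∑ a, ∑ c,
    ((-1 : ℂ) ^ ((par s c + par s j) * (par s a + par s c))) •
      TensorProduct.map
        ((∑ n ∈ Finset.HasAntidiagonal.antidiagonal m.1,
            entry T i a n.1 * entry (negArg (inverse T)) c j n.2)
          * σ ^ (par s a + par s c))
        (entry B a c m.2)

/-- `ρ` is the tensor product of the module `τ` over the super Yangian and the module `χ` over
the twisted super Yangian. -/
def IsTensorModule {s ε : Fin κ → ℤˣ} (σ : Module.End ℂ V)
    (τ : Yangian s →ₐ[ℂ] Module.End ℂ V) (χ : Twisted s ε →ₐ[ℂ] Module.End ℂ W)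
    (ρ : Twisted s ε →ₐ[ℂ] Module.End ℂ (V ⊗[ℂ] W)) : Prop :=
  ∀ i j r, ρ (bCoeff s ε i j r) =
    entry (coidealSeries s σ (series fun i j r => τ (tCoeff s i j r))
      (series fun i j r => χ (bCoeff s ε i j r))) i j r

end Tensor

/-- `χ` is the one-dimensional module `ℂ_γ`: `b i j (u)` acts by
`δ i j (ε i u + γ) / (u - γ) = δ i j (ε i + γ u⁻¹) / (1 - γ u⁻¹)`. -/
def IsOneDimModule {s ε : Fin κ → ℤˣ} (γ : ℂ) (χ : Twisted s ε →ₐ[ℂ] Module.End ℂ ℂ) : Prop :=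
  ∀ i j r, χ (bCoeff s ε i j r) =
    (if i = j then PowerSeries.coeff r
      ((PowerSeries.C (sgn (ε i)) + PowerSeries.C γ * PowerSeries.X)
        * (1 - PowerSeries.C γ * PowerSeries.X)⁻¹) else 0) • (1 : Module.End ℂ ℂ)

/-! ### Tensor products of evaluation modules in rank one

For `s 0 ≠ s 1` and `a + b ≠ 0`, the irreducible module `L(a, b)` over `𝔤𝔩(1|1)` with the highest
weight `(a, b)` has a basis `v⁺` (even), `v⁻ = e₂₁ v⁺` (odd). -/

/-- The action of `e i j` on `L(a, b)`, in the basis `v⁺, v⁻`. -/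
noncomputable def evalE (a b : ℂ) : Fin 2 → Fin 2 → Module.End ℂ (Fin 2 → ℂ) :=
  ![![Matrix.toLin' !![a, 0; 0, a - 1], Matrix.toLin' !![0, a + b; 0, 0]],
    ![Matrix.toLin' !![0, 0; 1, 0], Matrix.toLin' !![b, 0; 0, b + 1]]]

/-- The parity involution of `L(a, b)`. -/
noncomputable def evalParity : Module.End ℂ (Fin 2 → ℂ) := Matrix.toLin' !![1, 0; 0, -1]

/-- The evaluation module `L(a, b)` over the super Yangian:
`t i j (u) = δ i j + (s i) e i j u⁻¹`. -/
noncomputable def evalSeries (s : Fin 2 → ℤˣ) (a b : ℂ) :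
    MatSeries 2 (Module.End ℂ (Fin 2 → ℂ)) :=
  series fun i j r =>
    if r = 0 then (if i = j then 1 else 0)
    else if r = 1 then sgn (s i) • evalE a b i j else 0

/-- The space of `L(a₁, b₁) ⊗ (L(a₂, b₂) ⊗ (⋯ ⊗ (L(aₖ, bₖ) ⊗ ℂ)))` for the list of the pairs
`(aᵢ, bᵢ)`, where `ℂ` is the trivial module, the unit for the tensor product. -/
noncomputable def tensorSpace : List (ℂ × ℂ) → ModuleCat.{0} ℂ
  | [] => ModuleCat.of ℂ ℂ
  | _ :: L => ModuleCat.of ℂ ((Fin 2 → ℂ) ⊗[ℂ] (tensorSpace L))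

/-- The parity involution of the tensor product. -/
noncomputable def tensorParity : (L : List (ℂ × ℂ)) → Module.End ℂ (tensorSpace L)
  | [] => (1 : Module.End ℂ ℂ)
  | _ :: L => (TensorProduct.map evalParity (tensorParity L) :
      Module.End ℂ ((Fin 2 → ℂ) ⊗[ℂ] (tensorSpace L)))

/-- The action of `T(u)` on the tensor product. -/
noncomputable def tensorEvalSeries (s : Fin 2 → ℤˣ) :
    (L : List (ℂ × ℂ)) → MatSeries 2 (Module.End ℂ (tensorSpace L))
  | [] => (1 : MatSeries 2 (Module.End ℂ ℂ))
  | p :: L => (tensorSeries s evalParity (evalSeries s p.1 p.2) (tensorEvalSeries s L) :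
      MatSeries 2 (Module.End ℂ ((Fin 2 → ℂ) ⊗[ℂ] (tensorSpace L))))

/-- `τ` is the tensor product of the evaluation modules `L(aᵢ, bᵢ)`. -/
def IsEvalTensorModule {s : Fin 2 → ℤˣ} (L : List (ℂ × ℂ))
    (τ : Yangian s →ₐ[ℂ] Module.End ℂ (tensorSpace L)) : Prop :=
  ∀ i j r, τ (tCoeff s i j r) = entry (tensorEvalSeries s L) i j r

/-- The pairs `(aᵢ, bᵢ)`, `1 ≤ i ≤ k`, made of `a₁, …, a_l`, with `k = ⌊(l + 1) / 2⌋`: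
`bᵢ = a_{i+k} - 1`, except that `bₖ = -1/2` for odd `l`. -/
noncomputable def pairsEq (l : ℕ) (a : ℕ → ℂ) : List (ℂ × ℂ) :=
  (List.range' 1 ((l + 1) / 2)).map fun i =>
    (a i, if Odd l ∧ i = (l + 1) / 2 then -1 / 2 else a (i + (l + 1) / 2) - 1)

/-- The pairs `(aᵢ, bᵢ)`, `1 ≤ i ≤ k`, made of `a₁, …, a_l`, with `k = ⌊l / 2⌋`:
`bᵢ = a_{i+k} - 1`, except that `bₖ = -1/2` for even `l`. -/
noncomputable def pairsNe (l : ℕ) (a : ℕ → ℂ) : List (ℂ × ℂ) :=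
  (List.range' 1 (l / 2)).map fun i =>
    (a i, if Even l ∧ i = l / 2 then -1 / 2 else a (i + l / 2) - 1)

/-- `γ = ε₁ s₁ (a_l - 1)`; for `l = 0`, where there is no `a_l`, the value `1/2` takes its
place. -/
noncomputable def gammaParam (s ε : Fin 2 → ℤˣ) (l : ℕ) (a : ℕ → ℂ) : ℂ :=
  sgn (ε 0) * sgn (s 0) * ((if l = 0 then 1 / 2 else a l) - 1)

end TwistedSuperYangian

open TwistedSuperYangian

/-!
The defining relations of both superalgebras are matrix identities. Put `P` for the graded
permutation, `R(u) = u - P`, and write a series of `2 × 2` matrices in one of two tensor legs; the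
relations of the super Yangian become `R(u - v) T₁(u) T₂(v) = T₂(v) T₁(u) R(u - v)`, and those of
the twisted super Yangian the reflection equation
`R(u - v) B₁(u) R(u + v) B₂(v) = B₂(v) R(u + v) B₁(u) R(u - v)` with `B(u) B(-u) = 1`
(`isRTT_iff_relations`, `isReflection_iff_relations`). So homomorphisms out of the two algebras
are solutions of these equations. If `G(u)` solves the reflection equation and `T(u)` is a solution
of the `RTT` relation that supercommutes with it, then `T(u) G(u) T(-u)⁻¹` solves the reflection
equation (`IsReflection.reflectBy`). For a constant diagonal `G` this gives the homomorphism to the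
super Yangian, for `G + γ u⁻¹` times a scalar series the one-dimensional module, and for `G` acting
on another module the tensor product (`coidealSeries_eq`). All modules in the theorem
therefore arise from a diagonal boundary matrix by tensoring with one evaluation module at a time.

Irreducibility is shown for one factor at a time. A module is irreducible as soon as it has a
unique vector `ξ` killed by `b₁₂(u)`, a unique functional `ξ'` killed by the transpose of `b₂₁(u)`,
and `ξ' ξ ≠ 0`: the coefficient of `u⁻¹` in `b₁₁(u)` is a grading operator, so that every nonzero
invariant subspace contains `ξ`, and the annihilator of a proper one contains `ξ'`
(`IsExtremalPair.isStronglyIrreducible`). This property passes from `M` to `L(a, b) ⊗ M`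
(`IsExtremalPair.evalTensor`). Indeed, for a vector of `L(a, b) ⊗ M` killed by `b₁₂(u)` the
condition is an identity of polynomials in `t = s₁ u⁻¹`, and its value at `t = -1/a` (at `t = -1` if
`a = 0`) forces the component along `v⁻` to vanish, unless this value is a zero of one of the two
polynomials `p` and `R` that record the highest weight of `M`; for functionals the same holds with
`b + 1` in place of `a` (`eq_zero_of_evaluation`). Thus every factor contributes two nodes `a` and
`b + 1`, and all that is needed is that no two nodes, of the same or of different factors, have sum
`1`. For the given parameters the nodes are `a₁, …, a_l`, with `1/2` added when their number has the
wrong parity, and the condition is the coprimality of `P(u)` and `P(-u - s₁)`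
(`add_ne_one_of_isCoprime`). In the case of different signs the last node is that of the
one-dimensional module.

Each node `c` multiplies the ratio of the highest weight by `(1 + c t) / (1 + (1 - c) t)`, which is
`1` for the node `1/2`; hence the modules have the prescribed ratio (`IsExtremalPair.ratio`,
`prod_nodeRatio`). Conversely, the ratio determines the highest weight up to a scalar series `h(u)`,
and `h(u) h(-u) = 1` by unitarity (`almostIsomorphic_of_ratio`). Two irreducible modules with the
same highest weight are isomorphic: the submodule of their direct sum that is generated by the
sum of the highest weight vectors is the graph of an isomorphism, because its vectors of highest
weight are multiples of one vector (`IsSingular.mem_span`, `exists_intertwiner`).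
-/

namespace TwistedSuperYangian

/-! ### Formal series in two variables -/

/-- Formal series in `x = u⁻¹` (the inner variable) and `y = v⁻¹` (the outer one). -/
abbrev BiSeries (N : Type*) : Type _ := PowerSeries (PowerSeries N)

section BiSeries

variable {N : Type*} [Ring N]

/-- A series in `x`, as a series in two variables. -/
noncomputable def inX : PowerSeries N →+* BiSeries N := PowerSeries.C

/-- A series in `y`, as a series in two variables. -/
noncomputable def inY : PowerSeries N →+* BiSeries N := PowerSeries.map PowerSeries.C

/-- The variable `x = u⁻¹`. -/
noncomputable def xVar : BiSeries N := PowerSeries.C PowerSeries.X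

/-- The variable `y = v⁻¹`. -/
noncomputable def yVar : BiSeries N := PowerSeries.X

theorem yVar_comm (f : BiSeries N) : f * yVar = yVar * f := (PowerSeries.commute_X f).eq

theorem xVar_comm (f : BiSeries N) : f * xVar = xVar * f := by
  ext1 n
  simp only [xVar, PowerSeries.coeff_mul_C, PowerSeries.coeff_C_mul]
  exact (PowerSeries.commute_X _).eq

/-- The substitution `u ↦ -u` in a series with coefficients in a ring that need not be
commutative. -/
noncomputable def negHom : PowerSeries N →+* PowerSeries N where
  toFun f := PowerSeries.mk fun r => (-1) ^ r * PowerSeries.coeff r f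
  map_one' := by
    ext r
    rcases r with _ | r <;> simp [PowerSeries.coeff_one]
  map_zero' := by ext r; simp
  map_add' f g := by ext r; simp [mul_add]
  map_mul' f g := by
    ext r
    simp only [PowerSeries.coeff_mk, PowerSeries.coeff_mul, Finset.mul_sum]
    refine Finset.sum_congr rfl fun m hm => ?_
    rw [← Finset.HasAntidiagonal.mem_antidiagonal.1 hm, pow_add]
    have h : Commute (PowerSeries.coeff m.1 f) ((-1 : N) ^ m.2) :=
      (Commute.neg_one_right _).pow_right _
    simp only [mul_assoc]
    rw [← mul_assoc (PowerSeries.coeff m.1 f), h.eq, mul_assoc]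

theorem coeff_negHom (f : PowerSeries N) (r : ℕ) :
    PowerSeries.coeff r (negHom f) = (-1) ^ r * PowerSeries.coeff r f := by
  simp [negHom]

@[simp] theorem negHom_X : negHom (PowerSeries.X : PowerSeries N) = -PowerSeries.X := by
  ext r
  by_cases h : r = 1 <;> simp [coeff_negHom, PowerSeries.coeff_X, h]

@[simp] theorem negHom_C (a : N) : negHom (PowerSeries.C a) = PowerSeries.C a := by
  ext r
  by_cases h : r = 0 <;> simp [coeff_negHom, PowerSeries.coeff_C, h]

theorem negHom_negHom (f : PowerSeries N) : negHom (negHom f) = f := by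
  ext r
  rw [coeff_negHom, coeff_negHom, ← mul_assoc, ← pow_add, ← two_mul]
  simp

theorem map_negHom {N' : Type*} [Ring N'] (φ : N →+* N') (f : PowerSeries N) :
    PowerSeries.map φ (negHom f) = negHom (PowerSeries.map φ f) := by
  ext r
  simp [coeff_negHom]

/-- The substitution `u ↦ -u` in a series in two variables. -/
noncomputable def negX : BiSeries N →+* BiSeries N := PowerSeries.map negHom

/-- The substitution `v ↦ -v` in a series in two variables. -/
noncomputable def negY : BiSeries N →+* BiSeries N := negHom

theorem negX_xVar : negX (xVar : BiSeries N) = -xVar := by simp [negX, xVar]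

theorem negX_yVar : negX (yVar : BiSeries N) = yVar := by simp [negX, yVar]

theorem negY_xVar : negY (xVar : BiSeries N) = xVar := by simp [negY, xVar]

theorem negY_yVar : negY (yVar : BiSeries N) = -yVar := by simp [negY, yVar]

theorem negX_inX (f : PowerSeries N) : negX (inX f) = inX (negHom f) := by simp [negX, inX]

theorem negX_inY (f : PowerSeries N) : negX (inY f) = inY f := by
  ext1 n
  simp [negX, inY]

theorem negY_inX (f : PowerSeries N) : negY (inX f) = inX f := by simp [negY, inX]

theorem negY_inY (f : PowerSeries N) : negY (inY f) = inY (negHom f) := by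
  ext1 n
  simp [negY, inY, coeff_negHom]

/-- A series whose constant coefficient is a left nonzerodivisor is one too. -/
theorem eq_zero_of_mul_eq_zero_of_constantCoeff {S : Type*} [Ring S] {c f : PowerSeries S}
    (hc : ∀ a : S, PowerSeries.coeff 0 c * a = 0 → a = 0) (h : c * f = 0) : f = 0 := by
  ext n
  induction n using Nat.strong_induction_on with
  | _ n ih =>
    have h1 : PowerSeries.coeff n (c * f) = 0 := by simp [h]
    rw [PowerSeries.coeff_mul, Finset.sum_eq_single (0, n)] at h1
    · simpa using hc _ h1
    · rintro ⟨p, q⟩ hpq hne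
      rw [Finset.HasAntidiagonal.mem_antidiagonal] at hpq
      have hq : q < n := by
        rcases Nat.eq_zero_or_pos p with hp | hp
        · exact absurd (by simp_all) hne
        · omega
      simp only [ih q hq, map_zero, mul_zero]
    · intro hn
      exact absurd (by simp) hn

/-- The product `(x + ε y) ^ 2 - x ^ 2 y ^ 2` of two `R`-matrices that differ by the sign of the
permutation is a nonzerodivisor: its constant coefficient in `y` is `x ^ 2`. -/
theorem cancel_quadratic (ε : ℤ) {f g : BiSeries N}
    (h : ((xVar + ε • yVar) * (xVar + ε • yVar) - xVar * xVar * (yVar * yVar) : BiSeries N) * f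
      = ((xVar + ε • yVar) * (xVar + ε • yVar) - xVar * xVar * (yVar * yVar)) * g) : f = g := by
  rw [← sub_eq_zero, ← mul_sub] at h
  refine sub_eq_zero.1 (eq_zero_of_mul_eq_zero_of_constantCoeff (fun a ha => ?_) h)
  have h2 : PowerSeries.coeff 0 ((xVar + ε • yVar) * (xVar + ε • yVar)
      - xVar * xVar * (yVar * yVar) : BiSeries N) = PowerSeries.X * PowerSeries.X := by
    simp [xVar, yVar]
  rw [h2, mul_assoc] at ha
  have h3 : ∀ b : PowerSeries N, PowerSeries.X * b = 0 → b = 0 := fun b hb =>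
    PowerSeries.X_mul_cancel (by simpa using hb)
  exact h3 _ (h3 _ ha)

/-- The coefficient of `x ^ r * y ^ p`, for integers `r` and `p`. -/
noncomputable def bicoeff (f : BiSeries N) (r p : ℤ) : N :=
  if 0 ≤ r ∧ 0 ≤ p then PowerSeries.coeff r.toNat (PowerSeries.coeff p.toNat f) else 0

/-- The coefficient of `x ^ r`, for an integer `r`. -/
noncomputable def zcoeff (f : PowerSeries N) (r : ℤ) : N :=
  if 0 ≤ r then PowerSeries.coeff r.toNat f else 0

theorem zcoeff_natCast (f : PowerSeries N) (r : ℕ) : zcoeff f r = PowerSeries.coeff r f := by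
  simp [zcoeff]

theorem bicoeff_ext {f g : BiSeries N} (h : ∀ r p : ℕ, bicoeff f r p = bicoeff g r p) :
    f = g := by
  ext p r
  simpa [bicoeff] using h r p

theorem bicoeff_add (f g : BiSeries N) (r p : ℤ) :
    bicoeff (f + g) r p = bicoeff f r p + bicoeff g r p := by
  unfold bicoeff; split_ifs <;> simp

theorem bicoeff_sub (f g : BiSeries N) (r p : ℤ) :
    bicoeff (f - g) r p = bicoeff f r p - bicoeff g r p := by
  unfold bicoeff; split_ifs <;> simp

theorem bicoeff_xVar_mul (f : BiSeries N) (r p : ℤ) :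
    bicoeff (xVar * f) r p = bicoeff f (r - 1) p := by
  unfold bicoeff xVar
  by_cases hp : 0 ≤ p
  · by_cases hr : 0 ≤ r - 1
    · obtain ⟨n, rfl⟩ : ∃ n : ℕ, r = n + 1 :=
        ⟨(r - 1).toNat, by rw [Int.toNat_of_nonneg ‹_›]; ring⟩
      have h : ((n : ℤ) + 1).toNat = n + 1 := by omega
      have h0 : (0 : ℤ) ≤ n + 1 := by omega
      simp [hp, h, h0]
    · rw [if_neg (c := 0 ≤ r - 1 ∧ 0 ≤ p) (by omega)]
      split_ifs with h
      · have h0 : r = 0 := by omega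
        subst h0
        simp
      · rfl
  · simp [hp]

theorem bicoeff_yVar_mul (f : BiSeries N) (r p : ℤ) :
    bicoeff (yVar * f) r p = bicoeff f r (p - 1) := by
  unfold bicoeff yVar
  by_cases hr : 0 ≤ r
  · by_cases hp : 0 ≤ p - 1
    · obtain ⟨n, rfl⟩ : ∃ n : ℕ, p = n + 1 :=
        ⟨(p - 1).toNat, by rw [Int.toNat_of_nonneg ‹_›]; ring⟩
      have h : ((n : ℤ) + 1).toNat = n + 1 := by omega
      have h0 : (0 : ℤ) ≤ n + 1 := by omega
      simp [hr, h, h0]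
    · rw [if_neg (c := 0 ≤ r ∧ 0 ≤ p - 1) (by omega)]
      split_ifs with h
      · have h0 : p = 0 := by omega
        subst h0
        simp
      · rfl
  · simp [hr]

theorem bicoeff_inX_mul_inY (f g : PowerSeries N) (r p : ℤ) :
    bicoeff (inX f * inY g) r p = zcoeff f r * zcoeff g p := by
  unfold bicoeff zcoeff inX inY
  split_ifs <;> simp_all

theorem bicoeff_inY_mul_inX (f g : PowerSeries N) (r p : ℤ) :
    bicoeff (inY g * inX f) r p = zcoeff g p * zcoeff f r := by
  unfold bicoeff zcoeff inX inY
  split_ifs <;> simp_all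

theorem bicoeff_mul_C (f : BiSeries N) (a : N) (r p : ℤ) :
    bicoeff (f * inX (PowerSeries.C a)) r p = bicoeff f r p * a := by
  unfold bicoeff inX
  split_ifs <;> simp

theorem inX_C (a : N) : inX (PowerSeries.C a) = inY (PowerSeries.C a) := by
  simp [inX, inY]

end BiSeries

/-! ### The `RTT` relation and the reflection equation in an arbitrary ring -/

section Abstract

variable {R : Type*} [Ring R]

/-- `T(u) G T(-u)⁻¹` solves the reflection equation when `G` does: here `Tᵢ` stands for `T(u)` or
`T(v)` in the tensor leg `i`, `Sᵢ` for `T(-u)⁻¹` or `T(-v)⁻¹`, and `ρm`, `ρp` for the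
`R`-matrices in `u - v` and `u + v`. -/
theorem reflection_of_rtt {ρm ρp T₁ T₂ S₁ S₂ G₁ G₂ : R}
    (h1 : ρm * T₁ * T₂ = T₂ * T₁ * ρm) (h2 : S₂ * ρp * T₁ = T₁ * ρp * S₂)
    (h3 : S₁ * ρp * T₂ = T₂ * ρp * S₁) (h4 : ρm * S₁ * S₂ = S₂ * S₁ * ρm)
    (c1 : G₁ * T₂ = T₂ * G₁) (c2 : G₂ * T₁ = T₁ * G₂) (c3 : G₁ * S₂ = S₂ * G₁)
    (c4 : G₂ * S₁ = S₁ * G₂) (hG : ρm * G₁ * ρp * G₂ = G₂ * ρp * G₁ * ρm) :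
    ρm * (T₁ * G₁ * S₁) * ρp * (T₂ * G₂ * S₂) = (T₂ * G₂ * S₂) * ρp * (T₁ * G₁ * S₁) * ρm := by
  calc ρm * (T₁ * G₁ * S₁) * ρp * (T₂ * G₂ * S₂)
      = ρm * T₁ * G₁ * (S₁ * ρp * T₂) * G₂ * S₂ := by noncomm_ring
    _ = ρm * T₁ * (G₁ * T₂) * ρp * (S₁ * G₂) * S₂ := by rw [h3]; noncomm_ring
    _ = (ρm * T₁ * T₂) * G₁ * ρp * G₂ * S₁ * S₂ := by rw [c1, ← c4]; noncomm_ring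
    _ = T₂ * T₁ * (ρm * G₁ * ρp * G₂) * S₁ * S₂ := by rw [h1]; noncomm_ring
    _ = T₂ * (T₁ * G₂) * ρp * G₁ * (ρm * S₁ * S₂) := by rw [hG]; noncomm_ring
    _ = T₂ * G₂ * T₁ * ρp * (G₁ * S₂) * S₁ * ρm := by rw [← c2, h4]; noncomm_ring
    _ = T₂ * G₂ * (T₁ * ρp * S₂) * G₁ * S₁ * ρm := by rw [c3]; noncomm_ring
    _ = _ := by rw [← h2]; noncomm_ring

/-- Inverting the second factor `T` in an exchange relation moves it past the `R`-matrix. -/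
theorem inv_conj {ρ T S A : R} (hST : S * T = 1) (hTS : T * S = 1) (h : ρ * A * T = T * A * ρ) :
    S * ρ * A = A * ρ * S := by
  calc S * ρ * A = S * (ρ * A * T) * S := by simp only [mul_assoc, hTS, mul_one]
    _ = (S * T) * A * ρ * S := by rw [h]; noncomm_ring
    _ = _ := by rw [hST, one_mul]

theorem inv_conj_mul {ρ T T' S S' : R} (hS : S * T = 1) (hS' : S' * T' = 1) (hT : T * S = 1)
    (hT' : T' * S' = 1) (h : ρ * T' * T = T * T' * ρ) : ρ * S * S' = S' * S * ρ := by
  calc ρ * S * S' = S' * (S * T) * T' * ρ * S * S' := by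
        rw [hS, mul_one, hS', one_mul]
    _ = S' * S * (T * T' * ρ) * S * S' := by noncomm_ring
    _ = S' * S * ρ * T' * (T * S) * S' := by rw [← h]; noncomm_ring
    _ = S' * S * ρ := by rw [hT, mul_one, mul_assoc _ T', hT', mul_one]

variable {x y P : R}

/-- The expansion of the `RTT` relation; all occurrences of the permutation `P` are moved to the
right. -/
theorem rtt_expand (hx : ∀ a : R, a * x = x * a) (hy : ∀ a : R, a * y = y * a)
    {A₁ A₂ B₁ B₂ : R} (hA : P * A₁ = A₂ * P) (hB' : P * B₂ = B₁ * P) :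
    (y - x - x * y * P) * A₁ * B₂ - B₂ * A₁ * (y - x - x * y * P)
      = y * (A₁ * B₂ - B₂ * A₁) - x * (A₁ * B₂ - B₂ * A₁)
        - x * (y * ((A₂ * B₁ - B₂ * A₁) * P)) := by
  have e1 : P * A₁ * B₂ = A₂ * B₁ * P := by rw [hA, mul_assoc, hB', mul_assoc]
  have e2 : B₂ * A₁ * (y - x - x * y * P)
      = y * (B₂ * A₁) - x * (B₂ * A₁) - x * (y * (B₂ * A₁ * P)) := by
    have e : B₂ * A₁ * (x * y * P) = x * (y * (B₂ * A₁ * P)) := by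
      rw [← mul_assoc, ← mul_assoc, hx, mul_assoc x, hy, mul_assoc, mul_assoc]
    rw [mul_sub, mul_sub, hx, hy, e]
  have e3 : (y - x - x * y * P) * A₁ * B₂
      = y * (A₁ * B₂) - x * (A₁ * B₂) - x * (y * (P * A₁ * B₂)) := by noncomm_ring
  rw [e2, e3, e1]
  noncomm_ring

/-- The expansion of the reflection equation; all occurrences of the permutation `P` are moved to
the right. -/
theorem reflection_expand (hx : ∀ a : R, a * x = x * a) (hy : ∀ a : R, a * y = y * a)
    (hP : P * P = 1) {A₁ A₂ B₁ B₂ : R} (hA : P * A₁ = A₂ * P)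
    (hB' : P * B₂ = B₁ * P) :
    (y - x - x * y * P) * A₁ * (x + y - x * y * P) * B₂
        - B₂ * (x + y - x * y * P) * A₁ * (y - x - x * y * P)
      = y * (y * (A₁ * B₂ - B₂ * A₁)) - x * (x * (A₁ * B₂ - B₂ * A₁))
        - x * (y * (x * ((A₂ * B₁ - B₂ * A₁) * P)))
        - x * (y * (y * ((A₂ * B₁ - B₂ * A₁) * P)))
        - x * (y * (y * ((A₁ * B₁ - B₂ * A₂) * P)))
        + x * (y * (x * ((A₁ * B₁ - B₂ * A₂) * P)))
        + x * (x * (y * (y * (A₂ * B₂ - B₂ * A₂)))) := by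
  have c : ∀ a b z : R, (∀ a : R, a * z = z * a) → a * (z * b) = z * (a * b) := by
    intro a b z hz
    rw [← mul_assoc, hz, mul_assoc]
  have cx : ∀ a b : R, a * (x * b) = x * (a * b) := fun a b => c a b x hx
  have cy : ∀ a b : R, a * (y * b) = y * (a * b) := fun a b => c a b y hy
  have e1 : P * (A₁ * B₂) = A₂ * (B₁ * P) := by rw [← mul_assoc, hA, mul_assoc, hB']
  have e2 : A₁ * (P * B₂) = A₁ * (B₁ * P) := by rw [hB']
  have e3 : P * (A₁ * (P * B₂)) = A₂ * B₂ := by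
    rw [← mul_assoc, hA, mul_assoc, ← mul_assoc P P, hP, one_mul]
  have e4 : B₂ * (P * A₁) = B₂ * (A₂ * P) := by rw [hA]
  have e5 : B₂ * (P * (A₁ * P)) = B₂ * A₂ := by
    rw [← mul_assoc P, hA, mul_assoc A₂, hP, mul_one]
  have p1 : (y - x - x * y * P) * A₁ * (x + y - x * y * P) * B₂
      = (y * x + y * y - x * x - x * y) * (A₁ * B₂) - (x + y) * (x * y) * (P * (A₁ * B₂))
        - (y - x) * (x * y) * (A₁ * (P * B₂)) + x * y * (x * y) * (P * (A₁ * (P * B₂))) := by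
    simp only [mul_add, mul_sub, sub_mul, add_mul, mul_assoc]
    simp only [cx P, cy P, cx A₁, cy A₁, cx y]
    abel
  have p2 : B₂ * (x + y - x * y * P) * A₁ * (y - x - x * y * P)
      = (y * x + y * y - x * x - x * y) * (B₂ * A₁) - (x + y) * (x * y) * (B₂ * (A₁ * P))
        - (y - x) * (x * y) * (B₂ * (P * A₁)) + x * y * (x * y) * (B₂ * (P * (A₁ * P))) := by
    simp only [mul_add, mul_sub, sub_mul, add_mul, mul_assoc]
    simp only [hx A₁, hy A₁, cx P, cy P, cx A₁, cy A₁, cx B₂, cy B₂, cx y]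
    abel
  rw [p1, p2, e1, e3, e2, e4, e5]
  simp only [mul_sub, sub_mul, add_mul, mul_assoc]
  simp only [cx y]
  abel

end Abstract

/-! ### The `RTT` relation and the reflection equation as matrix identities -/

section Legs

variable {A : Type*} [Ring A] (s : Fin 2 → ℤˣ)

/-- `4 × 4` matrices, indexed by the pairs of indices of the two tensor legs. -/
abbrev Mat2 (A : Type*) : Type _ := Matrix (Fin 2 × Fin 2) (Fin 2 × Fin 2) A

/-- The graded permutation `e_i ⊗ e_j ↦ (-1) ^ (|i||j|) e_j ⊗ e_i`. -/
def gradedSwap : Mat2 A :=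
  Matrix.of fun p q => if p.1 = q.2 ∧ p.2 = q.1 then (-1) ^ (par s p.1 * par s p.2) else 0

/-- A matrix in the second tensor leg, `1 ⊗ M`. -/
def leg₂ : Matrix (Fin 2) (Fin 2) A →+* Mat2 A where
  toFun M := Matrix.of fun p q => if p.1 = q.1 then M p.2 q.2 else 0
  map_one' := by
    ext ⟨i, k⟩ ⟨j, l⟩
    simp only [Matrix.of_apply, Matrix.one_apply, Prod.mk.injEq]
    split_ifs <;> simp_all
  map_zero' := by ext; simp
  map_add' M M' := by
    ext ⟨i, k⟩ ⟨j, l⟩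
    simp only [Matrix.of_apply, Matrix.add_apply]
    split_ifs <;> simp
  map_mul' M M' := by
    ext ⟨i, k⟩ ⟨j, l⟩
    simp only [Matrix.of_apply, Matrix.mul_apply, Fintype.sum_prod_type]
    by_cases h : i = j
    · subst h
      simp [Finset.sum_ite_irrel]
    · simp only [h, if_false]
      refine (Finset.sum_eq_zero fun a _ => Finset.sum_eq_zero fun b _ => ?_).symm
      by_cases h1 : i = a
      · subst h1; simp [h]
      · simp [h1]

theorem leg₂_apply (M : Matrix (Fin 2) (Fin 2) A) (i k j l : Fin 2) :
    leg₂ M (i, k) (j, l) = if i = j then M k l else 0 := rfl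

theorem gradedSwap_apply (i k j l : Fin 2) :
    (gradedSwap s : Mat2 A) (i, k) (j, l)
      = if i = l ∧ k = j then (-1) ^ (par s i * par s k) else 0 := rfl

theorem par_eq_zero_or_one (i : Fin 2) : par s i = 0 ∨ par s i = 1 := by
  unfold par; split_ifs <;> simp

theorem gradedSwap_mul_self : (gradedSwap s * gradedSwap s : Mat2 A) = 1 := by
  ext ⟨i, k⟩ ⟨j, l⟩
  rw [Matrix.mul_apply, Fintype.sum_prod_type]
  rcases par_eq_zero_or_one s 0 with h0 | h0 <;> rcases par_eq_zero_or_one s 1 with h1 | h1 <;>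
  fin_cases i <;> fin_cases j <;> fin_cases k <;> fin_cases l <;>
    simp [gradedSwap_apply, Fin.sum_univ_two, h0, h1]

/-- A matrix in the first tensor leg, `M ⊗ 1`; the graded permutation produces the signs of the
tensor product of superalgebras. -/
def leg₁ : Matrix (Fin 2) (Fin 2) A →+* Mat2 A where
  toFun M := gradedSwap s * leg₂ M * gradedSwap s
  map_one' := by simp [gradedSwap_mul_self]
  map_zero' := by simp
  map_add' M M' := by simp [mul_add, add_mul]
  map_mul' M M' := by
    have h : ∀ a b : Mat2 A, gradedSwap s * a * gradedSwap s * (gradedSwap s * b * gradedSwap s)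
        = gradedSwap s * a * (gradedSwap s * gradedSwap s) * b * gradedSwap s := by
      intro a b; simp only [mul_assoc]
    rw [map_mul, h, gradedSwap_mul_self, mul_one]
    simp only [mul_assoc]

theorem leg₁_apply (M : Matrix (Fin 2) (Fin 2) A) (i k j l : Fin 2) :
    leg₁ s M (i, k) (j, l)
      = if k = l then (-1) ^ ((par s i + par s j) * par s k) * M i j else 0 := by
  change (gradedSwap s * leg₂ M * gradedSwap s : Mat2 A) (i, k) (j, l) = _
  rw [Matrix.mul_apply, Fintype.sum_prod_type]
  simp only [Matrix.mul_apply, Fintype.sum_prod_type, Fin.sum_univ_two]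
  rcases par_eq_zero_or_one s 0 with h0 | h0 <;> rcases par_eq_zero_or_one s 1 with h1 | h1 <;>
  fin_cases i <;> fin_cases j <;> fin_cases k <;> fin_cases l <;>
    simp [gradedSwap_apply, leg₂_apply, h0, h1]

theorem gradedSwap_mul_leg₁ (M : Matrix (Fin 2) (Fin 2) A) :
    gradedSwap s * leg₁ s M = leg₂ M * gradedSwap s := by
  change gradedSwap s * (gradedSwap s * leg₂ M * gradedSwap s) = _
  rw [← mul_assoc, ← mul_assoc, gradedSwap_mul_self, one_mul]

theorem gradedSwap_mul_leg₂ (M : Matrix (Fin 2) (Fin 2) A) :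
    gradedSwap s * leg₂ M = leg₁ s M * gradedSwap s := by
  change _ = (gradedSwap s * leg₂ M * gradedSwap s) * gradedSwap s
  rw [mul_assoc, gradedSwap_mul_self, mul_one]

theorem leg₁_mul_leg₂_apply (M M' : Matrix (Fin 2) (Fin 2) A) (i k j l : Fin 2) :
    (leg₁ s M * leg₂ M') (i, k) (j, l)
      = (-1) ^ ((par s i + par s j) * par s k) * (M i j * M' k l) := by
  rw [Matrix.mul_apply, Fintype.sum_prod_type]
  simp only [leg₁_apply, leg₂_apply, ite_mul, zero_mul, mul_ite, mul_zero]
  simp [mul_assoc]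

theorem neg_one_pow_mul_comm (n : ℕ) (a b : A) : a * ((-1) ^ n * b) = (-1) ^ n * (a * b) := by
  rw [← mul_assoc, ← mul_assoc, ((Commute.neg_one_right a).pow_right n).eq]

theorem leg₂_mul_leg₁_apply (M M' : Matrix (Fin 2) (Fin 2) A) (i k j l : Fin 2) :
    (leg₂ M' * leg₁ s M) (i, k) (j, l)
      = (-1) ^ ((par s i + par s j) * par s l) * (M' k l * M i j) := by
  rw [Matrix.mul_apply, Fintype.sum_prod_type]
  simp only [leg₁_apply, leg₂_apply, ite_mul, zero_mul, mul_ite, mul_zero]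
  simp [neg_one_pow_mul_comm]

theorem mul_gradedSwap_apply (N : Mat2 A) (i k j l : Fin 2) :
    (N * gradedSwap s : Mat2 A) (i, k) (j, l) = (-1) ^ (par s j * par s l) * N (i, k) (l, j) := by
  rw [Matrix.mul_apply, Fintype.sum_prod_type]
  simp only [gradedSwap_apply]
  rw [Finset.sum_eq_single l, Finset.sum_eq_single j]
  · rw [if_pos ⟨rfl, rfl⟩, mul_comm (par s l), ((Commute.neg_one_right _).pow_right _).eq]
  · intro b _ hb; simp [hb]
  · simp
  · intro b _ hb; simp [hb]
  · simp

end Legs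

section Equations

variable {A : Type*} [Ring A] (s : Fin 2 → ℤˣ)

/-- The graded permutation, as a constant series. -/
noncomputable def swapSeries : BiSeries (Mat2 A) := inX (PowerSeries.C (gradedSwap s))

/-- `x y` times the `R`-matrix `u - v - P`. -/
noncomputable def rMinus : BiSeries (Mat2 A) := yVar - xVar - xVar * yVar * swapSeries s

/-- `x y` times the `R`-matrix `u + v - P`. -/
noncomputable def rPlus : BiSeries (Mat2 A) := xVar + yVar - xVar * yVar * swapSeries s

/-- `F(u)` in the first leg. -/
noncomputable def x₁ : MatSeries 2 A →+* BiSeries (Mat2 A) := inX.comp (PowerSeries.map (leg₁ s))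

/-- `F(u)` in the second leg. -/
noncomputable def x₂ : MatSeries 2 A →+* BiSeries (Mat2 A) := inX.comp (PowerSeries.map leg₂)

/-- `F(v)` in the first leg. -/
noncomputable def y₁ : MatSeries 2 A →+* BiSeries (Mat2 A) := inY.comp (PowerSeries.map (leg₁ s))

/-- `F(v)` in the second leg. -/
noncomputable def y₂ : MatSeries 2 A →+* BiSeries (Mat2 A) := inY.comp (PowerSeries.map leg₂)

/-- The relation `R(u - v) T₁(u) T₂(v) = T₂(v) T₁(u) R(u - v)`. -/
def IsRTT (T : MatSeries 2 A) : Prop :=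
  rMinus s * x₁ s T * y₂ T = y₂ T * x₁ s T * rMinus s

/-- The reflection equation
`R(u - v) B₁(u) R(u + v) B₂(v) = B₂(v) R(u + v) B₁(u) R(u - v)`. -/
def IsReflection (B : MatSeries 2 A) : Prop :=
  rMinus s * x₁ s B * rPlus s * y₂ B = y₂ B * rPlus s * x₁ s B * rMinus s

variable {s}

theorem swapSeries_mul_self : (swapSeries s * swapSeries s : BiSeries (Mat2 A)) = 1 := by
  simp [swapSeries, ← map_mul, gradedSwap_mul_self]

theorem swapSeries_mul_x₁ (F : MatSeries 2 A) : swapSeries s * x₁ s F = x₂ F * swapSeries s := by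
  simp only [swapSeries, x₁, x₂, RingHom.comp_apply, ← map_mul]
  congr 1
  ext1 n
  simp [gradedSwap_mul_leg₁]

theorem swapSeries_mul_y₁ (F : MatSeries 2 A) : swapSeries s * y₁ s F = y₂ F * swapSeries s := by
  simp only [swapSeries, y₁, y₂, RingHom.comp_apply, inX_C, ← map_mul]
  congr 1
  ext1 n
  simp [gradedSwap_mul_leg₁]

theorem swapSeries_mul_y₂ (F : MatSeries 2 A) : swapSeries s * y₂ F = y₁ s F * swapSeries s := by
  simp only [swapSeries, y₁, y₂, RingHom.comp_apply, inX_C, ← map_mul]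
  congr 1
  ext1 n
  simp [gradedSwap_mul_leg₂]

theorem zcoeff_map {N N' : Type*} [Ring N] [Ring N'] (φ : N →+* N') (f : PowerSeries N) (r : ℤ) :
    zcoeff (PowerSeries.map φ f) r = φ (zcoeff f r) := by
  unfold zcoeff; split_ifs <;> simp

/-- The `RTT` relation for the coefficients. The indices are integers, and coefficients with a
negative index vanish, so that the relations at the boundary need no separate treatment. -/
theorem isRTT_iff (F : MatSeries 2 A) : IsRTT s F ↔ ∀ r p : ℤ,
    (leg₁ s (zcoeff F (r + 1)) * leg₂ (zcoeff F p) - leg₂ (zcoeff F p) * leg₁ s (zcoeff F (r + 1)))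
      - (leg₁ s (zcoeff F r) * leg₂ (zcoeff F (p + 1))
        - leg₂ (zcoeff F (p + 1)) * leg₁ s (zcoeff F r))
      - (leg₂ (zcoeff F r) * leg₁ s (zcoeff F p) - leg₂ (zcoeff F p) * leg₁ s (zcoeff F r))
        * gradedSwap s = 0 := by
  have key : ∀ r p : ℤ, bicoeff (rMinus s * x₁ s F * y₂ F - y₂ F * x₁ s F * rMinus s)
      (r + 1) (p + 1) =
    (leg₁ s (zcoeff F (r + 1)) * leg₂ (zcoeff F p) - leg₂ (zcoeff F p) * leg₁ s (zcoeff F (r + 1)))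
      - (leg₁ s (zcoeff F r) * leg₂ (zcoeff F (p + 1))
        - leg₂ (zcoeff F (p + 1)) * leg₁ s (zcoeff F r))
      - (leg₂ (zcoeff F r) * leg₁ s (zcoeff F p) - leg₂ (zcoeff F p) * leg₁ s (zcoeff F r))
        * gradedSwap s := by
    intro r p
    rw [rMinus, rtt_expand xVar_comm yVar_comm (swapSeries_mul_x₁ F) (swapSeries_mul_y₂ F)]
    simp only [bicoeff_sub, bicoeff_xVar_mul, bicoeff_yVar_mul, x₁, x₂, y₁, y₂, swapSeries,
      RingHom.comp_apply, bicoeff_mul_C, bicoeff_inX_mul_inY, bicoeff_inY_mul_inX, zcoeff_map,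
      add_sub_cancel_right]
  rw [IsRTT, ← sub_eq_zero]
  constructor
  · intro h r p
    rw [← key, h]
    simp [bicoeff]
  · intro h
    apply bicoeff_ext
    intro m n
    have := key (m - 1) (n - 1)
    simp only [sub_add_cancel] at this h
    rw [this]
    have h' := h (m - 1) (n - 1)
    simp only [sub_add_cancel] at h'
    rw [h']
    simp [bicoeff]

/-- The reflection equation for the coefficients. -/
theorem isReflection_iff (F : MatSeries 2 A) : IsReflection s F ↔ ∀ r p : ℤ,
    (leg₁ s (zcoeff F (r + 2)) * leg₂ (zcoeff F p) - leg₂ (zcoeff F p) * leg₁ s (zcoeff F (r + 2)))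
      - (leg₁ s (zcoeff F r) * leg₂ (zcoeff F (p + 2))
        - leg₂ (zcoeff F (p + 2)) * leg₁ s (zcoeff F r))
      - (leg₂ (zcoeff F r) * leg₁ s (zcoeff F (p + 1))
        - leg₂ (zcoeff F (p + 1)) * leg₁ s (zcoeff F r)) * gradedSwap s
      - (leg₂ (zcoeff F (r + 1)) * leg₁ s (zcoeff F p)
        - leg₂ (zcoeff F p) * leg₁ s (zcoeff F (r + 1))) * gradedSwap s
      - (leg₁ s (zcoeff F (r + 1)) * leg₁ s (zcoeff F p)
        - leg₂ (zcoeff F p) * leg₂ (zcoeff F (r + 1))) * gradedSwap s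
      + (leg₁ s (zcoeff F r) * leg₁ s (zcoeff F (p + 1))
        - leg₂ (zcoeff F (p + 1)) * leg₂ (zcoeff F r)) * gradedSwap s
      + (leg₂ (zcoeff F r) * leg₂ (zcoeff F p) - leg₂ (zcoeff F p) * leg₂ (zcoeff F r)) = 0 := by
  have key : ∀ r p : ℤ, bicoeff (rMinus s * x₁ s F * rPlus s * y₂ F
        - y₂ F * rPlus s * x₁ s F * rMinus s) (r + 1 + 1) (p + 1 + 1) =
    (leg₁ s (zcoeff F (r + 2)) * leg₂ (zcoeff F p) - leg₂ (zcoeff F p) * leg₁ s (zcoeff F (r + 2)))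
      - (leg₁ s (zcoeff F r) * leg₂ (zcoeff F (p + 2))
        - leg₂ (zcoeff F (p + 2)) * leg₁ s (zcoeff F r))
      - (leg₂ (zcoeff F r) * leg₁ s (zcoeff F (p + 1))
        - leg₂ (zcoeff F (p + 1)) * leg₁ s (zcoeff F r)) * gradedSwap s
      - (leg₂ (zcoeff F (r + 1)) * leg₁ s (zcoeff F p)
        - leg₂ (zcoeff F p) * leg₁ s (zcoeff F (r + 1))) * gradedSwap s
      - (leg₁ s (zcoeff F (r + 1)) * leg₁ s (zcoeff F p)
        - leg₂ (zcoeff F p) * leg₂ (zcoeff F (r + 1))) * gradedSwap s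
      + (leg₁ s (zcoeff F r) * leg₁ s (zcoeff F (p + 1))
        - leg₂ (zcoeff F (p + 1)) * leg₂ (zcoeff F r)) * gradedSwap s
      + (leg₂ (zcoeff F r) * leg₂ (zcoeff F p) - leg₂ (zcoeff F p) * leg₂ (zcoeff F r)) := by
    intro r p
    rw [rMinus, rPlus, reflection_expand xVar_comm yVar_comm swapSeries_mul_self
      (swapSeries_mul_x₁ F) (swapSeries_mul_y₂ F)]
    simp only [bicoeff_sub, bicoeff_add, bicoeff_xVar_mul, bicoeff_yVar_mul, x₁, x₂, y₁, y₂,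
      swapSeries, RingHom.comp_apply, bicoeff_mul_C, bicoeff_inX_mul_inY, bicoeff_inY_mul_inX,
      zcoeff_map, add_sub_cancel_right]
    simp only [add_assoc, one_add_one_eq_two]
  rw [IsReflection, ← sub_eq_zero]
  constructor
  · intro h r p
    rw [← key, h]
    simp [bicoeff]
  · intro h
    apply bicoeff_ext
    intro m n
    have h' := (key (m - 2) (n - 2)).trans (h _ _)
    have e : ∀ a : ℤ, a - 2 + 1 + 1 = a := fun a => by ring
    rw [e, e] at h'
    rw [h']
    simp [bicoeff]

end Equations

/-! ### The defining relations and the matrix identities -/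

section Relations

variable {A : Type*} [Ring A] {s : Fin 2 → ℤˣ}

theorem neg_one_pow_smul [Algebra ℂ A] (n : ℕ) (a : A) : ((-1 : ℂ) ^ n) • a = (-1) ^ n * a := by
  rcases Nat.even_or_odd n with h | h <;> simp [h.neg_one_pow]

theorem neg_one_pow_mul_eq_zero (n : ℕ) (a : A) : (-1) ^ n * a = 0 ↔ a = 0 := by
  rcases Nat.even_or_odd n with h | h <;> simp [h.neg_one_pow]

variable [Algebra ℂ A]

/-- A series solves the `RTT` relation if and only if its coefficients satisfy the defining
relations of the super Yangian. The entries of the matrix identity and the relations differ by the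
sign `(-1) ^ ((|i| + |j|) |k|)` of the product of matrix units. -/
theorem isRTT_iff_relations {F : MatSeries 2 A} {Ψ : FreeGen 2 →ₐ[ℂ] A}
    (hΨ : ∀ i j r, Ψ (gen (fun _ => 1) i j r) = zcoeff F r i j) :
    IsRTT s F ↔ ∀ x y, YangianRel s x y → Ψ x = Ψ y := by
  have key : ∀ (i j k l : Fin 2) (r p : ℤ),
      ((leg₁ s (zcoeff F (r + 1)) * leg₂ (zcoeff F p)
        - leg₂ (zcoeff F p) * leg₁ s (zcoeff F (r + 1)))
      - (leg₁ s (zcoeff F r) * leg₂ (zcoeff F (p + 1))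
        - leg₂ (zcoeff F (p + 1)) * leg₁ s (zcoeff F r))
      - (leg₂ (zcoeff F r) * leg₁ s (zcoeff F p) - leg₂ (zcoeff F p) * leg₁ s (zcoeff F r))
        * gradedSwap s : Mat2 A) (i, k) (j, l)
      = (-1) ^ ((par s i + par s j) * par s k) *
        (Ψ (scomm s (fun _ => 1) i j (r + 1) k l p - scomm s (fun _ => 1) i j r k l (p + 1))
          - Ψ (sgn3 s i j k • exch (fun _ => 1) i j k l r p)) := by
    intro i j k l r p
    simp only [scomm, exch, sgn3, map_sub, map_mul, map_smul, hΨ]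
    simp only [neg_one_pow_smul, Matrix.sub_apply, mul_gradedSwap_apply, leg₁_mul_leg₂_apply,
      leg₂_mul_leg₁_apply]
    have sg : ∀ {m n : ℕ}, m % 2 = n % 2 → ((-1) ^ m : A) = (-1) ^ n := by
      intro m n h
      rw [neg_one_pow_eq_pow_mod_two, h, ← neg_one_pow_eq_pow_mod_two]
    have hs : ∀ Z : A, (-1) ^ ((par s i + par s j) * par s l) * Z
        = (-1) ^ ((par s i + par s j) * par s k) *
          ((-1) ^ ((par s i + par s j) * (par s k + par s l)) * Z) := by
      intro Z
      simp only [← mul_assoc, ← pow_add]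
      congr 1
      exact sg (by ring_nf; omega)
    have he : ∀ Z : A, (-1) ^ (par s j * par s l) * ((-1) ^ ((par s i + par s l) * par s j) * Z)
        = (-1) ^ ((par s i + par s j) * par s k) *
          ((-1) ^ (par s i * par s j + par s i * par s k + par s j * par s k) * Z) := by
      intro Z
      simp only [← mul_assoc, ← pow_add]
      congr 1
      exact sg (by ring_nf; omega)
    simp only [mul_sub, hs, he]
  rw [isRTT_iff]
  constructor
  · rintro h _ _ ⟨i, j, k, l, r, p⟩
    have h1 := key i j k l r p
    rw [h r p, Matrix.zero_apply] at h1
    exact sub_eq_zero.1 ((neg_one_pow_mul_eq_zero _ _).1 h1.symm)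
  · intro h r p
    ext ⟨i, k⟩ ⟨j, l⟩
    rw [key, sub_eq_zero.2 (h _ _ (YangianRel.comm i j k l r p)), mul_zero, Matrix.zero_apply]

/-- A series solves the reflection equation if and only if its coefficients satisfy the commutation
relations of the twisted super Yangian. -/
theorem isReflection_iff_relations {ε : Fin 2 → ℤˣ} {F : MatSeries 2 A} {Ψ : FreeGen 2 →ₐ[ℂ] A}
    (hΨ : ∀ i j r, Ψ (gen (signs ε) i j r) = zcoeff F r i j) :
    IsReflection s F ↔ ∀ (i j k l : Fin 2) (r p : ℤ),
      Ψ (scomm s (signs ε) i j (r + 2) k l p - scomm s (signs ε) i j r k l (p + 2))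
        = Ψ (sgn3 s i j k •
            (exch (signs ε) i j k l (r + 1) p + exch (signs ε) i j k l r (p + 1))
          + sgn3 s i j k •
            (contr (signs ε) i j k l (r + 1) p - contr (signs ε) i j k l r (p + 1))
          - (if i = j then prodCoeff (signs ε) k l r p - prodCoeff (signs ε) k l p r else 0)) := by
  have hprod : ∀ (i j : Fin 2) (r p : ℤ),
      Ψ (prodCoeff (signs ε) i j r p) = (zcoeff F r * zcoeff F p) i j := by
    intro i j r p
    simp [prodCoeff, Matrix.mul_apply, hΨ]
  have key : ∀ (i j k l : Fin 2) (r p : ℤ),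
      ((leg₁ s (zcoeff F (r + 2)) * leg₂ (zcoeff F p)
        - leg₂ (zcoeff F p) * leg₁ s (zcoeff F (r + 2)))
      - (leg₁ s (zcoeff F r) * leg₂ (zcoeff F (p + 2))
        - leg₂ (zcoeff F (p + 2)) * leg₁ s (zcoeff F r))
      - (leg₂ (zcoeff F r) * leg₁ s (zcoeff F (p + 1))
        - leg₂ (zcoeff F (p + 1)) * leg₁ s (zcoeff F r)) * gradedSwap s
      - (leg₂ (zcoeff F (r + 1)) * leg₁ s (zcoeff F p)
        - leg₂ (zcoeff F p) * leg₁ s (zcoeff F (r + 1))) * gradedSwap s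
      - (leg₁ s (zcoeff F (r + 1)) * leg₁ s (zcoeff F p)
        - leg₂ (zcoeff F p) * leg₂ (zcoeff F (r + 1))) * gradedSwap s
      + (leg₁ s (zcoeff F r) * leg₁ s (zcoeff F (p + 1))
        - leg₂ (zcoeff F (p + 1)) * leg₂ (zcoeff F r)) * gradedSwap s
      + (leg₂ (zcoeff F r) * leg₂ (zcoeff F p) - leg₂ (zcoeff F p) * leg₂ (zcoeff F r)) :
        Mat2 A) (i, k) (j, l)
      = (-1) ^ ((par s i + par s j) * par s k) *
        (Ψ (scomm s (signs ε) i j (r + 2) k l p - scomm s (signs ε) i j r k l (p + 2))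
        - Ψ (sgn3 s i j k •
            (exch (signs ε) i j k l (r + 1) p + exch (signs ε) i j k l r (p + 1))
          + sgn3 s i j k •
            (contr (signs ε) i j k l (r + 1) p - contr (signs ε) i j k l r (p + 1))
          - (if i = j then prodCoeff (signs ε) k l r p - prodCoeff (signs ε) k l p r else 0))) := by
    intro i j k l r p
    simp only [scomm, exch, sgn3, contr, map_sub, map_add, map_smul, apply_ite Ψ, map_zero, hprod,
      map_mul, hΨ]
    simp only [neg_one_pow_smul, Matrix.sub_apply, Matrix.add_apply, mul_gradedSwap_apply,
      leg₁_mul_leg₂_apply, leg₂_mul_leg₁_apply]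
    simp only [← map_mul, leg₁_apply, leg₂_apply]
    generalize zcoeff F r * zcoeff F p = Y1
    generalize zcoeff F p * zcoeff F r = Y2
    generalize zcoeff F (r + 1) * zcoeff F p = Y3
    generalize zcoeff F p * zcoeff F (r + 1) = Y4
    generalize zcoeff F r * zcoeff F (p + 1) = Y5
    generalize zcoeff F (p + 1) * zcoeff F r = Y6
    have sg : ∀ {m n : ℕ}, m % 2 = n % 2 → ((-1) ^ m : A) = (-1) ^ n := by
      intro m n h
      rw [neg_one_pow_eq_pow_mod_two, h, ← neg_one_pow_eq_pow_mod_two]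
    have hc1 : ∀ Y : Matrix (Fin 2) (Fin 2) A, (-1) ^ (par s j * par s l) *
        (if k = j then (-1) ^ ((par s i + par s l) * par s k) * Y i l else 0)
        = (-1) ^ ((par s i + par s j) * par s k) *
          ((-1) ^ (par s i * par s j + par s i * par s k + par s j * par s k) *
            (if k = j then Y i l else 0)) := by
      intro Y
      split_ifs with h
      · subst h
        simp only [← mul_assoc, ← pow_add]
        congr 1
        exact sg (by ring_nf; omega)
      · simp
    have hc2 : ∀ Y : Matrix (Fin 2) (Fin 2) A, (-1) ^ (par s j * par s l) *
        (if i = l then Y k j else 0)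
        = (-1) ^ ((par s i + par s j) * par s k) *
          ((-1) ^ (par s i * par s j + par s i * par s k + par s j * par s k) *
            (if i = l then Y k j else 0)) := by
      intro Y
      split_ifs with h
      · subst h
        simp only [← mul_assoc, ← pow_add]
        congr 1
        exact sg (by ring_nf; omega)
      · simp
    have hc3 : ∀ Y : Matrix (Fin 2) (Fin 2) A,
        (-1) ^ ((par s i + par s j) * par s k) * (if i = j then Y k l else 0)
        = if i = j then Y k l else 0 := by
      intro Y
      split_ifs with h
      · subst h
        rw [sg (n := 0) (by ring_nf; omega), pow_zero, one_mul]
      · simp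
    have hs : ∀ Z : A, (-1) ^ ((par s i + par s j) * par s l) * Z
        = (-1) ^ ((par s i + par s j) * par s k) *
          ((-1) ^ ((par s i + par s j) * (par s k + par s l)) * Z) := by
      intro Z
      simp only [← mul_assoc, ← pow_add]
      congr 1
      exact sg (by ring_nf; omega)
    have he : ∀ Z : A, (-1) ^ (par s j * par s l) * ((-1) ^ ((par s i + par s l) * par s j) * Z)
        = (-1) ^ ((par s i + par s j) * par s k) *
          ((-1) ^ (par s i * par s j + par s i * par s k + par s j * par s k) * Z) := by
      intro Z
      simp only [← mul_assoc, ← pow_add]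
      congr 1
      exact sg (by ring_nf; omega)
    have hi : ∀ Y Y' : Matrix (Fin 2) (Fin 2) A,
        (if i = j then (Y k l - Y' k l) else 0)
          = (if i = j then Y k l else 0) - (if i = j then Y' k l else 0) := by
      intro Y Y'; split_ifs <;> simp
    rw [hi Y1 Y2]
    simp only [mul_sub, mul_add, hc1, hc2, hs, he, hc3]
    abel
  rw [isReflection_iff]
  constructor
  · intro h i j k l r p
    have h1 := key i j k l r p
    rw [h r p, Matrix.zero_apply] at h1
    exact sub_eq_zero.1 ((neg_one_pow_mul_eq_zero _ _).1 h1.symm)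
  · intro h r p
    ext ⟨i, k⟩ ⟨j, l⟩
    rw [key, sub_eq_zero.2 (h i j k l r p), mul_zero, Matrix.zero_apply]

end Relations

/-! ### Solutions of the reflection equation -/

section Solutions

variable {A : Type*} [Ring A] {s : Fin 2 → ℤˣ}

/-- `T(u) G(u) T(-u)⁻¹`. -/
noncomputable def reflectBy (G T : MatSeries 2 A) : MatSeries 2 A := T * G * negHom (inverse T)

theorem mul_inverse {T : MatSeries 2 A} (h0 : PowerSeries.coeff 0 T = 1) : T * inverse T = 1 :=
  PowerSeries.mul_invOfUnit _ _ (by simpa using h0)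

theorem inverse_mul {T : MatSeries 2 A} (h0 : PowerSeries.coeff 0 T = 1) : inverse T * T = 1 :=
  PowerSeries.invOfUnit_mul _ _ (by simpa using h0)

/-- Supercommuting entries: `G` in one leg commutes with `F` in the other one. -/
def LegsCommute (s : Fin 2 → ℤˣ) (G F : MatSeries 2 A) : Prop :=
  ∀ m n, leg₁ s (PowerSeries.coeff m G) * leg₂ (PowerSeries.coeff n F)
      = leg₂ (PowerSeries.coeff n F) * leg₁ s (PowerSeries.coeff m G)

theorem LegsCommute.x₁_y₂ {G F : MatSeries 2 A} (h : LegsCommute s G F) :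
    x₁ s G * y₂ F = y₂ F * x₁ s G := by
  apply bicoeff_ext
  intro m n
  simp only [x₁, y₂, RingHom.comp_apply, bicoeff_inX_mul_inY, bicoeff_inY_mul_inX,
    zcoeff_natCast, PowerSeries.coeff_map]
  exact h m n

theorem LegsCommute.y₂_x₁ {G F : MatSeries 2 A} (h : LegsCommute s F G) :
    y₂ G * x₁ s F = x₁ s F * y₂ G := h.x₁_y₂.symm

theorem sub_mul_add_of_central {R : Type*} [Ring R] {a q P : R} (ha : ∀ b : R, b * a = a * b)
    (hq : ∀ b : R, b * q = q * b) (hP : P * P = 1) :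
    (a - q * P) * (a + q * P) = a * a - q * q ∧ (a + q * P) * (a - q * P) = a * a - q * q := by
  have h : q * P * (q * P) = q * q := by
    rw [mul_assoc, ← mul_assoc P, hq P, mul_assoc q P, hP, mul_one]
  constructor
  · rw [sub_mul, mul_add, mul_add, h, ha (q * P)]
    abel
  · rw [add_mul, mul_sub, mul_sub, h, ha (q * P)]
    abel

/-- Conjugation turns a relation with the `R`-matrix `a + q P` into one with `a - q P`, as their
product is a central nonzerodivisor. -/
theorem conj_of_central {R : Type*} [Ring R] {a q P X Y c : R} (ha : ∀ b : R, b * a = a * b)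
    (hq : ∀ b : R, b * q = q * b) (hP : P * P = 1) (hc : a * a - q * q = c)
    (hcancel : ∀ {f g : R}, c * f = c * g → f = g)
    (h : (a + q * P) * X = Y * (a + q * P)) : (a - q * P) * Y = X * (a - q * P) := by
  obtain ⟨q1, q2⟩ := sub_mul_add_of_central ha hq hP
  have hcc : ∀ b : R, b * c = c * b := by
    intro b
    rw [← hc, mul_sub, sub_mul, ← mul_assoc, ha b, mul_assoc a b, ha b, ← mul_assoc b, hq b,
      mul_assoc q b, hq b, mul_assoc, mul_assoc]
  rw [hc] at q1 q2
  apply hcancel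
  calc c * ((a - q * P) * Y) = (a - q * P) * Y * ((a + q * P) * (a - q * P)) := by rw [q2, hcc]
    _ = (a - q * P) * (Y * (a + q * P)) * (a - q * P) := by simp only [mul_assoc]
    _ = ((a - q * P) * (a + q * P)) * (X * (a - q * P)) := by rw [← h]; simp only [mul_assoc]
    _ = c * (X * (a - q * P)) := by rw [q1]

section Neg

variable {T : MatSeries 2 A}

theorem swapSeries_negX : negX (swapSeries s : BiSeries (Mat2 A)) = swapSeries s := by
  simp [swapSeries, negX_inX]

theorem swapSeries_negY : negY (swapSeries s : BiSeries (Mat2 A)) = swapSeries s := by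
  simp [swapSeries, negY_inX]

theorem negX_x₁ (F : MatSeries 2 A) : negX (x₁ s F) = x₁ s (negHom F) := by
  simp [x₁, negX_inX, map_negHom]

theorem negX_y₂ (F : MatSeries 2 A) : negX (y₂ F) = y₂ F := by
  simp [y₂, negX_inY]

theorem negY_x₁ (F : MatSeries 2 A) : negY (x₁ s F) = x₁ s F := by
  simp [x₁, negY_inX]

theorem negY_y₂ (F : MatSeries 2 A) : negY (y₂ F) = y₂ (negHom F) := by
  simp [y₂, negY_inY, map_negHom]

/-- The `RTT` relation after the substitution `v ↦ -v`. -/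
theorem IsRTT.negY (h : IsRTT s T) :
    rPlus s * x₁ s T * y₂ (negHom T) = y₂ (negHom T) * x₁ s T * rPlus s := by
  have h' := congrArg TwistedSuperYangian.negY h
  simp only [rMinus, map_mul, map_sub, negY_xVar, negY_yVar, swapSeries_negY, negY_x₁,
    negY_y₂] at h'
  have e : (-yVar - xVar - xVar * -yVar * swapSeries s : BiSeries (Mat2 A)) = -rPlus s := by
    rw [rPlus]; noncomm_ring
  rw [e] at h'
  simpa only [neg_mul, mul_neg, neg_inj] using h'

theorem xVar_add_yVar_central (b : BiSeries (Mat2 A)) :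
    b * (xVar + yVar) = (xVar + yVar) * b := by
  rw [mul_add, add_mul, xVar_comm, yVar_comm]

theorem yVar_sub_xVar_central (b : BiSeries (Mat2 A)) :
    b * (yVar - xVar) = (yVar - xVar) * b := by
  rw [mul_sub, sub_mul, xVar_comm, yVar_comm]

theorem xVar_mul_yVar_central (b : BiSeries (Mat2 A)) :
    b * (xVar * yVar) = (xVar * yVar) * b := by
  rw [← mul_assoc, xVar_comm, mul_assoc, yVar_comm, mul_assoc]

theorem xy_mul_xy : (xVar * yVar * (xVar * yVar) : BiSeries (Mat2 A))
    = xVar * xVar * (yVar * yVar) := by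
  rw [← mul_assoc, mul_assoc xVar yVar xVar, ← yVar_comm xVar]
  simp only [mul_assoc]

/-- The `RTT` relation after the substitution `u ↦ -u` and the conjugation by an `R`-matrix. -/
theorem IsRTT.negX (h : IsRTT s T) :
    rPlus s * y₂ T * x₁ s (negHom T) = x₁ s (negHom T) * y₂ T * rPlus s := by
  have h' := congrArg TwistedSuperYangian.negX h
  simp only [rMinus, map_mul, map_sub, negX_xVar, negX_yVar, swapSeries_negX, negX_x₁,
    negX_y₂] at h'
  have e : (yVar - -xVar - -xVar * yVar * swapSeries s : BiSeries (Mat2 A))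
      = (xVar + yVar) + (xVar * yVar) * swapSeries s := by noncomm_ring
  rw [e, mul_assoc] at h'
  rw [mul_assoc]
  exact conj_of_central xVar_add_yVar_central xVar_mul_yVar_central swapSeries_mul_self
    (by rw [xy_mul_xy, one_smul]) (cancel_quadratic 1) h'

/-- The `RTT` relation for `-u` and `-v`, in the opposite order of the factors. -/
theorem IsRTT.negXY (h : IsRTT s T) :
    rMinus s * y₂ (negHom T) * x₁ s (negHom T) = x₁ s (negHom T) * y₂ (negHom T) * rMinus s := by
  have h' := congrArg TwistedSuperYangian.negX h.negY
  simp only [rPlus, map_mul, map_sub, map_add, negX_xVar, negX_yVar, swapSeries_negX, negX_x₁,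
    negX_y₂] at h'
  have e : (-xVar + yVar - -xVar * yVar * swapSeries s : BiSeries (Mat2 A))
      = (yVar - xVar) + (xVar * yVar) * swapSeries s := by noncomm_ring
  rw [e, mul_assoc] at h'
  rw [mul_assoc]
  refine conj_of_central yVar_sub_xVar_central xVar_mul_yVar_central swapSeries_mul_self
    ?_ (cancel_quadratic (-1)) h'
  rw [xy_mul_xy]
  noncomm_ring

end Neg

theorem map_mul_eq_one {R R' F : Type*} [Ring R] [Ring R'] [FunLike F R R'] [RingHomClass F R R']
    (f : F) {a b : R} (h : a * b = 1) : f a * f b = 1 := by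
  rw [← map_mul, h, map_one]

/-- The solutions of the reflection equation are stable under `G(u) ↦ T(u) G(u) T(-u)⁻¹`. -/
theorem IsReflection.reflectBy {G T : MatSeries 2 A} (hG : IsReflection s G) (hT : IsRTT s T)
    (h0 : PowerSeries.coeff 0 T = 1) (h1 : ∀ F, LegsCommute s G F) (h2 : ∀ F, LegsCommute s F G) :
    IsReflection s (reflectBy G T) := by
  have hS := map_mul_eq_one negHom (mul_inverse h0)
  have hS' := map_mul_eq_one negHom (inverse_mul h0)
  have := reflection_of_rtt (ρm := rMinus s) (ρp := rPlus s) (T₁ := x₁ s T) (T₂ := y₂ T)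
    (S₁ := x₁ s (negHom (inverse T))) (S₂ := y₂ (negHom (inverse T))) (G₁ := x₁ s G) (G₂ := y₂ G)
    hT (inv_conj (map_mul_eq_one y₂ hS') (map_mul_eq_one y₂ hS) hT.negY)
    (inv_conj (map_mul_eq_one (x₁ s) hS') (map_mul_eq_one (x₁ s) hS) hT.negX)
    (inv_conj_mul (map_mul_eq_one (x₁ s) hS') (map_mul_eq_one y₂ hS')
      (map_mul_eq_one (x₁ s) hS) (map_mul_eq_one y₂ hS) hT.negXY)
    (h1 T).x₁_y₂ (h2 T).y₂_x₁ (h1 _).x₁_y₂ (h2 _).y₂_x₁ hG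
  unfold IsReflection TwistedSuperYangian.reflectBy
  simpa only [map_mul] using this

theorem reflectBy_mul_negHom {G T : MatSeries 2 A} (h0 : PowerSeries.coeff 0 T = 1)
    (hG : G * negHom G = 1) : reflectBy G T * negHom (reflectBy G T) = 1 := by
  have hS := map_mul_eq_one negHom (inverse_mul h0)
  unfold reflectBy
  rw [map_mul, map_mul, negHom_negHom]
  calc T * G * negHom (inverse T) * (negHom T * negHom G * inverse T)
      = T * G * (negHom (inverse T) * negHom T) * negHom G * inverse T := by noncomm_ring
    _ = T * (G * negHom G) * inverse T := by rw [hS]; noncomm_ring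
    _ = 1 := by rw [hG, mul_one, mul_inverse h0]

/-- Products of supercommuting solutions of the `RTT` relation are solutions. -/
theorem IsRTT.mul {T T' : MatSeries 2 A} (hT : IsRTT s T) (hT' : IsRTT s T')
    (h1 : LegsCommute s T' T) (h2 : LegsCommute s T T') : IsRTT s (T * T') := by
  unfold IsRTT at *
  simp only [map_mul]
  calc rMinus s * (x₁ s T * x₁ s T') * (y₂ T * y₂ T')
      = rMinus s * x₁ s T * (x₁ s T' * y₂ T) * y₂ T' := by noncomm_ring
    _ = (rMinus s * x₁ s T * y₂ T) * x₁ s T' * y₂ T' := by rw [h1.x₁_y₂]; noncomm_ring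
    _ = y₂ T * x₁ s T * (rMinus s * x₁ s T' * y₂ T') := by rw [hT]; noncomm_ring
    _ = y₂ T * (x₁ s T * y₂ T') * x₁ s T' * rMinus s := by rw [hT']; noncomm_ring
    _ = _ := by rw [h2.x₁_y₂]; noncomm_ring

theorem coeff_series (x : Fin 2 → Fin 2 → ℕ → A) (r : ℕ) (i j : Fin 2) :
    PowerSeries.coeff r (series x) i j = x i j r := by
  simp [series]

theorem coeff_zero_reflectBy {G T : MatSeries 2 A} (h0 : PowerSeries.coeff 0 T = 1) :
    PowerSeries.coeff 0 (reflectBy G T) = PowerSeries.coeff 0 G := by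
  have h1 : PowerSeries.constantCoeff T = 1 := by simpa using h0
  have h2 : PowerSeries.coeff 0 (negHom (inverse T)) = 1 := by
    simp [coeff_negHom, inverse]
  simp only [PowerSeries.coeff_zero_eq_constantCoeff_apply] at *
  rw [reflectBy, map_mul, map_mul, h1, h2, one_mul, mul_one]

end Solutions

/-! ### Scalar and diagonal boundary matrices -/

section Scalars

variable {A : Type*} [Ring A] [Algebra ℂ A] {s : Fin 2 → ℤˣ}

/-- A scalar series, as a series of scalar matrices. -/
noncomputable def scalarSeries (A : Type*) [Ring A] [Algebra ℂ A] :
    PowerSeries ℂ →+* MatSeries 2 A :=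
  PowerSeries.map (algebraMap ℂ (Matrix (Fin 2) (Fin 2) A))

theorem constantCoeff_scalarSeries (h : PowerSeries ℂ) :
    PowerSeries.constantCoeff (scalarSeries A h)
      = algebraMap ℂ _ (PowerSeries.constantCoeff h) := by
  rw [← PowerSeries.coeff_zero_eq_constantCoeff_apply, scalarSeries, PowerSeries.coeff_map,
    PowerSeries.coeff_zero_eq_constantCoeff_apply]

theorem scalarSeries_central (h : PowerSeries ℂ) (F : MatSeries 2 A) :
    F * scalarSeries A h = scalarSeries A h * F := by
  ext1 n
  rw [PowerSeries.coeff_mul, PowerSeries.coeff_mul, ← Finset.Nat.sum_antidiagonal_swap]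
  refine Finset.sum_congr rfl fun m _ => ?_
  simp only [scalarSeries, PowerSeries.coeff_map, Prod.fst_swap, Prod.snd_swap]
  exact (Algebra.commutes _ _).symm

theorem leg₂_algebraMap (c : ℂ) :
    leg₂ (algebraMap ℂ (Matrix (Fin 2) (Fin 2) A) c) = algebraMap ℂ (Mat2 A) c := by
  ext ⟨i, k⟩ ⟨j, l⟩
  simp only [leg₂_apply, Matrix.algebraMap_matrix_apply, Prod.mk.injEq]
  split_ifs <;> simp_all

theorem leg₁_algebraMap (c : ℂ) :
    leg₁ s (algebraMap ℂ (Matrix (Fin 2) (Fin 2) A) c) = algebraMap ℂ (Mat2 A) c := by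
  change gradedSwap s * leg₂ (algebraMap ℂ (Matrix (Fin 2) (Fin 2) A) c) * gradedSwap s = _
  rw [leg₂_algebraMap, ← Algebra.commutes, mul_assoc, gradedSwap_mul_self, mul_one]

theorem inX_algebraMap_central {N : Type*} [Ring N] [Algebra ℂ N] (h : PowerSeries ℂ)
    (b : BiSeries N) : b * inX (PowerSeries.map (algebraMap ℂ N) h)
      = inX (PowerSeries.map (algebraMap ℂ N) h) * b := by
  ext p r
  simp only [inX, PowerSeries.coeff_mul_C, PowerSeries.coeff_C_mul]
  rw [PowerSeries.coeff_mul, PowerSeries.coeff_mul, ← Finset.Nat.sum_antidiagonal_swap]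
  refine Finset.sum_congr rfl fun m _ => ?_
  simp only [PowerSeries.coeff_map, Prod.fst_swap, Prod.snd_swap]
  exact (Algebra.commutes _ _).symm

theorem inY_algebraMap_central {N : Type*} [Ring N] [Algebra ℂ N] (h : PowerSeries ℂ)
    (b : BiSeries N) : b * inY (PowerSeries.map (algebraMap ℂ N) h)
      = inY (PowerSeries.map (algebraMap ℂ N) h) * b := by
  ext1 p
  rw [PowerSeries.coeff_mul, PowerSeries.coeff_mul, ← Finset.Nat.sum_antidiagonal_swap]
  refine Finset.sum_congr rfl fun m _ => ?_
  simp only [inY, PowerSeries.coeff_map, Prod.fst_swap, Prod.snd_swap]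
  ext1 r
  rw [PowerSeries.coeff_mul_C, PowerSeries.coeff_C_mul]
  exact (Algebra.commutes _ _).symm

theorem x₁_scalarSeries_central (h : PowerSeries ℂ) (b : BiSeries (Mat2 A)) :
    b * x₁ s (scalarSeries A h) = x₁ s (scalarSeries A h) * b := by
  have : PowerSeries.map (leg₁ s) (scalarSeries A h)
      = PowerSeries.map (algebraMap ℂ (Mat2 A)) h := by
    ext1 n
    simp only [scalarSeries, PowerSeries.coeff_map, leg₁_algebraMap]
  rw [x₁, RingHom.comp_apply, this, inX_algebraMap_central]

theorem y₂_scalarSeries_central (h : PowerSeries ℂ) (b : BiSeries (Mat2 A)) :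
    b * y₂ (scalarSeries A h) = y₂ (scalarSeries A h) * b := by
  have : PowerSeries.map leg₂ (scalarSeries A h)
      = PowerSeries.map (algebraMap ℂ (Mat2 A)) h := by
    ext1 n
    simp only [scalarSeries, PowerSeries.coeff_map, leg₂_algebraMap]
  rw [y₂, RingHom.comp_apply, this, inY_algebraMap_central]

theorem IsReflection.scalar_mul {F : MatSeries 2 A} (hF : IsReflection s F) (h : PowerSeries ℂ) :
    IsReflection s (scalarSeries A h * F) := by
  unfold IsReflection at *
  have c1 := x₁_scalarSeries_central (A := A) (s := s) h
  have c2 := y₂_scalarSeries_central (A := A) h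
  simp only [map_mul]
  generalize x₁ s (scalarSeries A h) = a at *
  generalize y₂ (scalarSeries A h) = b at *
  calc rMinus s * (a * x₁ s F) * rPlus s * (b * y₂ F)
      = (rMinus s * a) * (x₁ s F * rPlus s * b) * y₂ F := by noncomm_ring
    _ = a * b * (rMinus s * x₁ s F * rPlus s * y₂ F) := by
        rw [c1 (rMinus s), c2 (x₁ s F * rPlus s), mul_assoc a, ← mul_assoc (rMinus s) b,
          c2 (rMinus s)]
        noncomm_ring
    _ = (b * a) * (y₂ F * rPlus s * x₁ s F * rMinus s) := by rw [hF, c2]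
    _ = b * (y₂ F * rPlus s * a) * x₁ s F * rMinus s := by
        rw [c1 (y₂ F * rPlus s)]; noncomm_ring
    _ = _ := by noncomm_ring

theorem negHom_scalarSeries (h : PowerSeries ℂ) :
    negHom (scalarSeries A h) = scalarSeries A (PowerSeries.evalNegHom h) := by
  ext1 n
  rw [coeff_negHom, scalarSeries, PowerSeries.coeff_map, PowerSeries.coeff_map,
    PowerSeries.evalNegHom, PowerSeries.coeff_rescale]
  simp

theorem scalar_mul_unitary {F : MatSeries 2 A} (hF : F * negHom F = 1) {h : PowerSeries ℂ}
    (hh : h * PowerSeries.evalNegHom h = 1) :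
    (scalarSeries A h * F) * negHom (scalarSeries A h * F) = 1 := by
  rw [map_mul, mul_assoc, ← mul_assoc F, negHom_scalarSeries, scalarSeries_central,
    mul_assoc _ F, hF, mul_one, ← map_mul, hh, map_one]

/-- A diagonal matrix of scalars. -/
noncomputable def scalarDiag (A : Type*) [Ring A] [Algebra ℂ A] (d : Fin 2 → ℂ) :
    Matrix (Fin 2) (Fin 2) A :=
  Matrix.diagonal fun i => algebraMap ℂ A (d i)

/-- Diagonal scalar matrices are even, hence their legs commute with those of every series. -/
theorem legsCommute_of_scalarDiag {G F : MatSeries 2 A}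
    (hG : ∀ n, ∃ d, PowerSeries.coeff n G = scalarDiag A d) :
    LegsCommute s G F ∧ LegsCommute s F G := by
  constructor
  · intro m n
    obtain ⟨d, hd⟩ := hG m
    rw [hd]
    ext ⟨i, k⟩ ⟨j, l⟩
    rw [leg₁_mul_leg₂_apply, leg₂_mul_leg₁_apply, scalarDiag, Matrix.diagonal_apply]
    split_ifs with h
    · subst h
      rw [Algebra.commutes, neg_one_pow_eq_pow_mod_two,
        neg_one_pow_eq_pow_mod_two ((par s i + par s i) * par s l)]
      congr 2
      ring_nf
      omega
    · simp
  · intro m n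
    obtain ⟨d, hd⟩ := hG n
    rw [hd]
    ext ⟨i, k⟩ ⟨j, l⟩
    rw [leg₁_mul_leg₂_apply, leg₂_mul_leg₁_apply, scalarDiag, Matrix.diagonal_apply]
    split_ifs with h
    · subst h
      rw [Algebra.commutes]
    · simp

/-- The polynomial matrix `G + γ u⁻¹`, with `G` the diagonal matrix of the signs `ε i`. -/
noncomputable def linearDiag (A : Type*) [Ring A] [Algebra ℂ A] (ε : Fin 2 → ℤˣ) (γ : ℂ) :
    MatSeries 2 A :=
  PowerSeries.C (scalarDiag A (signs ε)) + scalarSeries A (PowerSeries.C γ * PowerSeries.X)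

theorem signs_mul_self (ε : Fin 2 → ℤˣ) (i : Fin 2) : signs ε i * signs ε i = 1 := by
  rcases Int.units_eq_one_or (ε i) with h | h <;> simp [signs, sgn, h]

theorem scalarDiag_mul_self (ε : Fin 2 → ℤˣ) :
    scalarDiag A (signs ε) * scalarDiag A (signs ε) = 1 := by
  simp only [scalarDiag, Matrix.diagonal_mul_diagonal, ← map_mul, signs_mul_self, map_one,
    Matrix.diagonal_one]

theorem coeff_scalarSeries (h : PowerSeries ℂ) (r : ℕ) :
    PowerSeries.coeff r (scalarSeries A h) = scalarDiag A fun _ => PowerSeries.coeff r h := by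
  rw [scalarSeries, PowerSeries.coeff_map]
  rfl

theorem coeff_linearDiag (ε : Fin 2 → ℤˣ) (γ : ℂ) (r : ℕ) :
    PowerSeries.coeff r (linearDiag A ε γ) = scalarDiag A fun i => PowerSeries.coeff r
      (PowerSeries.C (signs ε i) + PowerSeries.C γ * PowerSeries.X) := by
  rw [linearDiag, map_add, coeff_scalarSeries, PowerSeries.coeff_C]
  ext i j
  simp only [Matrix.add_apply, scalarDiag, Matrix.diagonal_apply, map_add, PowerSeries.coeff_C]
  split_ifs with h1 h2 h2 <;> simp [h1, h2]

/-- The boundary matrix `h(u) (G + γ u⁻¹)`. -/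
noncomputable def boundary (A : Type*) [Ring A] [Algebra ℂ A] (ε : Fin 2 → ℤˣ) (γ : ℂ)
    (h : PowerSeries ℂ) : MatSeries 2 A := scalarSeries A h * linearDiag A ε γ

theorem boundary_one (ε : Fin 2 → ℤˣ) (γ : ℂ) : boundary A ε γ 1 = linearDiag A ε γ := by
  rw [boundary, map_one, one_mul]

theorem coeff_boundary (ε : Fin 2 → ℤˣ) (γ : ℂ) (h : PowerSeries ℂ) (r : ℕ) :
    PowerSeries.coeff r (boundary A ε γ h) = scalarDiag A fun i => PowerSeries.coeff r
      (h * (PowerSeries.C (signs ε i) + PowerSeries.C γ * PowerSeries.X)) := by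
  rw [boundary, PowerSeries.coeff_mul]
  ext i j
  simp only [coeff_scalarSeries, coeff_linearDiag, scalarDiag, Matrix.sum_apply,
    Matrix.diagonal_mul_diagonal, Matrix.diagonal_apply]
  split_ifs
  · rw [PowerSeries.coeff_mul, map_sum]
    exact Finset.sum_congr rfl fun m _ => (map_mul _ _ _).symm
  · simp

theorem evalNegHom_C (c : ℂ) : PowerSeries.evalNegHom (PowerSeries.C c) = PowerSeries.C c := by
  ext n
  rw [PowerSeries.evalNegHom, PowerSeries.coeff_rescale, PowerSeries.coeff_C]
  split_ifs with h <;> simp [h]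

/-- The expanded reflection equation holds for `E + g u⁻¹`, with legs `E₁` and `E₂` of a diagonal
involution `E`. -/
theorem linear_reflection {R : Type*} [Ring R] {x y g P E₁ E₂ : R} (hx : ∀ a : R, a * x = x * a)
    (hy : ∀ a : R, a * y = y * a) (hg : ∀ a : R, a * g = g * a) (h1 : E₁ * E₁ = 1)
    (h2 : E₂ * E₂ = 1) (h3 : E₁ * E₂ = E₂ * E₁) :
    y * (y * ((E₁ + g * x) * (E₂ + g * y) - (E₂ + g * y) * (E₁ + g * x)))
      - x * (x * ((E₁ + g * x) * (E₂ + g * y) - (E₂ + g * y) * (E₁ + g * x)))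
      - x * (y * (x * (((E₂ + g * x) * (E₁ + g * y) - (E₂ + g * y) * (E₁ + g * x)) * P)))
      - x * (y * (y * (((E₂ + g * x) * (E₁ + g * y) - (E₂ + g * y) * (E₁ + g * x)) * P)))
      - x * (y * (y * (((E₁ + g * x) * (E₁ + g * y) - (E₂ + g * y) * (E₂ + g * x)) * P)))
      + x * (y * (x * (((E₁ + g * x) * (E₁ + g * y) - (E₂ + g * y) * (E₂ + g * x)) * P)))
      + x * (x * (y * (y * ((E₂ + g * x) * (E₂ + g * y) - (E₂ + g * y) * (E₂ + g * x))))) = 0 := by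
  have ce : ∀ (E z : R), (∀ a : R, a * z = z * a) → E * (g * z) = g * (z * E) := by
    intro E z hz
    rw [← mul_assoc, hg, mul_assoc, hz]
  have cc : g * g * y * x = g * g * x * y := by rw [mul_assoc, hx, ← mul_assoc]
  have cc' : g * y * x = g * x * y := by rw [mul_assoc, hx, mul_assoc]
  have k1 : (E₁ + g * x) * (E₂ + g * y) - (E₂ + g * y) * (E₁ + g * x) = 0 := by
    simp only [add_mul, mul_add, ce _ _ hx, ce _ _ hy, h3, mul_assoc]
    simp only [← mul_assoc, cc]
    abel
  have k2 : (E₂ + g * x) * (E₂ + g * y) - (E₂ + g * y) * (E₂ + g * x) = 0 := by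
    simp only [add_mul, mul_add, ce _ _ hx, ce _ _ hy, mul_assoc]
    simp only [← mul_assoc, cc]
    abel
  have k3 : (E₂ + g * x) * (E₁ + g * y) - (E₂ + g * y) * (E₁ + g * x)
      = g * ((y - x) * (E₂ - E₁)) := by
    simp only [add_mul, mul_add, ce _ _ hx, ce _ _ hy, mul_sub, sub_mul, mul_assoc]
    simp only [← mul_assoc, cc]
    abel
  have k4 : (E₁ + g * x) * (E₁ + g * y) - (E₂ + g * y) * (E₂ + g * x)
      = g * ((x + y) * (E₁ - E₂)) := by
    simp only [add_mul, mul_add, ce _ _ hx, ce _ _ hy, mul_sub, h1, h2, mul_assoc]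
    simp only [← mul_assoc, cc]
    abel
  rw [k1, k2, k3, k4]
  have k5 : x * (g * ((y - x) * (E₂ - E₁)) * P) + y * (g * ((y - x) * (E₂ - E₁)) * P)
      + y * (g * ((x + y) * (E₁ - E₂)) * P) - x * (g * ((x + y) * (E₁ - E₂)) * P) = 0 := by
    simp only [add_mul, sub_mul, mul_add, mul_sub, ← mul_assoc, hg x, hg y, cc']
    abel
  have k6 := congrArg (fun z => x * (y * z)) k5
  simp only [mul_add, mul_sub, mul_zero] at k6
  simp only [mul_zero, sub_zero, zero_sub, add_zero]
  simp only [mul_sub] at k6 ⊢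
  rw [← neg_eq_zero, ← k6]
  abel

theorem x₁_linearDiag (ε : Fin 2 → ℤˣ) (γ : ℂ) : x₁ s (linearDiag A ε γ)
    = inX (PowerSeries.C (leg₁ s (scalarDiag A (signs ε))))
      + inX (PowerSeries.C (algebraMap ℂ (Mat2 A) γ)) * xVar := by
  simp [x₁, linearDiag, scalarSeries, leg₁_algebraMap, inX, xVar]

theorem x₂_linearDiag (ε : Fin 2 → ℤˣ) (γ : ℂ) : x₂ (linearDiag A ε γ)
    = inX (PowerSeries.C (leg₂ (scalarDiag A (signs ε))))
      + inX (PowerSeries.C (algebraMap ℂ (Mat2 A) γ)) * xVar := by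
  simp [x₂, linearDiag, scalarSeries, leg₂_algebraMap, inX, xVar]

theorem y₁_linearDiag (ε : Fin 2 → ℤˣ) (γ : ℂ) : y₁ s (linearDiag A ε γ)
    = inX (PowerSeries.C (leg₁ s (scalarDiag A (signs ε))))
      + inX (PowerSeries.C (algebraMap ℂ (Mat2 A) γ)) * yVar := by
  simp [y₁, linearDiag, scalarSeries, leg₁_algebraMap, inX_C, inY, yVar]

theorem y₂_linearDiag (ε : Fin 2 → ℤˣ) (γ : ℂ) : y₂ (linearDiag A ε γ)
    = inX (PowerSeries.C (leg₂ (scalarDiag A (signs ε))))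
      + inX (PowerSeries.C (algebraMap ℂ (Mat2 A) γ)) * yVar := by
  simp [y₂, linearDiag, scalarSeries, leg₂_algebraMap, inX_C, inY, yVar]

theorem isReflection_linearDiag (ε : Fin 2 → ℤˣ) (γ : ℂ) :
    IsReflection s (linearDiag A ε γ) := by
  have hg : ∀ b : BiSeries (Mat2 A), b * inX (PowerSeries.C (algebraMap ℂ (Mat2 A) γ))
      = inX (PowerSeries.C (algebraMap ℂ (Mat2 A) γ)) * b := by
    intro b
    simpa using inX_algebraMap_central (PowerSeries.C γ) b
  have h3 : leg₁ s (scalarDiag A (signs ε)) * leg₂ (scalarDiag A (signs ε))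
      = leg₂ (scalarDiag A (signs ε)) * leg₁ s (scalarDiag A (signs ε)) := by
    have := (legsCommute_of_scalarDiag (s := s) (F := PowerSeries.C (scalarDiag A (signs ε)))
      fun n => ⟨_, coeff_linearDiag (A := A) ε 0 n⟩).1 0 0
    simpa [linearDiag, scalarSeries] using this
  rw [IsReflection, ← sub_eq_zero, rMinus, rPlus, reflection_expand xVar_comm yVar_comm
    swapSeries_mul_self (swapSeries_mul_x₁ _) (swapSeries_mul_y₂ _), x₁_linearDiag,
    x₂_linearDiag, y₁_linearDiag, y₂_linearDiag]
  refine linear_reflection xVar_comm yVar_comm hg ?_ ?_ ?_ <;>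
    simp only [← map_mul, scalarDiag_mul_self, map_one, h3]

theorem linearDiag_mul_negHom (ε : Fin 2 → ℤˣ) (γ : ℂ) :
    linearDiag A ε γ * negHom (linearDiag A ε γ)
      = scalarSeries A ((1 - PowerSeries.C γ * PowerSeries.X) *
          (1 + PowerSeries.C γ * PowerSeries.X)) := by
  have h : negHom (linearDiag A ε γ)
      = PowerSeries.C (scalarDiag A (signs ε))
        - scalarSeries A (PowerSeries.C γ * PowerSeries.X) := by
    rw [linearDiag, map_add, negHom_C, negHom_scalarSeries, map_mul, sub_eq_add_neg, ← map_neg]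
    congr 3
    rw [PowerSeries.evalNegHom_X, mul_neg, evalNegHom_C]
  rw [h, linearDiag, add_mul, mul_sub, mul_sub, scalarSeries_central, ← map_mul,
    scalarDiag_mul_self, map_one, ← map_mul]
  have : ((1 - PowerSeries.C γ * PowerSeries.X) * (1 + PowerSeries.C γ * PowerSeries.X)
      : PowerSeries ℂ)
        = 1 - (PowerSeries.C γ * PowerSeries.X) * (PowerSeries.C γ * PowerSeries.X) := by
    ring
  rw [this, map_sub, map_one]
  abel

end Scalars

/-! ### Homomorphisms from the super Yangian and the twisted super Yangian -/

section Lifts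

variable {A : Type*} [Ring A] [Algebra ℂ A] {s ε : Fin 2 → ℤˣ}

/-- The homomorphism from the free algebra with the coefficients of `F` as values. -/
noncomputable def freeLift (F : MatSeries 2 A) : FreeGen 2 →ₐ[ℂ] A :=
  FreeAlgebra.lift ℂ fun p => PowerSeries.coeff (p.2.2 + 1) F p.1 p.2.1

theorem freeLift_gen {F : MatSeries 2 A} {g : Fin 2 → ℂ}
    (h0 : PowerSeries.coeff 0 F = scalarDiag A g) (i j : Fin 2) (r : ℤ) :
    freeLift F (gen g i j r) = zcoeff F r i j := by
  unfold gen zcoeff freeLift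
  by_cases hr : r = 0
  · subst hr
    simp only [if_true, le_refl, Int.toNat_zero, h0, scalarDiag, Matrix.diagonal_apply]
    split_ifs with h
    · rw [AlgHom.commutes, h]
    · simp
  · by_cases hr' : 0 < r
    · have e : (r - 1).toNat + 1 = r.toNat := by omega
      rw [if_neg hr, if_pos hr', if_pos hr'.le, FreeAlgebra.lift_ι_apply]
      simp only [e]
    · rw [if_neg hr, if_neg hr', if_neg (by omega)]
      simp

theorem map_gen {g : Fin 2 → ℂ} {Ψ : FreeGen 2 →ₐ[ℂ] A} (F : MatSeries 2 A)
    (h : ∀ i j (r : ℕ), Ψ (gen g i j r) = PowerSeries.coeff r F i j) (i j : Fin 2) (r : ℤ) :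
    Ψ (gen g i j r) = zcoeff F r i j := by
  by_cases hr : 0 ≤ r
  · obtain ⟨n, rfl⟩ := Int.eq_ofNat_of_zero_le hr
    rw [zcoeff_natCast]
    exact h i j n
  · simp only [zcoeff, hr, if_false, gen]
    rw [if_neg (by omega), if_neg (by omega)]
    simp

/-- A solution of the `RTT` relation is a homomorphism from the super Yangian. -/
theorem exists_yangian_hom {T : MatSeries 2 A} (h0 : PowerSeries.coeff 0 T = 1)
    (hT : IsRTT s T) :
    ∃ τ : Yangian s →ₐ[ℂ] A, ∀ i j r, τ (tCoeff s i j r) = PowerSeries.coeff r T i j := by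
  have h0' : PowerSeries.coeff 0 T = scalarDiag A (fun _ => 1) := by
    rw [h0, scalarDiag]; simp
  have hΨ := freeLift_gen h0'
  refine ⟨RingQuot.liftAlgHom ℂ ⟨freeLift T, fun {_ _} h => (isRTT_iff_relations hΨ).1 hT _ _ h⟩,
    fun i j r => ?_⟩
  rw [tCoeff, RingQuot.liftAlgHom_mkAlgHom_apply, hΨ, zcoeff_natCast]

theorem coeff_mul_negHom (F : MatSeries 2 A) (r : ℕ) (i j : Fin 2) :
    PowerSeries.coeff r (F * negHom F) i j
      = ∑ m ∈ Finset.HasAntidiagonal.antidiagonal r, ((-1 : ℂ) ^ m.2) •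
        ∑ a, PowerSeries.coeff m.1 F i a * PowerSeries.coeff m.2 F a j := by
  rw [PowerSeries.coeff_mul, Matrix.sum_apply]
  refine Finset.sum_congr rfl fun m _ => ?_
  rw [coeff_negHom, neg_one_pow_smul]
  rcases Nat.even_or_odd m.2 with h | h <;> simp [h.neg_one_pow, Matrix.mul_apply]

/-- A unitary solution of the reflection equation with constant term `diag (ε i)` is a
homomorphism from the twisted super Yangian. -/
theorem exists_twisted_hom {B : MatSeries 2 A} (h0 : PowerSeries.coeff 0 B = scalarDiag A (signs ε))
    (hB : IsReflection s B) (hu : B * negHom B = 1) :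
    ∃ ρ : Twisted s ε →ₐ[ℂ] A, ∀ i j r, ρ (bCoeff s ε i j r) = PowerSeries.coeff r B i j := by
  have hΨ := freeLift_gen h0
  refine ⟨RingQuot.liftAlgHom ℂ ⟨freeLift B, fun {x y} h => ?_⟩, fun i j r => ?_⟩
  · cases h with
    | comm i j k l r p => exact (isReflection_iff_relations hΨ).1 hB i j k l r p
    | unitary i j r =>
      have h1 := coeff_mul_negHom B r i j
      rw [hu] at h1
      simp only [prodCoeff, map_sum, map_smul, map_mul, hΨ, zcoeff_natCast]
      rw [← h1, PowerSeries.coeff_one]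
      by_cases hr : r = 0 <;> by_cases hij : i = j <;> simp [hr, hij, Matrix.one_apply]
  · rw [bCoeff, RingQuot.liftAlgHom_mkAlgHom_apply, hΨ, zcoeff_natCast]

variable (s ε) in
theorem coeff_zero_series_tCoeff : PowerSeries.coeff 0 (series (tCoeff s)) = 1 := by
  ext i j
  rw [coeff_series, tCoeff, gen]
  by_cases h : i = j <;> simp [h, Matrix.one_apply]

variable (s ε) in
theorem coeff_zero_series_bCoeff :
    PowerSeries.coeff 0 (series (bCoeff s ε)) = scalarDiag _ (signs ε) := by
  ext i j
  rw [coeff_series, bCoeff, gen]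
  by_cases h : i = j <;> simp [h, scalarDiag]

variable (s) in
theorem isRTT_series_tCoeff : IsRTT s (series (tCoeff s)) :=
  (isRTT_iff_relations (Ψ := RingQuot.mkAlgHom ℂ (YangianRel s))
    (map_gen _ fun i j r => by rw [coeff_series]; rfl)).2
    fun _ _ h => RingQuot.mkAlgHom_rel ℂ h

variable (s ε) in
theorem isReflection_series_bCoeff : IsReflection s (series (bCoeff s ε)) :=
  (isReflection_iff_relations (Ψ := RingQuot.mkAlgHom ℂ (TwistedRel s ε))
    (map_gen _ fun i j r => by rw [coeff_series]; rfl)).2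
    fun i j k l r p => RingQuot.mkAlgHom_rel ℂ (TwistedRel.comm i j k l r p)

variable (s ε) in
theorem series_bCoeff_unitary : series (bCoeff s ε) * negHom (series (bCoeff s ε)) = 1 := by
  ext r i j
  rw [coeff_mul_negHom]
  have h := RingQuot.mkAlgHom_rel ℂ (TwistedRel.unitary (s := s) (ε := ε) i j r)
  simp only [prodCoeff, map_sum, map_smul, map_mul] at h
  simp only [coeff_series]
  refine h.trans ?_
  rw [PowerSeries.coeff_one]
  by_cases hr : r = 0 <;> by_cases hij : i = j <;> simp [hr, hij, Matrix.one_apply]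

variable (s ε) in
theorem twisted_hom_ext {f g : Twisted s ε →ₐ[ℂ] A}
    (h : ∀ i j r, f (bCoeff s ε i j r) = g (bCoeff s ε i j r)) : f = g := by
  apply RingQuot.ringQuot_ext'
  apply FreeAlgebra.hom_ext
  funext ⟨i, j, r⟩
  have := h i j (r + 1)
  simp only [bCoeff, gen] at this
  rw [if_neg (by omega), if_pos (by omega)] at this
  simpa using this

theorem reflect_eq (T : MatSeries 2 A) : reflect ε T = reflectBy (linearDiag A ε 0) T := by
  have : linearDiag A ε 0
      = PowerSeries.C (Matrix.diagonal fun i => algebraMap ℂ A (sgn (ε i))) := by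
    simp [linearDiag, scalarDiag, signs]
  rw [this]
  rfl

/-- `h(u) (G + γ u⁻¹)`, transformed by a solution `T(u)` of the `RTT` relation, defines a
homomorphism from the twisted super Yangian. -/
theorem exists_twisted_hom_reflectBy {T : MatSeries 2 A} (h0 : PowerSeries.coeff 0 T = 1)
    (hT : IsRTT s T) {γ : ℂ} {h : PowerSeries ℂ} (hh : PowerSeries.constantCoeff h = 1)
    (hu : (h * PowerSeries.evalNegHom h) *
      ((1 - PowerSeries.C γ * PowerSeries.X) * (1 + PowerSeries.C γ * PowerSeries.X)) = 1) :
    ∃ ρ : Twisted s ε →ₐ[ℂ] A, ∀ i j r, ρ (bCoeff s ε i j r) = PowerSeries.coeff r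
      (reflectBy (boundary A ε γ h) T) i j := by
  have hc : ∀ n, ∃ d, PowerSeries.coeff n (boundary A ε γ h) = scalarDiag A d :=
    fun n => ⟨_, coeff_boundary ε γ h n⟩
  refine exists_twisted_hom ?_ (IsReflection.reflectBy ((isReflection_linearDiag ε γ).scalar_mul h)
    hT h0 (fun F => (legsCommute_of_scalarDiag hc).1)
    (fun F => (legsCommute_of_scalarDiag hc).2)) ?_
  · rw [coeff_zero_reflectBy h0]
    simp [boundary, linearDiag, constantCoeff_scalarSeries, hh]
  · refine reflectBy_mul_negHom h0 ?_
    rw [boundary, map_mul, mul_assoc, ← mul_assoc (linearDiag A ε γ), negHom_scalarSeries,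
      scalarSeries_central, mul_assoc _ (linearDiag A ε γ), linearDiag_mul_negHom, ← map_mul,
      ← map_mul, ← mul_assoc, hu, map_one]

variable (s ε) in
/-- The homomorphism `B(u) ↦ T(u) G T(-u)⁻¹`. -/
theorem exists_twisted_embedding : ∃ φ : Twisted s ε →ₐ[ℂ] Yangian s, IsTwistedEmbedding φ := by
  obtain ⟨φ, hφ⟩ := exists_twisted_hom_reflectBy (ε := ε) (coeff_zero_series_tCoeff s)
    (isRTT_series_tCoeff s) (γ := 0) (h := 1) (by simp) (by simp)
  refine ⟨φ, fun i j r => ?_⟩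
  rw [hφ, reflect_eq, boundary_one]
  rfl

/-- The homomorphism `B(u) ↦ h(u) B(u)`. -/
theorem exists_rescaling_hom {h : PowerSeries ℂ} (h0 : PowerSeries.constantCoeff h = 1)
    (hh : h * PowerSeries.evalNegHom h = 1) :
    ∃ M : Twisted s ε →ₐ[ℂ] Twisted s ε, ∀ i j r, M (bCoeff s ε i j r) =
      ∑ m ∈ Finset.HasAntidiagonal.antidiagonal r,
        PowerSeries.coeff m.1 h • bCoeff s ε i j m.2 := by
  obtain ⟨M, hM⟩ := exists_twisted_hom (ε := ε)
    (B := scalarSeries (Twisted s ε) h * series (bCoeff s ε))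
    (by
      rw [PowerSeries.coeff_zero_eq_constantCoeff_apply, map_mul,
        ← PowerSeries.coeff_zero_eq_constantCoeff_apply (φ := series _),
        coeff_zero_series_bCoeff]
      simp [constantCoeff_scalarSeries, h0])
    ((isReflection_series_bCoeff s ε).scalar_mul h)
    (scalar_mul_unitary (series_bCoeff_unitary s ε) hh)
  refine ⟨M, fun i j r => ?_⟩
  rw [hM, PowerSeries.coeff_mul, Matrix.sum_apply]
  refine Finset.sum_congr rfl fun m _ => ?_
  rw [scalarSeries, PowerSeries.coeff_map, ← Algebra.smul_def, Matrix.smul_apply, coeff_series]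

/-- The rescalings by inverse series are inverse to each other. -/
theorem rescaling_comp {h h' : PowerSeries ℂ} (hh : h * h' = 1)
    {M M' : Twisted s ε →ₐ[ℂ] Twisted s ε}
    (hM : ∀ i j r, M (bCoeff s ε i j r) =
      ∑ m ∈ Finset.HasAntidiagonal.antidiagonal r, PowerSeries.coeff m.1 h • bCoeff s ε i j m.2)
    (hM' : ∀ i j r, M' (bCoeff s ε i j r) =
      ∑ m ∈ Finset.HasAntidiagonal.antidiagonal r, PowerSeries.coeff m.1 h' • bCoeff s ε i j m.2) :
    M.comp M' = AlgHom.id ℂ _ := by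
  have key : ∀ (h : PowerSeries ℂ) (F : MatSeries 2 (Twisted s ε)) (r : ℕ) (i j : Fin 2),
      PowerSeries.coeff r (scalarSeries (Twisted s ε) h * F) i j
      = ∑ m ∈ Finset.HasAntidiagonal.antidiagonal r,
        PowerSeries.coeff m.1 h • PowerSeries.coeff m.2 F i j := by
    intro h F r i j
    rw [PowerSeries.coeff_mul, Matrix.sum_apply]
    refine Finset.sum_congr rfl fun m _ => ?_
    rw [scalarSeries, PowerSeries.coeff_map, ← Algebra.smul_def, Matrix.smul_apply]
  apply twisted_hom_ext
  intro i j r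
  rw [AlgHom.comp_apply, hM', map_sum, AlgHom.id_apply]
  have h2 : ∀ m : ℕ × ℕ, M (PowerSeries.coeff m.1 h' • bCoeff s ε i j m.2)
      = PowerSeries.coeff m.1 h' • PowerSeries.coeff m.2
        (scalarSeries (Twisted s ε) h * series (bCoeff s ε)) i j := by
    intro m
    rw [map_smul, hM, key]
    simp only [coeff_series]
  simp only [h2]
  rw [← key, ← mul_assoc, ← map_mul, mul_comm, hh, map_one, one_mul, coeff_series]

/-- The automorphism `B(u) ↦ h(u) B(u)`. -/
theorem exists_rescaling {h : PowerSeries ℂ} (h0 : PowerSeries.constantCoeff h = 1)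
    (hh : h * PowerSeries.evalNegHom h = 1) :
    ∃ M : Twisted s ε ≃ₐ[ℂ] Twisted s ε, IsRescaling h M := by
  have e2 : PowerSeries.evalNegHom (PowerSeries.evalNegHom h) = h := by
    simp [PowerSeries.evalNegHom, PowerSeries.rescale_rescale, PowerSeries.rescale_one]
  obtain ⟨M, hM⟩ := exists_rescaling_hom (s := s) (ε := ε) h0 hh
  obtain ⟨M', hM'⟩ := exists_rescaling_hom (s := s) (ε := ε)
    (h := PowerSeries.evalNegHom h)
    (by
      rw [← PowerSeries.coeff_zero_eq_constantCoeff_apply, PowerSeries.evalNegHom,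
        PowerSeries.coeff_rescale]
      simpa using h0)
    (by rw [e2, mul_comm, hh])
  exact ⟨AlgEquiv.ofAlgHom M M' (rescaling_comp hh hM hM')
    (rescaling_comp (by rw [mul_comm, hh]) hM' hM), hM⟩

end Lifts

/-! ### Change of the algebra, and parities -/

section Change

variable {A A' : Type*} [Ring A] [Ring A'] {s : Fin 2 → ℤˣ}

/-- A ring homomorphism applied to all the coefficients of all the entries. -/
noncomputable def opMap (φ : A →+* A') : MatSeries 2 A →+* MatSeries 2 A' :=
  PowerSeries.map φ.mapMatrix

theorem coeff_opMap (φ : A →+* A') (F : MatSeries 2 A) (r : ℕ) (i j : Fin 2) :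
    PowerSeries.coeff r (opMap φ F) i j = φ (PowerSeries.coeff r F i j) := by
  simp [opMap]

theorem coeff_zero_opMap (φ : A →+* A') {F : MatSeries 2 A} (h : PowerSeries.coeff 0 F = 1) :
    PowerSeries.coeff 0 (opMap φ F) = 1 := by
  rw [opMap, PowerSeries.coeff_map, h, map_one]

theorem negHom_opMap (φ : A →+* A') (F : MatSeries 2 A) :
    negHom (opMap φ F) = opMap φ (negHom F) := (map_negHom _ _).symm

theorem inverse_opMap (φ : A →+* A') {T : MatSeries 2 A} (h : PowerSeries.coeff 0 T = 1) :
    inverse (opMap φ T) = opMap φ (inverse T) := by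
  refine left_inv_eq_right_inv (inverse_mul (coeff_zero_opMap φ h)) ?_
  rw [← map_mul, mul_inverse h, map_one]

theorem opMap_reflectBy (φ : A →+* A') {G T : MatSeries 2 A} (h : PowerSeries.coeff 0 T = 1) :
    opMap φ (reflectBy G T) = reflectBy (opMap φ G) (opMap φ T) := by
  rw [reflectBy, reflectBy, map_mul, map_mul, inverse_opMap φ h, negHom_opMap]

theorem map_leg₁ (φ : A →+* A') (M : Matrix (Fin 2) (Fin 2) A) :
    φ.mapMatrix (leg₁ s M) = leg₁ s (φ.mapMatrix M) := by
  ext ⟨i, k⟩ ⟨j, l⟩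
  simp only [RingHom.mapMatrix_apply, Matrix.map_apply, leg₁_apply]
  split_ifs <;> simp

theorem map_leg₂ (φ : A →+* A') (M : Matrix (Fin 2) (Fin 2) A) :
    φ.mapMatrix (leg₂ M) = leg₂ (φ.mapMatrix M) := by
  ext ⟨i, k⟩ ⟨j, l⟩
  simp only [RingHom.mapMatrix_apply, Matrix.map_apply, leg₂_apply]
  split_ifs <;> simp

theorem map_gradedSwap (φ : A →+* A') :
    φ.mapMatrix (gradedSwap s : Mat2 A) = gradedSwap s := by
  ext ⟨i, k⟩ ⟨j, l⟩
  simp only [RingHom.mapMatrix_apply, Matrix.map_apply, gradedSwap_apply]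
  split_ifs <;> simp

theorem IsRTT.opMap {T : MatSeries 2 A} (h : IsRTT s T) (φ : A →+* A') :
    IsRTT s (opMap φ T) := by
  rw [isRTT_iff] at h ⊢
  intro r p
  simp only [TwistedSuperYangian.opMap, zcoeff_map, ← map_leg₁, ← map_leg₂,
    ← map_gradedSwap (s := s) φ, ← map_mul, ← map_sub]
  rw [h r p, map_zero]

/-- The diagonal matrix with entries `τ ^ |i|`. -/
noncomputable def parityDiag (s : Fin 2 → ℤˣ) (τ : A) : MatSeries 2 A :=
  PowerSeries.C (Matrix.diagonal fun i => τ ^ par s i)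

theorem coeff_parityDiag_conj (τ : A) (F : MatSeries 2 A) (r : ℕ) (i j : Fin 2) :
    PowerSeries.coeff r (parityDiag s τ * F * parityDiag s τ) i j
      = τ ^ par s i * PowerSeries.coeff r F i j * τ ^ par s j := by
  simp [parityDiag]

theorem parityDiag_mul_self {τ : A} (h : τ * τ = 1) : parityDiag s τ * parityDiag s τ = 1 := by
  rw [parityDiag, ← map_mul, Matrix.diagonal_mul_diagonal, ← map_one PowerSeries.C]
  congr 1
  rw [← Matrix.diagonal_one]
  congr 1
  funext i
  rcases par_eq_zero_or_one s i with h1 | h1 <;> simp [h1, h]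

/-- An exchange relation for `F` is inherited by `K F K`, if `K` in one leg commutes with `F` and
`K` in the other one, and `K₁ K₂` with the `R`-matrix. -/
theorem conj_exchange {R : Type*} [Ring R] {K₁ K₂ F₁ F₂ ρ : R} (e₁ : K₁ * F₂ = F₂ * K₁)
    (e₂ : F₁ * K₂ = K₂ * F₁) (e₃ : K₁ * K₂ = K₂ * K₁) (hρ : ρ * (K₁ * K₂) = K₁ * K₂ * ρ)
    (h : ρ * F₁ * F₂ = F₂ * F₁ * ρ) :
    ρ * (K₁ * F₁ * K₁) * (K₂ * F₂ * K₂) = K₂ * F₂ * K₂ * (K₁ * F₁ * K₁) * ρ := by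
  have l : K₁ * F₁ * K₁ * (K₂ * F₂ * K₂) = K₁ * K₂ * (F₁ * F₂) * (K₁ * K₂) := by
    calc K₁ * F₁ * K₁ * (K₂ * F₂ * K₂) = K₁ * F₁ * (K₁ * K₂) * F₂ * K₂ := by
          simp only [mul_assoc]
      _ = K₁ * (F₁ * K₂) * (K₁ * F₂) * K₂ := by rw [e₃]; simp only [mul_assoc]
      _ = _ := by rw [e₁, e₂]; simp only [mul_assoc]
  have r : K₂ * F₂ * K₂ * (K₁ * F₁ * K₁) = K₁ * K₂ * (F₂ * F₁) * (K₁ * K₂) := by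
    calc K₂ * F₂ * K₂ * (K₁ * F₁ * K₁) = K₂ * F₂ * (K₁ * K₂) * F₁ * K₁ := by
          rw [e₃]; simp only [mul_assoc]
      _ = K₂ * (K₁ * F₂) * (F₁ * K₂) * K₁ := by rw [e₁, e₂]; simp only [mul_assoc]
      _ = (K₁ * K₂) * (F₂ * F₁) * (K₁ * K₂) := by rw [e₃]; simp only [mul_assoc]
  calc ρ * (K₁ * F₁ * K₁) * (K₂ * F₂ * K₂) = ρ * (K₁ * F₁ * K₁ * (K₂ * F₂ * K₂)) := mul_assoc _ _ _
    _ = (ρ * (K₁ * K₂)) * (F₁ * F₂) * (K₁ * K₂) := by rw [l]; simp only [mul_assoc]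
    _ = K₁ * K₂ * (ρ * F₁ * F₂) * (K₁ * K₂) := by rw [hρ]; simp only [mul_assoc]
    _ = K₁ * K₂ * (F₂ * F₁) * (ρ * (K₁ * K₂)) := by rw [h]; simp only [mul_assoc]
    _ = K₁ * K₂ * (F₂ * F₁) * (K₁ * K₂) * ρ := by rw [hρ]; simp only [mul_assoc]
    _ = _ := by rw [r]

/-- Conjugation by the parity of another tensor factor preserves the `RTT` relation. -/
theorem IsRTT.parity_conj {T : MatSeries 2 A} (hT : IsRTT s T) {τ : A}
    (hc : ∀ i j r, τ * PowerSeries.coeff r T i j = PowerSeries.coeff r T i j * τ) :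
    IsRTT s (parityDiag s τ * T * parityDiag s τ) := by
  have hτ : ∀ i j k r, τ ^ par s k * PowerSeries.coeff r T i j
      = PowerSeries.coeff r T i j * τ ^ par s k := fun i j k r =>
    (Commute.pow_left (hc i j r) _ : Commute _ _)
  have coeffK : ∀ n, PowerSeries.coeff n (parityDiag s τ)
      = if n = 0 then Matrix.diagonal fun i => τ ^ par s i else 0 := fun n => by
    rw [parityDiag, PowerSeries.coeff_C]
  have c1 : LegsCommute s (parityDiag s τ) T := by
    intro m n
    rw [coeffK]
    split_ifs
    · ext ⟨i, k⟩ ⟨j, l⟩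
      rw [leg₁_mul_leg₂_apply, leg₂_mul_leg₁_apply, Matrix.diagonal_apply]
      split_ifs with h
      · subst h
        rw [hτ, neg_one_pow_eq_pow_mod_two,
          neg_one_pow_eq_pow_mod_two ((par s i + par s i) * par s l)]
        congr 2
        ring_nf
        omega
      · simp
    · simp
  have c2 : LegsCommute s T (parityDiag s τ) := by
    intro m n
    rw [coeffK]
    split_ifs
    · ext ⟨i, k⟩ ⟨j, l⟩
      rw [leg₁_mul_leg₂_apply, leg₂_mul_leg₁_apply, Matrix.diagonal_apply]
      split_ifs with h
      · subst h
        rw [hτ]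
      · simp
    · simp
  have c3 : LegsCommute s (parityDiag s τ) (parityDiag s τ) := by
    intro m n
    rw [coeffK, coeffK]
    split_ifs
    · ext ⟨i, k⟩ ⟨j, l⟩
      rw [leg₁_mul_leg₂_apply, leg₂_mul_leg₁_apply, Matrix.diagonal_apply, Matrix.diagonal_apply]
      split_ifs with h h'
      · subst h h'
        rw [((Commute.refl τ).pow_pow _ _ : τ ^ par s i * τ ^ par s k = _)]
      all_goals simp
    all_goals simp
  have hx : x₁ s (parityDiag s τ) = y₁ s (parityDiag s τ) := by
    simp [x₁, y₁, parityDiag, inX_C]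
  have hP : swapSeries s * (x₁ s (parityDiag s τ) * y₂ (parityDiag s τ))
      = (x₁ s (parityDiag s τ) * y₂ (parityDiag s τ)) * swapSeries s := by
    rw [hx, ← mul_assoc, swapSeries_mul_y₁, mul_assoc, swapSeries_mul_y₂, ← mul_assoc, ← hx,
      c3.x₁_y₂]
  have hρ : rMinus s * (x₁ s (parityDiag s τ) * y₂ (parityDiag s τ))
      = (x₁ s (parityDiag s τ) * y₂ (parityDiag s τ)) * rMinus s := by
    generalize x₁ s (parityDiag s τ) * y₂ (parityDiag s τ) = K at *
    rw [rMinus, sub_mul, sub_mul, mul_sub, mul_sub, mul_assoc (xVar * yVar), hP, ← mul_assoc,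
      ← mul_assoc K, xVar_mul_yVar_central K, yVar_comm K, xVar_comm K]
  unfold IsRTT at *
  simp only [map_mul]
  exact conj_exchange c1.x₁_y₂ c2.x₁_y₂ c3.x₁_y₂ hρ hT

end Change

section Homogeneous

variable {A : Type*} [Ring A] [Algebra ℂ A] {s : Fin 2 → ℤˣ}

/-- The `(i, j)` entry of every coefficient has parity `|i| + |j|` with respect to the parity
involution `σ`. -/
def IsHomogeneous (s : Fin 2 → ℤˣ) (σ : A) (F : MatSeries 2 A) : Prop :=
  ∀ i j r, σ * PowerSeries.coeff r F i j
    = ((-1 : ℂ) ^ (par s i + par s j)) • (PowerSeries.coeff r F i j * σ)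

/-- Homogeneity is commutation with a diagonal matrix. -/
theorem isHomogeneous_iff {σ : A} {F : MatSeries 2 A} : IsHomogeneous s σ F ↔
    PowerSeries.C (Matrix.diagonal fun i => (-1) ^ par s i * σ) * F
      = F * PowerSeries.C (Matrix.diagonal fun i => (-1) ^ par s i * σ) := by
  have key : ∀ i j r, (PowerSeries.coeff r
      (PowerSeries.C (Matrix.diagonal fun i => (-1) ^ par s i * σ) * F) i j
      = PowerSeries.coeff r
        (F * PowerSeries.C (Matrix.diagonal fun i => (-1) ^ par s i * σ)) i j) ↔
      σ * PowerSeries.coeff r F i j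
        = ((-1 : ℂ) ^ (par s i + par s j)) • (PowerSeries.coeff r F i j * σ) := by
    intro i j r
    rw [PowerSeries.coeff_C_mul, PowerSeries.coeff_mul_C, Matrix.diagonal_mul,
      Matrix.mul_diagonal, neg_one_pow_smul]
    rcases par_eq_zero_or_one s i with hi | hi <;> rcases par_eq_zero_or_one s j with hj | hj <;>
      simp [hi, hj, neg_eq_iff_eq_neg]
  constructor
  · intro h
    ext r i j
    exact (key i j r).2 (h i j r)
  · intro h i j r
    exact (key i j r).1 (by rw [h])

theorem IsHomogeneous.mul {σ : A} {F F' : MatSeries 2 A} (h : IsHomogeneous s σ F)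
    (h' : IsHomogeneous s σ F') : IsHomogeneous s σ (F * F') := by
  rw [isHomogeneous_iff] at *
  rw [← mul_assoc, h, mul_assoc, h', mul_assoc]

theorem IsHomogeneous.negHom {σ : A} {F : MatSeries 2 A} (h : IsHomogeneous s σ F) :
    IsHomogeneous s σ (negHom F) := by
  rw [isHomogeneous_iff] at *
  have := congrArg TwistedSuperYangian.negHom h
  simpa only [map_mul, negHom_C] using this

theorem IsHomogeneous.inverse {σ : A} {T : MatSeries 2 A} (h : IsHomogeneous s σ T)
    (h0 : PowerSeries.coeff 0 T = 1) : IsHomogeneous s σ (inverse T) := by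
  rw [isHomogeneous_iff] at *
  set J : MatSeries 2 A := PowerSeries.C (Matrix.diagonal fun i => (-1) ^ par s i * σ)
  set S := TwistedSuperYangian.inverse T
  calc J * S = (S * T) * J * S := by rw [inverse_mul h0, one_mul]
    _ = S * (J * T) * S := by rw [h]; noncomm_ring
    _ = S * J * (T * S) := by noncomm_ring
    _ = S * J := by rw [mul_inverse h0, mul_one]

theorem IsHomogeneous.of_scalarDiag {σ : A} {G : MatSeries 2 A}
    (hG : ∀ n, ∃ d, PowerSeries.coeff n G = scalarDiag A d) : IsHomogeneous s σ G := by
  intro i j r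
  obtain ⟨d, hd⟩ := hG r
  rw [hd, scalarDiag, Matrix.diagonal_apply]
  split_ifs with h
  · subst h
    rw [← two_mul, pow_mul, neg_one_sq, one_pow, one_smul, Algebra.commutes]
  · simp

theorem IsHomogeneous.reflectBy {σ : A} {G T : MatSeries 2 A} (h : IsHomogeneous s σ T)
    (h0 : PowerSeries.coeff 0 T = 1)
    (hG : ∀ n, ∃ d, PowerSeries.coeff n G = scalarDiag A d) :
    IsHomogeneous s σ (reflectBy G T) :=
  (h.mul (IsHomogeneous.of_scalarDiag hG)).mul (h.inverse h0).negHom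

end Homogeneous

/-! ### Tensor products of modules -/

section TensorOfModules

variable {V W : Type*} [AddCommGroup V] [Module ℂ V] [AddCommGroup W] [Module ℂ W]
  {s : Fin 2 → ℤˣ}

/-- The operator `x ⊗ 1` on `V ⊗ W`. -/
noncomputable def onLeft (V W : Type*) [AddCommGroup V] [Module ℂ V] [AddCommGroup W] [Module ℂ W] :
    Module.End ℂ V →ₐ[ℂ] Module.End ℂ (V ⊗[ℂ] W) := Module.End.rTensorAlgHom ℂ V W

/-- The operator `1 ⊗ y` on `V ⊗ W`. -/
noncomputable def onRight (V W : Type*) [AddCommGroup V] [Module ℂ V] [AddCommGroup W]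
    [Module ℂ W] : Module.End ℂ W →ₐ[ℂ] Module.End ℂ (V ⊗[ℂ] W) :=
  Module.End.lTensorAlgHom ℂ W V

theorem onLeft_tmul (x : Module.End ℂ V) (v : V) (w : W) :
    onLeft V W x (v ⊗ₜ w) = x v ⊗ₜ w := rfl

theorem onRight_tmul (y : Module.End ℂ W) (v : V) (w : W) :
    onRight V W y (v ⊗ₜ w) = v ⊗ₜ y w := rfl

theorem onLeft_mul_onRight (x : Module.End ℂ V) (y : Module.End ℂ W) :
    onLeft V W x * onRight V W y = TensorProduct.map x y := by
  ext v w
  simp [onLeft_tmul, onRight_tmul]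

theorem onRight_mul_onLeft (x : Module.End ℂ V) (y : Module.End ℂ W) :
    onRight V W y * onLeft V W x = onLeft V W x * onRight V W y := by
  ext v w
  simp [onLeft_tmul, onRight_tmul]

/-- `t i j (u) ⊗ 1`. -/
noncomputable def leftSeries (V W : Type*) [AddCommGroup V] [Module ℂ V] [AddCommGroup W]
    [Module ℂ W] : MatSeries 2 (Module.End ℂ V) →+* MatSeries 2 (Module.End ℂ (V ⊗[ℂ] W)) :=
  opMap (onLeft V W : Module.End ℂ V →+* _)

/-- `1 ⊗ t i j (u)`, with the sign rule: the entry `(i, j)` is multiplied by `σ ^ (|i| + |j|)`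
for the parity involution `σ` of `V`. -/
noncomputable def rightSeries (s : Fin 2 → ℤˣ) (σ : Module.End ℂ V)
    (F : MatSeries 2 (Module.End ℂ W)) : MatSeries 2 (Module.End ℂ (V ⊗[ℂ] W)) :=
  parityDiag s (onLeft V W σ) * opMap (onRight V W : Module.End ℂ W →+* _) F
    * parityDiag s (onLeft V W σ)

theorem coeff_leftSeries (T : MatSeries 2 (Module.End ℂ V)) (r : ℕ) (i j : Fin 2) :
    PowerSeries.coeff r (leftSeries V W T) i j = onLeft V W (PowerSeries.coeff r T i j) :=
  coeff_opMap _ _ _ _ _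

theorem coeff_rightSeries (σ : Module.End ℂ V) (F : MatSeries 2 (Module.End ℂ W)) (r : ℕ)
    (i j : Fin 2) :
    PowerSeries.coeff r (rightSeries s σ F) i j
      = TensorProduct.map (σ ^ (par s i + par s j)) (PowerSeries.coeff r F i j) := by
  rw [rightSeries, coeff_parityDiag_conj, coeff_opMap, ← map_pow, ← map_pow]
  change _ * onRight V W _ * _ = _
  rw [mul_assoc, onRight_mul_onLeft, ← mul_assoc, ← map_mul, ← pow_add, onLeft_mul_onRight]

theorem onLeft_sq {σ : Module.End ℂ V} (hσ : σ * σ = 1) :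
    onLeft V W σ * onLeft V W σ = 1 := by rw [← map_mul, hσ, map_one]

theorem rightSeries_mul {σ : Module.End ℂ V} (hσ : σ * σ = 1)
    (F F' : MatSeries 2 (Module.End ℂ W)) :
    rightSeries s σ (F * F') = (rightSeries s σ F * rightSeries s σ F' :
      MatSeries 2 (Module.End ℂ (V ⊗[ℂ] W))) := by
  have h := parityDiag_mul_self (s := s) (onLeft_sq (W := W) hσ)
  simp only [rightSeries, map_mul]
  generalize parityDiag s (onLeft V W σ) = K at *
  simp only [mul_assoc]
  rw [← mul_assoc K K, h, one_mul]

theorem rightSeries_one {σ : Module.End ℂ V} (hσ : σ * σ = 1) :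
    rightSeries s σ (1 : MatSeries 2 (Module.End ℂ W))
      = (1 : MatSeries 2 (Module.End ℂ (V ⊗[ℂ] W))) := by
  rw [rightSeries, map_one, mul_one, parityDiag_mul_self (onLeft_sq hσ)]

theorem negHom_parityDiag {A : Type*} [Ring A] (τ : A) :
    negHom (parityDiag s τ) = parityDiag s τ := by rw [parityDiag, negHom_C]

theorem negHom_rightSeries (σ : Module.End ℂ V) (F : MatSeries 2 (Module.End ℂ W)) :
    negHom (rightSeries s σ F : MatSeries 2 (Module.End ℂ (V ⊗[ℂ] W)))
      = rightSeries s σ (negHom F) := by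
  rw [rightSeries, rightSeries, map_mul, map_mul, negHom_parityDiag, negHom_opMap]

theorem coeff_zero_leftSeries {T : MatSeries 2 (Module.End ℂ V)} (h : PowerSeries.coeff 0 T = 1) :
    PowerSeries.coeff 0 (leftSeries V W T) = 1 := coeff_zero_opMap _ h

theorem coeff_zero_rightSeries {σ : Module.End ℂ V} (hσ : σ * σ = 1)
    {T : MatSeries 2 (Module.End ℂ W)} (h : PowerSeries.coeff 0 T = 1) :
    PowerSeries.coeff 0 (rightSeries s σ T : MatSeries 2 (Module.End ℂ (V ⊗[ℂ] W))) = 1 := by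
  have e : PowerSeries.coeff 0 (rightSeries s σ T : MatSeries 2 (Module.End ℂ (V ⊗[ℂ] W)))
      = PowerSeries.coeff 0 (rightSeries s σ (1 : MatSeries 2 (Module.End ℂ W)) :
          MatSeries 2 (Module.End ℂ (V ⊗[ℂ] W))) := by
    ext1 i j
    rw [coeff_rightSeries, coeff_rightSeries, h, PowerSeries.coeff_zero_one]
  rw [e, rightSeries_one hσ, PowerSeries.coeff_zero_one]

theorem inverse_rightSeries {σ : Module.End ℂ V} (hσ : σ * σ = 1)
    {T : MatSeries 2 (Module.End ℂ W)} (h : PowerSeries.coeff 0 T = 1) :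
    inverse (rightSeries s σ T : MatSeries 2 (Module.End ℂ (V ⊗[ℂ] W)))
      = rightSeries s σ (inverse T) := by
  refine left_inv_eq_right_inv (inverse_mul (coeff_zero_rightSeries hσ h)) ?_
  rw [← rightSeries_mul hσ, mul_inverse h, rightSeries_one hσ]

theorem tensorSeries_eq (σ : Module.End ℂ V) (T : MatSeries 2 (Module.End ℂ V))
    (T' : MatSeries 2 (Module.End ℂ W)) :
    tensorSeries s σ T T' = leftSeries V W T * rightSeries s σ T' := by
  ext1 r
  ext1 i j
  rw [tensorSeries, coeff_series, PowerSeries.coeff_mul, Matrix.sum_apply]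
  refine Finset.sum_congr rfl fun m _ => ?_
  rw [Matrix.mul_apply]
  refine Finset.sum_congr rfl fun k _ => ?_
  rw [coeff_leftSeries, coeff_rightSeries, ← onLeft_mul_onRight, ← onLeft_mul_onRight, map_mul,
    mul_assoc]
  rfl

theorem IsHomogeneous.sigma_pow {σ : Module.End ℂ V} {T : MatSeries 2 (Module.End ℂ V)}
    (h : IsHomogeneous s σ T) (n : ℕ) (i j : Fin 2) (r : ℕ) :
    σ ^ n * PowerSeries.coeff r T i j
      = ((-1 : ℂ) ^ (n * (par s i + par s j))) • (PowerSeries.coeff r T i j * σ ^ n) := by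
  induction n with
  | zero => simp
  | succ n ih =>
    rw [pow_succ, mul_assoc, h, mul_smul_comm, ← mul_assoc, ih, smul_mul_assoc, smul_smul,
      ← pow_add, add_mul, one_mul, add_comm (par s i + par s j), mul_assoc]

/-- The sign rule in `rightSeries` makes operators on different tensor factors supercommute. -/
theorem legsCommute_right_left {σ : Module.End ℂ V} {T : MatSeries 2 (Module.End ℂ V)}
    (h : IsHomogeneous s σ T) (F : MatSeries 2 (Module.End ℂ W)) :
    LegsCommute s (rightSeries s σ F) (leftSeries V W T) := by
  intro m n
  ext1 ⟨i, k⟩ ⟨j, l⟩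
  rw [leg₁_mul_leg₂_apply, leg₂_mul_leg₁_apply, coeff_leftSeries, coeff_rightSeries,
    ← onLeft_mul_onRight]
  have key := h.sigma_pow (par s i + par s j) k l n
  revert key
  generalize PowerSeries.coeff n T k l = t, PowerSeries.coeff m F i j = f
  intro key
  rw [mul_assoc (onLeft V W _), onRight_mul_onLeft, ← mul_assoc (onLeft V W _), ← map_mul, key,
    ← mul_assoc (onLeft V W t), ← map_mul, map_smul, ← neg_one_pow_smul, ← neg_one_pow_smul,
    smul_mul_assoc, smul_smul, ← pow_add,
    neg_one_pow_eq_pow_mod_two, neg_one_pow_eq_pow_mod_two ((par s i + par s j) * par s l)]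
  congr 2
  ring_nf
  omega

theorem legsCommute_left_right {σ : Module.End ℂ V} {T : MatSeries 2 (Module.End ℂ V)}
    (h : IsHomogeneous s σ T) (F : MatSeries 2 (Module.End ℂ W)) :
    LegsCommute s (leftSeries V W T) (rightSeries s σ F) := by
  intro m n
  ext1 ⟨i, k⟩ ⟨j, l⟩
  rw [leg₁_mul_leg₂_apply, leg₂_mul_leg₁_apply, coeff_leftSeries, coeff_rightSeries,
    ← onLeft_mul_onRight]
  have key := h.sigma_pow (par s k + par s l) i j m
  revert key
  generalize PowerSeries.coeff m T i j = t, PowerSeries.coeff n F k l = f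
  intro key
  rw [mul_assoc (onLeft V W _) (onRight V W f), onRight_mul_onLeft,
    ← mul_assoc (onLeft V W (σ ^ _)),
    ← map_mul, key, ← mul_assoc (onLeft V W t), ← map_mul, map_smul,
    ← neg_one_pow_smul, ← neg_one_pow_smul, smul_mul_assoc, smul_smul, ← pow_add,
    neg_one_pow_eq_pow_mod_two, neg_one_pow_eq_pow_mod_two (_ + _)]
  congr 2
  ring_nf
  omega

theorem IsRTT.leftSeries {T : MatSeries 2 (Module.End ℂ V)} (h : IsRTT s T) :
    IsRTT s (leftSeries V W T) := h.opMap _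

theorem IsRTT.rightSeries {σ : Module.End ℂ V} {T : MatSeries 2 (Module.End ℂ W)}
    (h : IsRTT s T) : IsRTT s (rightSeries s σ T : MatSeries 2 (Module.End ℂ (V ⊗[ℂ] W))) := by
  refine (h.opMap _).parity_conj fun i j r => ?_
  rw [coeff_opMap]
  exact (onRight_mul_onLeft _ _).symm

theorem IsRTT.tensorSeries {σ : Module.End ℂ V} {T : MatSeries 2 (Module.End ℂ V)}
    {T' : MatSeries 2 (Module.End ℂ W)} (h : IsRTT s T) (h' : IsRTT s T')
    (hσ : IsHomogeneous s σ T) : IsRTT s (tensorSeries s σ T T') := by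
  rw [tensorSeries_eq]
  exact h.leftSeries.mul h'.rightSeries (legsCommute_right_left hσ _) (legsCommute_left_right hσ _)

theorem IsHomogeneous.leftSeries {σ : Module.End ℂ V} {T : MatSeries 2 (Module.End ℂ V)}
    (h : IsHomogeneous s σ T) (σ' : Module.End ℂ W) :
    IsHomogeneous s (TensorProduct.map σ σ') (leftSeries V W T) := by
  intro i j r
  rw [coeff_leftSeries, ← onLeft_mul_onRight, mul_assoc, onRight_mul_onLeft, ← mul_assoc,
    ← map_mul, h, map_smul, smul_mul_assoc, map_mul, mul_assoc]

theorem IsHomogeneous.rightSeries (σ : Module.End ℂ V) {σ' : Module.End ℂ W}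
    {T : MatSeries 2 (Module.End ℂ W)} (h : IsHomogeneous s σ' T) :
    IsHomogeneous s (TensorProduct.map σ σ')
      (rightSeries s σ T : MatSeries 2 (Module.End ℂ (V ⊗[ℂ] W))) := by
  intro i j r
  rw [coeff_rightSeries, ← TensorProduct.map_mul, h, ← TensorProduct.map_mul, ← pow_succ,
    ← pow_succ', TensorProduct.map_smul_right]

theorem IsHomogeneous.tensorSeries {σ : Module.End ℂ V} {σ' : Module.End ℂ W}
    {T : MatSeries 2 (Module.End ℂ V)} {T' : MatSeries 2 (Module.End ℂ W)}
    (h : IsHomogeneous s σ T) (h' : IsHomogeneous s σ' T') :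
    IsHomogeneous s (TensorProduct.map σ σ') (tensorSeries s σ T T') := by
  rw [tensorSeries_eq]
  exact (h.leftSeries σ').mul (h'.rightSeries σ)

theorem coeff_zero_tensorSeries {σ : Module.End ℂ V} (hσ : σ * σ = 1)
    {T : MatSeries 2 (Module.End ℂ V)} {T' : MatSeries 2 (Module.End ℂ W)}
    (h : PowerSeries.coeff 0 T = 1) (h' : PowerSeries.coeff 0 T' = 1) :
    PowerSeries.coeff 0 (tensorSeries s σ T T') = 1 := by
  rw [tensorSeries_eq, PowerSeries.coeff_mul, Finset.Nat.antidiagonal_zero, Finset.sum_singleton,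
    coeff_zero_leftSeries h, coeff_zero_rightSeries hσ h', mul_one]

/-- The sign rule is multiplicative, so it is compatible with `T(u) G(u) T(-u)⁻¹`. -/
theorem reflectBy_rightSeries {σ : Module.End ℂ V} (hσ : σ * σ = 1)
    (G : MatSeries 2 (Module.End ℂ W))
    {T : MatSeries 2 (Module.End ℂ W)} (h : PowerSeries.coeff 0 T = 1) :
    reflectBy (rightSeries s σ G) (rightSeries s σ T : MatSeries 2 (Module.End ℂ (V ⊗[ℂ] W)))
      = rightSeries s σ (reflectBy G T) := by
  rw [reflectBy, reflectBy, inverse_rightSeries hσ h, negHom_rightSeries, rightSeries_mul hσ,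
    rightSeries_mul hσ]

/-- For a product of solutions, the factors can be applied one after the other. -/
theorem reflectBy_mul {A : Type*} [Ring A] {G T T' : MatSeries 2 A}
    (h : PowerSeries.coeff 0 T = 1) (h' : PowerSeries.coeff 0 T' = 1) :
    reflectBy G (T * T') = reflectBy (reflectBy G T') T := by
  have : inverse (T * T') = inverse T' * inverse T := by
    refine left_inv_eq_right_inv (inverse_mul ?_) ?_
    · rw [PowerSeries.coeff_mul, Finset.Nat.antidiagonal_zero, Finset.sum_singleton, h, h', mul_one]
    · rw [mul_assoc, ← mul_assoc T', mul_inverse h', one_mul, mul_inverse h]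
  simp only [reflectBy, this, map_mul, mul_assoc]

/-- The `(i, j)` entry of a series of matrices, as a series. -/
noncomputable def entrySeries {A : Type*} [Ring A] (F : MatSeries 2 A) (i j : Fin 2) :
    PowerSeries A := PowerSeries.mk fun r => PowerSeries.coeff r F i j

theorem entrySeries_mul {A : Type*} [Ring A] (F F' : MatSeries 2 A) (i j : Fin 2) :
    entrySeries (F * F') i j = ∑ k, entrySeries F i k * entrySeries F' k j := by
  ext r
  rw [entrySeries, PowerSeries.coeff_mk, PowerSeries.coeff_mul, Matrix.sum_apply, map_sum]
  simp only [Matrix.mul_apply, PowerSeries.coeff_mul, entrySeries, PowerSeries.coeff_mk]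
  rw [Finset.sum_comm]

/-- The coaction, in matrix form. -/
theorem coidealSeries_eq {σ : Module.End ℂ V} {T : MatSeries 2 (Module.End ℂ V)}
    (h : IsHomogeneous s σ T) (h0 : PowerSeries.coeff 0 T = 1) (B : MatSeries 2 (Module.End ℂ W)) :
    coidealSeries s σ T B = reflectBy (rightSeries s σ B) (leftSeries V W T) := by
  have hS := (h.inverse h0).negHom
  have hr : reflectBy (rightSeries s σ B) (leftSeries V W T)
      = leftSeries V W T * rightSeries s σ B * leftSeries V W (negHom (inverse T)) := by
    rw [reflectBy, leftSeries, inverse_opMap _ h0, negHom_opMap]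
  -- the sign comes from moving the last factor past the middle one
  have e1 : ∀ a c j, entrySeries (rightSeries s σ B : MatSeries 2 (Module.End ℂ (V ⊗[ℂ] W))) a c
        * entrySeries (leftSeries V W (negHom (inverse T))) c j
      = ((-1 : ℂ) ^ ((par s c + par s j) * (par s a + par s c))) •
        (entrySeries (leftSeries V W (negHom (inverse T))) c j
          * entrySeries (rightSeries s σ B) a c) := by
    intro a c j
    ext1 r
    rw [PowerSeries.coeff_smul, PowerSeries.coeff_mul, PowerSeries.coeff_mul, Finset.smul_sum,
      ← Finset.Nat.sum_antidiagonal_swap]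
    refine Finset.sum_congr rfl fun m _ => ?_
    simp only [entrySeries, PowerSeries.coeff_mk, coeff_leftSeries, coeff_rightSeries,
      Prod.fst_swap, Prod.snd_swap, ← onLeft_mul_onRight]
    have key := hS.sigma_pow (par s a + par s c) c j m.1
    revert key
    generalize PowerSeries.coeff m.1 (negHom (inverse T)) c j = t, PowerSeries.coeff m.2 B a c = f
    intro key
    rw [mul_assoc, onRight_mul_onLeft, ← mul_assoc, ← map_mul, key, ← mul_assoc, ← map_mul,
      map_smul, smul_mul_assoc, mul_comm (par s a + par s c)]
  have e2 : entrySeries (coidealSeries s σ T B) = fun i j => ∑ a, ∑ c,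
      ((-1 : ℂ) ^ ((par s c + par s j) * (par s a + par s c))) •
      ((entrySeries (leftSeries V W T) i a * entrySeries (leftSeries V W (negHom (inverse T))) c j)
        * entrySeries (rightSeries s σ B) a c) := by
    funext i j
    ext1 r
    simp only [entrySeries, coidealSeries, PowerSeries.coeff_mk, coeff_series, map_sum,
      PowerSeries.coeff_smul]
    rw [Finset.sum_comm]
    refine Finset.sum_congr rfl fun a _ => ?_
    rw [Finset.sum_comm]
    refine Finset.sum_congr rfl fun c _ => ?_
    rw [← Finset.smul_sum, PowerSeries.coeff_mul]
    congr 1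
    refine Finset.sum_congr rfl fun m _ => ?_
    rw [← onLeft_mul_onRight, PowerSeries.coeff_mul, PowerSeries.coeff_mk, coeff_rightSeries,
      ← onLeft_mul_onRight, map_mul, mul_assoc, map_sum]
    congr 1
    refine Finset.sum_congr rfl fun n _ => ?_
    simp only [PowerSeries.coeff_mk, coeff_leftSeries, map_mul]
    rfl
  have e3 : entrySeries (coidealSeries s σ T B)
      = entrySeries (reflectBy (rightSeries s σ B) (leftSeries V W T)) := by
    rw [e2, hr]
    funext i j
    rw [mul_assoc, entrySeries_mul]
    refine Finset.sum_congr rfl fun a _ => ?_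
    rw [entrySeries_mul, Finset.mul_sum]
    refine Finset.sum_congr rfl fun c _ => ?_
    rw [e1, mul_smul_comm, mul_assoc]
  ext1 r
  ext1 i j
  simpa [entrySeries] using congrArg (PowerSeries.coeff r) (congrFun (congrFun e3 i) j)

end TensorOfModules

/-! ### Evaluation modules -/

/-- `1 + E u⁻¹` solves the `RTT` relation if `E` satisfies the relations of the Lie superalgebra
`gl(1|1)`. -/
theorem linear_rtt {R : Type*} [Ring R] {x y P E₁ E₂ : R} (hx : ∀ a : R, a * x = x * a)
    (hy : ∀ a : R, a * y = y * a) (h₁ : P * E₁ = E₂ * P) (h₂ : P * E₂ = E₁ * P)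
    (h : E₁ * E₂ - E₂ * E₁ = (E₁ - E₂) * P) :
    (y - x - x * y * P) * (1 + E₁ * x) * (1 + E₂ * y)
      = (1 + E₂ * y) * (1 + E₁ * x) * (y - x - x * y * P) := by
  have cx : ∀ a b : R, a * (x * b) = x * (a * b) := fun a b => by
    rw [← mul_assoc, hx, mul_assoc]
  have cy : ∀ a b : R, a * (y * b) = y * (a * b) := fun a b => by
    rw [← mul_assoc, hy, mul_assoc]
  have eA : (1 + E₁ * x) * (1 + E₂ * y) = 1 + x * E₁ + y * E₂ + x * (y * (E₁ * E₂)) := by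
    rw [hx, hy, mul_add, mul_one, add_mul, one_mul, mul_assoc, cy]
    abel
  have eB : (1 + E₂ * y) * (1 + E₁ * x) = 1 + x * E₁ + y * E₂ + x * (y * (E₂ * E₁)) := by
    rw [hx, hy, mul_add, mul_one, add_mul, one_mul, mul_assoc, cx E₂, cx y]
    abel
  have hd : ∀ b, b * (y - x) = (y - x) * b := fun b => by rw [mul_sub, sub_mul, hx, hy]
  have k1 : P * (1 + x * E₁ + y * E₂ + x * (y * (E₁ * E₂)))
      = (1 + x * E₂ + y * E₁ + x * (y * (E₂ * E₁))) * P := by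
    simp only [mul_add, add_mul, mul_one, one_mul, cx P, cy P, mul_assoc, h₁, h₂]
    rw [← mul_assoc P, h₁, mul_assoc, h₂]
  rw [mul_assoc, eA, eB, sub_mul, mul_assoc (x * y), k1, mul_sub, hd, ← mul_assoc _ (x * y)]
  have k2 : (1 + x * E₁ + y * E₂ + x * (y * (E₂ * E₁))) * (x * y)
      = x * y * (1 + x * E₁ + y * E₂ + x * (y * (E₂ * E₁))) := by
    rw [← mul_assoc, hy, hx, mul_assoc, cx y]
  rw [k2]
  have k3 : x * (y * (E₁ * E₂)) = x * (y * (E₂ * E₁)) + x * (y * ((E₁ - E₂) * P)) := by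
    rw [← h, mul_sub, mul_sub]; abel
  rw [k3]
  have k4 : (y - x) * (x * (y * ((E₁ - E₂) * P))) = x * y * ((y - x) * ((E₁ - E₂) * P)) := by
    rw [← hd, mul_assoc, mul_assoc, hd, mul_assoc]
  rw [← add_assoc, mul_add, k4, sub_eq_sub_iff_add_eq_add,
    add_assoc, mul_assoc (x * y) _ P, ← mul_add]
  congr 2
  simp only [add_mul, mul_sub, sub_mul, one_mul, mul_assoc]
  abel

section Eval

variable {s : Fin 2 → ℤˣ}

/-- The matrix `(s i) e i j` on `L(a, b)`. -/
noncomputable def evalMatrix (s : Fin 2 → ℤˣ) (a b : ℂ) :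
    Matrix (Fin 2) (Fin 2) (Module.End ℂ (Fin 2 → ℂ)) :=
  Matrix.of fun i j => sgn (s i) • evalE a b i j

theorem evalSeries_eq (a b : ℂ) :
    evalSeries s a b = 1 + PowerSeries.C (evalMatrix s a b) * PowerSeries.X := by
  ext1 r
  ext1 i j
  rw [evalSeries, coeff_series, map_add, PowerSeries.coeff_C_mul, PowerSeries.coeff_X,
    PowerSeries.coeff_one]
  rcases r with _ | _ | r
  · simp [Matrix.one_apply]
  · simp [evalMatrix]
  · simp

theorem coeff_zero_evalSeries (a b : ℂ) : PowerSeries.coeff 0 (evalSeries s a b) = 1 := by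
  simp [evalSeries_eq]

theorem evalParity_mul_self : evalParity * evalParity = 1 := by
  rw [evalParity, Module.End.mul_eq_comp, ← Matrix.toLin'_mul]
  ext i j; fin_cases i <;> fin_cases j <;> simp

theorem signs_cases (hs : s 0 ≠ s 1) : (s 0 = 1 ∧ s 1 = -1) ∨ (s 0 = -1 ∧ s 1 = 1) := by
  rcases Int.units_eq_one_or (s 0) with h | h <;> rcases Int.units_eq_one_or (s 1) with h' | h' <;>
    simp_all

theorem isHomogeneous_evalSeries (hs : s 0 ≠ s 1) (a b : ℂ) :
    IsHomogeneous s evalParity (evalSeries s a b) := by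
  intro i j r
  rw [evalSeries, coeff_series]
  split_ifs with h0 h1 h2
  · subst h1; rw [← two_mul, pow_mul]; simp
  · simp
  · rw [mul_smul_comm, smul_mul_assoc, smul_comm]
    congr 1
    rcases signs_cases hs with ⟨h, h'⟩ | ⟨h, h'⟩ <;> fin_cases i <;> fin_cases j <;>
      simp [par, h, h', evalE, evalParity, Module.End.mul_eq_comp, ← Matrix.toLin'_mul] <;>
      (try rw [← map_neg]) <;> congr 1 <;> ext i j <;> fin_cases i <;> fin_cases j <;> simp
  · simp

theorem evalE_apply (a b : ℂ) (v : Fin 2 → ℂ) :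
    evalE a b 0 0 v = ![a * v 0, (a - 1) * v 1] ∧ evalE a b 0 1 v = ![(a + b) * v 1, 0] ∧
      evalE a b 1 0 v = ![0, v 0] ∧ evalE a b 1 1 v = ![b * v 0, (b + 1) * v 1] := by
  refine ⟨?_, ?_, ?_, ?_⟩ <;> funext x <;> fin_cases x <;>
    simp [evalE, Matrix.toLin'_apply, Matrix.mulVec, dotProduct]

set_option maxHeartbeats 1000000 in
theorem evalMatrix_comm (hs : s 0 ≠ s 1) (a b : ℂ) :
    leg₁ s (evalMatrix s a b) * leg₂ (evalMatrix s a b)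
      - leg₂ (evalMatrix s a b) * leg₁ s (evalMatrix s a b)
      = (leg₁ s (evalMatrix s a b) - leg₂ (evalMatrix s a b)) * gradedSwap s := by
  ext1 ⟨i, k⟩ ⟨j, l⟩
  rw [mul_gradedSwap_apply, Matrix.sub_apply, leg₁_mul_leg₂_apply, leg₂_mul_leg₁_apply]
  change _ = _ * (leg₁ s (evalMatrix s a b) _ _ - leg₂ (evalMatrix s a b) _ _)
  rw [leg₁_apply, leg₂_apply]
  simp only [← neg_one_pow_smul]
  have h0 := fun v => (evalE_apply a b v).1
  have h1 := fun v => (evalE_apply a b v).2.1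
  have h2 := fun v => (evalE_apply a b v).2.2.1
  have h3 := fun v => (evalE_apply a b v).2.2.2
  refine LinearMap.ext fun v => funext fun x => ?_
  rcases signs_cases hs with ⟨h, h'⟩ | ⟨h, h'⟩ <;> fin_cases i <;> fin_cases k <;>
    fin_cases j <;> fin_cases l <;> fin_cases x <;>
    simp [par, h, h', evalMatrix, sgn, h0, h1, h2, h3] <;> try ring

/-- The characteristic identity of `gl(1|1)` on `L(a, b)`. -/
theorem evalMatrix_sq (hs : s 0 ≠ s 1) (a b : ℂ) :
    evalMatrix s a b * evalMatrix s a b = (sgn (s 0) * (a - b - 1)) • evalMatrix s a b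
      + (b * (a - 1)) • 1 := by
  ext1 i j
  rw [Matrix.mul_apply, Fin.sum_univ_two]
  have h0 := fun v => (evalE_apply a b v).1
  have h1 := fun v => (evalE_apply a b v).2.1
  have h2 := fun v => (evalE_apply a b v).2.2.1
  have h3 := fun v => (evalE_apply a b v).2.2.2
  refine LinearMap.ext fun v => funext fun x => ?_
  rcases signs_cases hs with ⟨h, h'⟩ | ⟨h, h'⟩ <;> fin_cases i <;> fin_cases j <;> fin_cases x <;>
    simp [h, h', evalMatrix, sgn, h0, h1, h2, h3] <;> ring

theorem isRTT_evalSeries (hs : s 0 ≠ s 1) (a b : ℂ) : IsRTT s (evalSeries s a b) := by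
  set M := evalMatrix s a b with hM
  have e1 : x₁ s (evalSeries s a b) = 1 + inX (PowerSeries.C (leg₁ s M)) * xVar := by
    simp [evalSeries_eq, x₁, inX, xVar, hM]
  have e2 : y₂ (evalSeries s a b) = 1 + inX (PowerSeries.C (leg₂ M)) * yVar := by
    simp [evalSeries_eq, y₂, inX_C, inY, yVar, hM]
  unfold IsRTT
  rw [e1, e2, rMinus]
  refine linear_rtt xVar_comm yVar_comm ?_ ?_ ?_
  · rw [swapSeries, ← map_mul, ← map_mul, ← map_mul, ← map_mul, gradedSwap_mul_leg₁]
  · rw [swapSeries, ← map_mul, ← map_mul, ← map_mul, ← map_mul, gradedSwap_mul_leg₂]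
  · rw [swapSeries]
    simp only [← map_mul, ← map_sub]
    rw [evalMatrix_comm hs]

/-- If `m ^ 2 = t m + d` with `t` and `d` central, then the inverse of `1 - m x` is
`(1 - t x + m x) / (1 - t x - d x ^ 2)`. -/
theorem quadratic_inverse {R : Type*} [Ring R] {t d x m S : R} (ct : ∀ F, F * t = t * F)
    (cd : ∀ F, F * d = d * F) (cx : ∀ F, F * x = x * F) (hm : m * m = t * m + d)
    (hS : S * (1 - m * x) = 1) : (1 - t * x - d * x ^ 2) * S = 1 - t * x + m * x := by
  have e1 : m * x * (t * x) = t * m * x ^ 2 := by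
    rw [← mul_assoc, ct, sq]; simp only [mul_assoc]
  have e2 : m * x * (m * x) = (t * m + d) * x ^ 2 := by
    rw [← hm, mul_assoc, ← mul_assoc x, ← cx, sq]; simp only [mul_assoc]
  have key : (1 - m * x) * (1 - t * x + m * x) = 1 - t * x - d * x ^ 2 := by
    rw [sub_mul, one_mul, mul_add, mul_sub, mul_one, e1, e2, add_mul]
    abel
  have hc : (1 - t * x - d * x ^ 2) * S = S * (1 - t * x - d * x ^ 2) := by
    have c1 : t * x * S = S * (t * x) := by rw [mul_assoc, ← cx, ← mul_assoc, ← ct, mul_assoc]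
    have c2 : d * x ^ 2 * S = S * (d * x ^ 2) := by
      rw [sq, ← mul_assoc, mul_assoc, ← cx, ← mul_assoc, mul_assoc d, ← cx, ← mul_assoc, ← cd]
      simp only [mul_assoc]
    rw [sub_mul, sub_mul, one_mul, c1, c2, mul_sub, mul_sub, mul_one]
  rw [hc, ← key, ← mul_assoc, hS, one_mul]

theorem negHom_one_add {N : Type*} [Ring N] (m : N) :
    negHom (1 + PowerSeries.C m * PowerSeries.X) = 1 - PowerSeries.C m * PowerSeries.X := by
  rw [map_add, map_mul, negHom_X, negHom_C, map_one, mul_neg, sub_eq_add_neg]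

/-- If the matrix `M` is a root of a quadratic polynomial, then the inverse of `1 - u⁻¹ M` is
linear in `M`, up to a scalar factor. -/
theorem negHom_inverse_linear {A : Type*} [Ring A] [Algebra ℂ A] {M : Matrix (Fin 2) (Fin 2) A}
    {τ δ : ℂ} (hM : M * M = τ • M + δ • 1) :
    scalarSeries A (1 - PowerSeries.C τ * PowerSeries.X - PowerSeries.C δ * PowerSeries.X ^ 2)
        * negHom (inverse (1 + PowerSeries.C M * PowerSeries.X))
      = scalarSeries A (1 - PowerSeries.C τ * PowerSeries.X)
        + PowerSeries.C M * PowerSeries.X := by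
  have hX : scalarSeries A PowerSeries.X = PowerSeries.X := PowerSeries.map_X _
  have h1 : negHom (inverse (1 + PowerSeries.C M * PowerSeries.X))
      * (1 - PowerSeries.C M * PowerSeries.X) = 1 := by
    rw [← negHom_one_add, ← map_mul, inverse_mul (by simp), map_one]
  have hMM : PowerSeries.C M * PowerSeries.C M
      = scalarSeries A (PowerSeries.C τ) * PowerSeries.C M + scalarSeries A (PowerSeries.C δ) := by
    rw [← map_mul, hM, scalarSeries, PowerSeries.map_C, PowerSeries.map_C,
      ← map_mul, ← map_add, Algebra.smul_def, Algebra.smul_def, mul_one]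
  simp only [map_sub, map_mul, map_pow, map_one, hX]
  exact quadratic_inverse (fun F => scalarSeries_central _ F) (fun F => scalarSeries_central _ F)
    (fun F => (PowerSeries.commute_X F).eq) hMM h1

theorem negHom_inverse_evalSeries (hs : s 0 ≠ s 1) (a b : ℂ) :
    scalarSeries _ (1 - PowerSeries.C (sgn (s 0) * (a - b - 1)) * PowerSeries.X
        - PowerSeries.C (b * (a - 1)) * PowerSeries.X ^ 2) * negHom (inverse (evalSeries s a b))
      = scalarSeries _ (1 - PowerSeries.C (sgn (s 0) * (a - b - 1)) * PowerSeries.X)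
        + PowerSeries.C (evalMatrix s a b) * PowerSeries.X := by
  rw [evalSeries_eq]
  exact negHom_inverse_linear (evalMatrix_sq hs a b)

end Eval

/-! ### Iterated tensor products of evaluation modules -/

section Iterated

variable {s : Fin 2 → ℤˣ}

theorem tensorParity_mul_self (L : List (ℂ × ℂ)) : tensorParity L * tensorParity L = 1 := by
  induction L with
  | nil => exact one_mul (1 : Module.End ℂ ℂ)
  | cons p L ih =>
    have h : (TensorProduct.map evalParity (tensorParity L) :
        Module.End ℂ ((Fin 2 → ℂ) ⊗[ℂ] (tensorSpace L))) * TensorProduct.map evalParity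
          (tensorParity L) = 1 := by
      rw [← TensorProduct.map_mul, ih, evalParity_mul_self, TensorProduct.map_one]
    exact h

theorem isRTT_one {A : Type*} [Ring A] : IsRTT s (1 : MatSeries 2 A) := by
  simp [IsRTT]

theorem tensorEvalSeries_spec (hs : s 0 ≠ s 1) (L : List (ℂ × ℂ)) :
    PowerSeries.coeff 0 (tensorEvalSeries s L) = 1 ∧ IsRTT s (tensorEvalSeries s L) ∧
      IsHomogeneous s (tensorParity L) (tensorEvalSeries s L) := by
  induction L with
  | nil =>
    refine ⟨PowerSeries.coeff_zero_one, isRTT_one, ?_⟩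
    rw [isHomogeneous_iff]
    exact (mul_one _).trans (one_mul _).symm
  | cons p L ih =>
    obtain ⟨h1, h2, h3⟩ := ih
    have hp := isHomogeneous_evalSeries hs p.1 p.2
    exact ⟨coeff_zero_tensorSeries evalParity_mul_self (coeff_zero_evalSeries _ _) h1,
      (isRTT_evalSeries hs p.1 p.2).tensorSeries h2 hp, hp.tensorSeries h3⟩

instance finiteDimensional_tensorSpace (L : List (ℂ × ℂ)) :
    FiniteDimensional ℂ (tensorSpace L) := by
  induction L with
  | nil => exact inferInstanceAs (FiniteDimensional ℂ ℂ)
  | cons p L ih => exact inferInstanceAs (FiniteDimensional ℂ ((Fin 2 → ℂ) ⊗[ℂ] tensorSpace L))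

theorem finrank_tensorSpace (L : List (ℂ × ℂ)) :
    Module.finrank ℂ (tensorSpace L) = 2 ^ L.length := by
  induction L with
  | nil => exact Module.finrank_self ℂ
  | cons p L ih =>
    have : Module.finrank ℂ ((Fin 2 → ℂ) ⊗[ℂ] tensorSpace L) = 2 ^ (L.length + 1) := by
      rw [Module.finrank_tensorProduct, ih, Module.finrank_fintype_fun_eq_card, Fintype.card_fin,
        pow_succ']
    exact this

end Iterated

/-! ### Matrix coefficients -/

section MatrixCoefficients

variable {V M : Type*} [AddCommGroup V] [Module ℂ V] [AddCommGroup M] [Module ℂ M]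
  {s : Fin 2 → ℤˣ}

/-- The series of the matrix coefficients `ψ (b i j (u) w)`. -/
noncomputable def matCoeff (B : MatSeries 2 (Module.End ℂ M)) (i j : Fin 2) (ψ : Module.Dual ℂ M)
    (w : M) : PowerSeries ℂ :=
  PowerSeries.mk fun r => ψ (PowerSeries.coeff r B i j w)

variable (B : MatSeries 2 (Module.End ℂ M)) (i j : Fin 2) (ψ ψ' : Module.Dual ℂ M) (w w' : M)

theorem matCoeff_add_right :
    matCoeff B i j ψ (w + w') = matCoeff B i j ψ w + matCoeff B i j ψ w' := by
  ext r; simp [matCoeff]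

theorem matCoeff_smul_right (c : ℂ) :
    matCoeff B i j ψ (c • w) = PowerSeries.C c * matCoeff B i j ψ w := by
  ext r; simp [matCoeff]

theorem matCoeff_smul_left (c : ℂ) :
    matCoeff B i j (c • ψ) w = PowerSeries.C c * matCoeff B i j ψ w := by
  ext r; simp [matCoeff]

theorem matCoeff_zero_left : matCoeff B i j 0 w = 0 := by
  ext r; simp [matCoeff]

theorem matCoeff_neg_left : matCoeff B i j (-ψ) w = - matCoeff B i j ψ w := by
  ext r; simp [matCoeff]

theorem matCoeff_add (B' : MatSeries 2 (Module.End ℂ M)) :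
    matCoeff (B + B') i j ψ w = matCoeff B i j ψ w + matCoeff B' i j ψ w := by
  ext r; simp [matCoeff]

theorem matCoeff_C_mul (E : Matrix (Fin 2) (Fin 2) (Module.End ℂ M)) :
    matCoeff (PowerSeries.C E * B) i j ψ w = ∑ k, matCoeff B k j (ψ.comp (E i k)) w := by
  ext r
  simp [matCoeff, PowerSeries.coeff_C_mul, Matrix.mul_apply]

theorem matCoeff_mul_C (E : Matrix (Fin 2) (Fin 2) (Module.End ℂ M)) :
    matCoeff (B * PowerSeries.C E) i j ψ w = ∑ k, matCoeff B i k ψ (E k j w) := by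
  ext r
  simp [matCoeff, PowerSeries.coeff_mul_C, Matrix.mul_apply]

theorem matCoeff_scalarSeries_mul (h : PowerSeries ℂ) :
    matCoeff (scalarSeries _ h * B) i j ψ w = h * matCoeff B i j ψ w := by
  ext r
  rw [PowerSeries.coeff_mul, matCoeff, PowerSeries.coeff_mk, PowerSeries.coeff_mul,
    Matrix.sum_apply, LinearMap.sum_apply, map_sum]
  refine Finset.sum_congr rfl fun m _ => ?_
  rw [scalarSeries, PowerSeries.coeff_map, ← Algebra.smul_def, Matrix.smul_apply,
    LinearMap.smul_apply, map_smul, smul_eq_mul, matCoeff, PowerSeries.coeff_mk]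

theorem matCoeff_X_mul :
    matCoeff (PowerSeries.X * B) i j ψ w = PowerSeries.X * matCoeff B i j ψ w := by
  rw [← matCoeff_scalarSeries_mul, scalarSeries, PowerSeries.map_X]

theorem matCoeff_rightSeries (σ : Module.End ℂ V) (ψ : Module.Dual ℂ (V ⊗[ℂ] M)) (v : V) :
    matCoeff (rightSeries s σ B) i j ψ (v ⊗ₜ w)
      = matCoeff B i j (ψ.comp (TensorProduct.mk ℂ V M ((σ ^ (par s i + par s j)) v))) w := by
  ext r
  simp only [matCoeff, PowerSeries.coeff_mk, coeff_rightSeries]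
  rfl

theorem leftSeries_scalarSeries (h : PowerSeries ℂ) :
    leftSeries V M (scalarSeries _ h) = scalarSeries _ h := by
  ext1 r
  ext1 i j
  rw [coeff_leftSeries, scalarSeries, scalarSeries, PowerSeries.coeff_map, PowerSeries.coeff_map,
    Matrix.algebraMap_matrix_apply, Matrix.algebraMap_matrix_apply]
  split_ifs <;> simp

theorem leftSeries_C (E : Matrix (Fin 2) (Fin 2) (Module.End ℂ V)) :
    leftSeries V M (PowerSeries.C E)
      = PowerSeries.C ((onLeft V M : Module.End ℂ V →+* _).mapMatrix E) := by
  simp [leftSeries, opMap]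

theorem leftSeries_X : leftSeries V M PowerSeries.X = PowerSeries.X := by
  simp [leftSeries, opMap]

/-- The functional `w ↦ ψ (v ⊗ w)`. -/
noncomputable def slice (ψ : Module.Dual ℂ (V ⊗[ℂ] M)) (v : V) : Module.Dual ℂ M :=
  ψ.comp (TensorProduct.mk ℂ V M v)

theorem slice_smul (ψ : Module.Dual ℂ (V ⊗[ℂ] M)) (c : ℂ) (v : V) :
    slice ψ (c • v) = c • slice ψ v := by ext; simp [slice]

theorem slice_neg (ψ : Module.Dual ℂ (V ⊗[ℂ] M)) (v : V) : slice ψ (-v) = -slice ψ v := by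
  ext; simp [slice]

theorem slice_zero (ψ : Module.Dual ℂ (V ⊗[ℂ] M)) : slice ψ (0 : V) = 0 := by
  ext; simp [slice]

/-- The matrix coefficients of the tensor product with an evaluation module. -/
theorem matCoeff_reflectBy_evalSeries (hs : s 0 ≠ s 1) (a b : ℂ)
    (ψ : Module.Dual ℂ ((Fin 2 → ℂ) ⊗[ℂ] M)) (v : Fin 2 → ℂ) :
    (1 - PowerSeries.C (sgn (s 0) * (a - b - 1)) * PowerSeries.X
        - PowerSeries.C (b * (a - 1)) * PowerSeries.X ^ 2) *
      matCoeff (reflectBy (rightSeries s evalParity B) (leftSeries _ M (evalSeries s a b))) i j ψ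
        (v ⊗ₜ w)
    = (1 - PowerSeries.C (sgn (s 0) * (a - b - 1)) * PowerSeries.X) *
        (matCoeff B i j (slice ψ ((evalParity ^ (par s i + par s j)) v)) w
          + PowerSeries.X * ∑ k, matCoeff B k j
            (slice ψ (evalMatrix s a b i k ((evalParity ^ (par s k + par s j)) v))) w)
      + PowerSeries.X * (∑ l, (matCoeff B i l
            (slice ψ ((evalParity ^ (par s i + par s l)) (evalMatrix s a b l j v))) w
          + PowerSeries.X * ∑ k, matCoeff B k l
            (slice ψ (evalMatrix s a b i k
              ((evalParity ^ (par s k + par s l)) (evalMatrix s a b l j v)))) w)) := by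
  rw [← matCoeff_scalarSeries_mul]
  set R := (rightSeries s evalParity B : MatSeries 2 (Module.End ℂ ((Fin 2 → ℂ) ⊗[ℂ] M))) with hR
  set E : Matrix (Fin 2) (Fin 2) (Module.End ℂ ((Fin 2 → ℂ) ⊗[ℂ] M)) :=
    (onLeft (Fin 2 → ℂ) M : Module.End ℂ (Fin 2 → ℂ) →+* _).mapMatrix (evalMatrix s a b) with hE
  have hT : leftSeries _ M (evalSeries s a b) = 1 + PowerSeries.X * PowerSeries.C E := by
    rw [evalSeries_eq, map_add, map_mul, leftSeries_C, leftSeries_X, map_one,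
      (PowerSeries.commute_X _).eq]
  have hS := negHom_inverse_evalSeries hs a b
  generalize (1 - PowerSeries.C (sgn (s 0) * (a - b - 1)) * PowerSeries.X
        - PowerSeries.C (b * (a - 1)) * PowerSeries.X ^ 2 : PowerSeries ℂ) = n at hS ⊢
  generalize (1 - PowerSeries.C (sgn (s 0) * (a - b - 1)) * PowerSeries.X : PowerSeries ℂ) = ν
    at hS ⊢
  replace hS := congrArg (leftSeries (Fin 2 → ℂ) M) hS
  rw [map_mul, map_add, leftSeries_scalarSeries, leftSeries_scalarSeries, map_mul, leftSeries_C,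
    leftSeries_X, ← hE] at hS
  have key : scalarSeries _ n * reflectBy R (leftSeries _ M (evalSeries s a b))
      = scalarSeries _ ν * (R + PowerSeries.X * (PowerSeries.C E * R))
        + PowerSeries.X * ((R + PowerSeries.X * (PowerSeries.C E * R)) * PowerSeries.C E) := by
    rw [reflectBy, leftSeries, inverse_opMap _ (coeff_zero_evalSeries a b), negHom_opMap]
    change scalarSeries _ n * (leftSeries _ M (evalSeries s a b) * R
      * leftSeries _ M (negHom (inverse (evalSeries s a b)))) = _
    rw [← scalarSeries_central, mul_assoc, scalarSeries_central, hS, hT, add_mul, one_mul, mul_add,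
      scalarSeries_central, ← mul_assoc _ (PowerSeries.C E), (PowerSeries.commute_X _).eq,
      mul_assoc PowerSeries.X (PowerSeries.C E) R]
  rw [key, matCoeff_add, matCoeff_scalarSeries_mul, matCoeff_add, matCoeff_X_mul, matCoeff_C_mul,
    matCoeff_X_mul, matCoeff_mul_C]
  simp only [matCoeff_add, matCoeff_X_mul, matCoeff_C_mul]
  have hv : ∀ k l v, E k l (v ⊗ₜ w) = (evalMatrix s a b k l v) ⊗ₜ w := fun k l v => rfl
  simp only [hv, hR, matCoeff_rightSeries]
  rfl

/-- The basis vector `v⁺`. -/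
def vPlus : Fin 2 → ℂ := ![1, 0]

/-- The basis vector `v⁻`. -/
def vMinus : Fin 2 → ℂ := ![0, 1]

theorem evalE_vPlus (a b : ℂ) : evalE a b 0 0 vPlus = a • vPlus ∧ evalE a b 0 1 vPlus = 0 ∧
    evalE a b 1 0 vPlus = vMinus ∧ evalE a b 1 1 vPlus = b • vPlus := by
  have h := evalE_apply a b vPlus
  refine ⟨h.1.trans ?_, h.2.1.trans ?_, h.2.2.1.trans ?_, h.2.2.2.trans ?_⟩ <;>
    simp [vPlus, vMinus]

theorem evalE_vMinus (a b : ℂ) : evalE a b 0 0 vMinus = (a - 1) • vMinus ∧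
    evalE a b 0 1 vMinus = (a + b) • vPlus ∧
    evalE a b 1 0 vMinus = 0 ∧ evalE a b 1 1 vMinus = (b + 1) • vMinus := by
  have h := evalE_apply a b vMinus
  refine ⟨h.1.trans ?_, h.2.1.trans ?_, h.2.2.1.trans ?_, h.2.2.2.trans ?_⟩ <;>
    simp [vPlus, vMinus]

theorem evalParity_vPlus : evalParity vPlus = vPlus := by
  funext i; fin_cases i <;> simp [evalParity, vPlus, Matrix.toLin'_apply]

theorem evalParity_vMinus : evalParity vMinus = -vMinus := by
  funext i; fin_cases i <;> simp [evalParity, vMinus, Matrix.toLin'_apply]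

theorem evalParity_pow (hs : s 0 ≠ s 1) :
    evalParity ^ (par s 0 + par s 0) = 1 ∧ evalParity ^ (par s 0 + par s 1) = evalParity ∧
    evalParity ^ (par s 1 + par s 0) = evalParity ∧ evalParity ^ (par s 1 + par s 1) = 1 := by
  rcases signs_cases hs with ⟨h, h'⟩ | ⟨h, h'⟩ <;> simp [par, h, h', sq, evalParity_mul_self]

theorem sgn_one_eq_neg (hs : s 0 ≠ s 1) : sgn (s 1) = -sgn (s 0) := by
  rcases signs_cases hs with ⟨h, h'⟩ | ⟨h, h'⟩ <;> simp [sgn, h, h']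

theorem sgn_mul_self (x : ℤˣ) : sgn x * sgn x = 1 := by
  rcases Int.units_eq_one_or x with h | h <;> simp [sgn, h]

/-- The variable `s₁ u⁻¹`. -/
noncomputable def sX (s : Fin 2 → ℤˣ) : PowerSeries ℂ := PowerSeries.C (sgn (s 0)) * PowerSeries.X

/-- The linear polynomial `1 + c (s₁ u⁻¹)`. -/
noncomputable def lin (s : Fin 2 → ℤˣ) (c : ℂ) : PowerSeries ℂ := 1 + PowerSeries.C c * sX s

/-- The quadratic polynomial by which `T(-u)⁻¹` has to be multiplied on `L(a, b)`. -/
noncomputable def evalDenom (s : Fin 2 → ℤˣ) (a b : ℂ) : PowerSeries ℂ :=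
  1 - PowerSeries.C (a - b - 1) * sX s - PowerSeries.C (b * (a - 1)) * sX s ^ 2

/-- The action of `B(u)` on `L(a, b) ⊗ M`, for a module `M` on which it acts by `B`. -/
noncomputable def evalTensor (s : Fin 2 → ℤˣ) (a b : ℂ) (B : MatSeries 2 (Module.End ℂ M)) :
    MatSeries 2 (Module.End ℂ ((Fin 2 → ℂ) ⊗[ℂ] M)) :=
  reflectBy (rightSeries s evalParity B) (leftSeries _ M (evalSeries s a b))

/-- The matrix coefficients of `L(a, b) ⊗ M`, expressed through those of `M`. -/
theorem matCoeff_evalTensor (hs : s 0 ≠ s 1) (a b : ℂ)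
    (ψ : Module.Dual ℂ ((Fin 2 → ℂ) ⊗[ℂ] M)) :
    (evalDenom s a b * matCoeff (evalTensor s a b B) 0 0 ψ (vPlus ⊗ₜ w)
      = lin s a * lin s (b + 1) * matCoeff B 0 0 (slice ψ vPlus) w
        - PowerSeries.C (a + b) * sX s ^ 2 * matCoeff B 1 1 (slice ψ vPlus) w
        + sX s * lin s (a - 1) * matCoeff B 0 1 (slice ψ vMinus) w) ∧
    (evalDenom s a b * matCoeff (evalTensor s a b B) 0 0 ψ (vMinus ⊗ₜ w)
      = lin s (a - 1) * lin s b * matCoeff B 0 0 (slice ψ vMinus) w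
        - PowerSeries.C (a + b) * sX s * lin s b * matCoeff B 1 0 (slice ψ vPlus) w) ∧
    (evalDenom s a b * matCoeff (evalTensor s a b B) 0 1 ψ (vPlus ⊗ₜ w)
      = lin s a * lin s (1 - a) * matCoeff B 0 1 (slice ψ vPlus) w) ∧
    (evalDenom s a b * matCoeff (evalTensor s a b B) 0 1 ψ (vMinus ⊗ₜ w)
      = PowerSeries.C (a + b) * sX s * (lin s a * matCoeff B 0 0 (slice ψ vPlus) w
          + lin s (-a) * matCoeff B 1 1 (slice ψ vPlus) w)
        - lin s (a - 1) * lin s (-a) * matCoeff B 0 1 (slice ψ vMinus) w) ∧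
    (evalDenom s a b * matCoeff (evalTensor s a b B) 1 0 ψ (vPlus ⊗ₜ w)
      = lin s (b + 1) * lin s (-b) * matCoeff B 1 0 (slice ψ vPlus) w
        - sX s * (lin s (b + 1) * matCoeff B 0 0 (slice ψ vMinus) w
          + lin s (-(b + 1)) * matCoeff B 1 1 (slice ψ vMinus) w)) ∧
    (evalDenom s a b * matCoeff (evalTensor s a b B) 1 0 ψ (vMinus ⊗ₜ w)
      = -(lin s (-(b + 1)) * lin s b * matCoeff B 1 0 (slice ψ vMinus) w)) ∧
    (evalDenom s a b * matCoeff (evalTensor s a b B) 1 1 ψ (vPlus ⊗ₜ w)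
      = lin s (-b) * lin s (1 - a) * matCoeff B 1 1 (slice ψ vPlus) w
        - sX s * lin s (1 - a) * matCoeff B 0 1 (slice ψ vMinus) w) ∧
    (evalDenom s a b * matCoeff (evalTensor s a b B) 1 1 ψ (vMinus ⊗ₜ w)
      = lin s (-(b + 1)) * lin s (-a) * matCoeff B 1 1 (slice ψ vMinus) w
        - PowerSeries.C (a + b) * sX s ^ 2 * matCoeff B 0 0 (slice ψ vMinus) w
        + PowerSeries.C (a + b) * sX s * lin s (-b) * matCoeff B 1 0 (slice ψ vPlus) w) := by
  obtain ⟨p1, p2, p3, p4⟩ := evalParity_pow hs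
  obtain ⟨e1, e2, e3, e4⟩ := evalE_vPlus a b
  obtain ⟨f1, f2, f3, f4⟩ := evalE_vMinus a b
  have hS := congrArg PowerSeries.C (sgn_mul_self (s 0))
  rw [map_mul, map_one] at hS
  have hd : evalDenom s a b = 1 - PowerSeries.C (sgn (s 0) * (a - b - 1)) * PowerSeries.X
      - PowerSeries.C (b * (a - 1)) * PowerSeries.X ^ 2 := by
    rw [evalDenom, sX, mul_pow, sq (PowerSeries.C (sgn (s 0))), hS, one_mul, ← mul_assoc, ← map_mul,
      mul_comm (a - b - 1)]
  rw [hd, evalTensor]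
  refine ⟨?_, ?_, ?_, ?_, ?_, ?_, ?_, ?_⟩ <;>
  · rw [matCoeff_reflectBy_evalSeries B _ _ _ hs]
    simp only [Fin.sum_univ_two, evalMatrix, Matrix.of_apply, LinearMap.smul_apply, p1, p2, p3,
      p4, Module.End.one_apply, evalParity_vPlus, evalParity_vMinus, e1, e2, e3, e4, f1, f2, f3,
      f4, map_smul, map_neg, map_zero, smul_zero, smul_neg, slice_smul, slice_neg, slice_zero,
      matCoeff_smul_left, matCoeff_neg_left, matCoeff_zero_left, sgn_one_eq_neg hs, lin, sX,
      map_mul, map_sub, map_add, map_one, neg_smul]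
    generalize PowerSeries.C (sgn (s 0)) = S at hS ⊢
    clear hd p1 p2 p3 p4 e1 e2 e3 e4 f1 f2 f3 f4
    grind

end MatrixCoefficients

/-! ### Extremal vectors of tensor products -/

section Extremal

variable {s : Fin 2 → ℤˣ}

/-- Polynomials in `s₁ u⁻¹`, as power series. -/
noncomputable def polySeries (s : Fin 2 → ℤˣ) : Polynomial ℂ →ₐ[ℂ] PowerSeries ℂ :=
  Polynomial.aeval (sX s)

theorem coeff_polySeries (q : Polynomial ℂ) (n : ℕ) :
    PowerSeries.coeff n (polySeries s q) = sgn (s 0) ^ n * q.coeff n := by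
  induction q using Polynomial.induction_on' with
  | add p q hp hq => rw [map_add, map_add, hp, hq, Polynomial.coeff_add, mul_add]
  | monomial k c =>
    have h : polySeries s (Polynomial.monomial k c)
        = PowerSeries.C (c * sgn (s 0) ^ k) * PowerSeries.X ^ k := by
      rw [polySeries, Polynomial.aeval_monomial, sX, mul_pow, ← mul_assoc, map_mul, map_pow]
      rfl
    rw [h, PowerSeries.coeff_C_mul, PowerSeries.coeff_X_pow, Polynomial.coeff_monomial]
    rcases eq_or_ne n k with rfl | hk
    · simp [mul_comm]
    · simp [hk, hk.symm]

theorem polySeries_injective : Function.Injective (polySeries s) := by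
  intro p q h
  ext n
  have := congrArg (PowerSeries.coeff n) h
  rw [coeff_polySeries, coeff_polySeries] at this
  have hs : sgn (s 0) ≠ 0 := fun h0 => by simpa [h0] using sgn_mul_self (s 0)
  exact mul_left_cancel₀ (pow_ne_zero n hs) this

theorem polySeries_X : polySeries s Polynomial.X = sX s := Polynomial.aeval_X _

theorem polySeries_C (c : ℂ) : polySeries s (Polynomial.C c) = PowerSeries.C c :=
  Polynomial.aeval_C _ _

theorem lin_ne_zero (c : ℂ) : lin s c ≠ 0 := fun h => by
  simpa [lin, sX] using congrArg PowerSeries.constantCoeff h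

theorem constantCoeff_evalDenom (a b : ℂ) : PowerSeries.constantCoeff (evalDenom s a b) = 1 := by
  simp [evalDenom, sX]

theorem evalDenom_ne_zero (a b : ℂ) : evalDenom s a b ≠ 0 := fun h => by
  simpa [constantCoeff_evalDenom] using congrArg PowerSeries.constantCoeff h

/-- The evaluation that separates the factors: at the zero `-1/a` of the first factor, respectively
at the zero `-1` of the second factor if `a = 0`, only the last term survives. -/
theorem eq_zero_of_evaluation {q p₁ p₂ R : Polynomial ℂ} {a k : ℂ}
    (h : (1 + Polynomial.C a * Polynomial.X) * (1 + Polynomial.C (1 - a) * Polynomial.X) * q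
      + Polynomial.C k * Polynomial.X * ((1 + Polynomial.C a * Polynomial.X) * p₁
        + (1 + Polynomial.C (-a) * Polynomial.X) * p₂) = 0)
    (hR : (2 + Polynomial.X) * p₁ - Polynomial.X * p₂ = 2 * R)
    (h2 : a ≠ 0 → p₂.eval (-a⁻¹) ≠ 0) (h0 : a = 0 → R.eval (-1) ≠ 0) : k = 0 := by
  by_cases ha : a = 0
  · have e1 := congrArg (Polynomial.eval (-1)) h
    have e2 := congrArg (Polynomial.eval (-1)) hR
    subst ha
    simp at e1 e2
    have h0' := h0 rfl
    by_contra hk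
    have e3 := e1.resolve_left hk
    apply h0'
    linear_combination (1 / 2 : ℂ) * e3 - (1 / 2 : ℂ) * e2
  · have e1 := congrArg (Polynomial.eval (-a⁻¹)) h
    simp [ha] at e1
    rcases e1 with h' | h'
    · exact h'
    · exact absurd h' (h2 ha)

variable {M : Type*} [AddCommGroup M] [Module ℂ M]

/-- The module has a highest weight vector `ξ` and a functional `ξ'` that is a highest weight
vector of the dual, both unique up to a factor. The weight `m` is recorded by the polynomials
`p = N m₂` and `R = N ((2 + t) m₁ - t m₂) / 2` in `t = s₁ u⁻¹`, where `N` is a common denominator of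
all the matrix coefficients. -/
structure IsExtremalPair (s : Fin 2 → ℤˣ) (B : MatSeries 2 (Module.End ℂ M)) (ξ : M)
    (ξ' : Module.Dual ℂ M) (m : Fin 2 → PowerSeries ℂ) (N : PowerSeries ℂ) (p R : Polynomial ℂ) :
    Prop where
  pairing : ξ' ξ = 1
  raising : ∀ ψ, matCoeff B 0 1 ψ ξ = 0
  lowering : ∀ w, matCoeff B 1 0 ξ' w = 0
  weight : ∀ i ψ, matCoeff B i i ψ ξ = PowerSeries.C (ψ ξ) * m i
  coweight : ∀ i w, matCoeff B i i ξ' w = PowerSeries.C (ξ' w) * m i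
  ker : ∀ w, (∀ ψ, matCoeff B 0 1 ψ w = 0) → ∃ c : ℂ, w = c • ξ
  coker : ∀ ψ, (∀ w, matCoeff B 1 0 ψ w = 0) → ∃ c : ℂ, ψ = c • ξ'
  poly : ∀ i j ψ w, ∃ q, polySeries s q = N * matCoeff B i j ψ w
  denom : N ≠ 0
  second : N * m 1 = polySeries s p
  first : N * ((2 + sX s) * m 0 - sX s * m 1) = polySeries s (2 * R)

/-- The functional `v ⊗ w ↦ (v i) φ w`. -/
noncomputable def coordDual (i : Fin 2) (φ : Module.Dual ℂ M) :
    Module.Dual ℂ ((Fin 2 → ℂ) ⊗[ℂ] M) :=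
  (TensorProduct.lid ℂ ℂ).toLinearMap ∘ₗ TensorProduct.map (LinearMap.proj i) φ

theorem slice_coordDual (i : Fin 2) (φ : Module.Dual ℂ M) (v : Fin 2 → ℂ) :
    slice (coordDual i φ) v = v i • φ := by
  ext w; simp [slice, coordDual]

theorem exists_components (z : (Fin 2 → ℂ) ⊗[ℂ] M) :
    ∃ w₁ w₂ : M, z = vPlus ⊗ₜ w₁ + vMinus ⊗ₜ w₂ := by
  induction z using TensorProduct.induction_on with
  | zero => exact ⟨0, 0, by simp⟩
  | tmul v w =>
    refine ⟨v 0 • w, v 1 • w, ?_⟩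
    rw [← TensorProduct.smul_tmul, ← TensorProduct.smul_tmul, ← TensorProduct.add_tmul]
    congr 1
    funext i; fin_cases i <;> simp [vPlus, vMinus]
  | add x y hx hy =>
    obtain ⟨w₁, w₂, rfl⟩ := hx
    obtain ⟨w₁', w₂', rfl⟩ := hy
    refine ⟨w₁ + w₁', w₂ + w₂', ?_⟩
    rw [TensorProduct.tmul_add, TensorProduct.tmul_add]
    abel

theorem dual_ext {ψ ψ' : Module.Dual ℂ ((Fin 2 → ℂ) ⊗[ℂ] M)} (h₁ : slice ψ vPlus = slice ψ' vPlus)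
    (h₂ : slice ψ vMinus = slice ψ' vMinus) : ψ = ψ' := by
  refine LinearMap.ext fun z => ?_
  obtain ⟨w₁, w₂, rfl⟩ := exists_components z
  have e1 := LinearMap.congr_fun h₁ w₁
  have e2 := LinearMap.congr_fun h₂ w₂
  simp only [slice, LinearMap.comp_apply, TensorProduct.mk_apply] at e1 e2
  rw [map_add, map_add, e1, e2]

/-- The evaluation for the matrix coefficients of a module with extremal vectors `ξ` and `ξ'`; the
weight enters through `p` and `R`. -/
theorem IsExtremalPair.evaluation {B : MatSeries 2 (Module.End ℂ M)} {ξ : M}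
    {ξ' : Module.Dual ℂ M} {m : Fin 2 → PowerSeries ℂ} {N : PowerSeries ℂ} {p R : Polynomial ℂ}
    (h : IsExtremalPair s B ξ ξ' m N p R) {i j : Fin 2} {φ : Module.Dual ℂ M} {w : M} {a k : ℂ}
    (h2 : a ≠ 0 → p.eval (-a⁻¹) ≠ 0) (h0 : a = 0 → R.eval (-1) ≠ 0)
    (e : lin s a * lin s (1 - a) * matCoeff B i j φ w
      + PowerSeries.C k * sX s * (lin s a * m 0 + lin s (-a) * m 1) = 0) : k = 0 := by
  obtain ⟨q, hq⟩ := h.poly i j φ w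
  obtain ⟨p₁, hp₁⟩ := h.poly 0 0 ξ' ξ
  rw [h.weight, h.pairing, map_one, one_mul] at hp₁
  refine eq_zero_of_evaluation (q := q) (p₁ := p₁) (p₂ := p) (R := R) (a := a) ?_ ?_ h2 h0
  · apply polySeries_injective (s := s)
    simp only [map_add, map_mul, polySeries_X, polySeries_C, map_one, hq, hp₁, map_zero,
      ← h.second]
    simp only [lin] at e
    linear_combination N * e
  · apply polySeries_injective (s := s)
    rw [← h.first]
    simp only [map_add, map_sub, map_mul, polySeries_X, hp₁, ← h.second, map_ofNat]
    ring

theorem polySeries_lin (c : ℂ) :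
    polySeries s (1 + Polynomial.C c * Polynomial.X) = lin s c := by
  rw [map_add, map_one, map_mul, polySeries_C, polySeries_X, lin]

/-- The matrix coefficients that become polynomials after multiplication by `N`. -/
def PolyUpTo (s : Fin 2 → ℤˣ) (N f : PowerSeries ℂ) : Prop := ∃ q, polySeries s q = N * f

theorem PolyUpTo.add {N f g : PowerSeries ℂ} (hf : PolyUpTo s N f) (hg : PolyUpTo s N g) :
    PolyUpTo s N (f + g) := by
  obtain ⟨p, hp⟩ := hf
  obtain ⟨q, hq⟩ := hg
  exact ⟨p + q, by rw [map_add, hp, hq, mul_add]⟩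

theorem PolyUpTo.sub {N f g : PowerSeries ℂ} (hf : PolyUpTo s N f) (hg : PolyUpTo s N g) :
    PolyUpTo s N (f - g) := by
  obtain ⟨p, hp⟩ := hf
  obtain ⟨q, hq⟩ := hg
  exact ⟨p - q, by rw [map_sub, hp, hq, mul_sub]⟩

theorem PolyUpTo.neg {N f : PowerSeries ℂ} (hf : PolyUpTo s N f) : PolyUpTo s N (-f) := by
  obtain ⟨p, hp⟩ := hf
  exact ⟨-p, by rw [map_neg, hp, mul_neg]⟩

theorem PolyUpTo.C_mul {N f : PowerSeries ℂ} (hf : PolyUpTo s N f) (c : ℂ) :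
    PolyUpTo s N (PowerSeries.C c * f) := by
  obtain ⟨p, hp⟩ := hf
  exact ⟨Polynomial.C c * p, by rw [map_mul, hp, polySeries_C]; ring⟩

theorem PolyUpTo.sX_mul {N f : PowerSeries ℂ} (hf : PolyUpTo s N f) :
    PolyUpTo s N (sX s * f) := by
  obtain ⟨p, hp⟩ := hf
  exact ⟨Polynomial.X * p, by rw [map_mul, hp, polySeries_X]; ring⟩

theorem PolyUpTo.lin_mul {N f : PowerSeries ℂ} (hf : PolyUpTo s N f) (c : ℂ) :
    PolyUpTo s N (lin s c * f) := by
  obtain ⟨p, hp⟩ := hf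
  exact ⟨(1 + Polynomial.C c * Polynomial.X) * p, by rw [map_mul, hp, polySeries_lin]; ring⟩

/-- A common denominator for `M` gives one for `L(a, b) ⊗ M`. -/
theorem polyUpTo_evalTensor {B : MatSeries 2 (Module.End ℂ M)} {N : PowerSeries ℂ}
    (h : ∀ i j ψ w, PolyUpTo s N (matCoeff B i j ψ w)) (hs : s 0 ≠ s 1) (a b : ℂ) (i j : Fin 2)
    (ψ : Module.Dual ℂ ((Fin 2 → ℂ) ⊗[ℂ] M)) (z : (Fin 2 → ℂ) ⊗[ℂ] M) :
    PolyUpTo s N (evalDenom s a b * matCoeff (evalTensor s a b B) i j ψ z) := by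
  obtain ⟨w₁, w₂, rfl⟩ := exists_components z
  rw [matCoeff_add_right, mul_add]
  obtain ⟨e1, -, e3, -, e5, -, e7, -⟩ := matCoeff_evalTensor B w₁ hs a b ψ
  obtain ⟨-, f2, -, f4, -, f6, -, f8⟩ := matCoeff_evalTensor B w₂ hs a b ψ
  have hl := fun c c' i j φ w => ((h i j φ w).lin_mul c).lin_mul c'
  simp only [← mul_assoc] at hl
  apply PolyUpTo.add
  · fin_cases i <;> fin_cases j
    · refine (congrArg (PolyUpTo s N) e1).mpr (((hl _ _ _ _ _ _).sub ?_).add ?_)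
      · rw [sq, mul_assoc, mul_assoc]
        exact (h _ _ _ _).sX_mul.sX_mul.C_mul _
      · rw [mul_assoc]
        exact ((h _ _ _ _).lin_mul _).sX_mul
    · exact (congrArg (PolyUpTo s N) e3).mpr (hl _ _ _ _ _ _)
    · exact (congrArg (PolyUpTo s N) e5).mpr
        ((hl _ _ _ _ _ _).sub (((h _ _ _ _).lin_mul _).add ((h _ _ _ _).lin_mul _)).sX_mul)
    · refine (congrArg (PolyUpTo s N) e7).mpr ((hl _ _ _ _ _ _).sub ?_)
      rw [mul_assoc]
      exact ((h _ _ _ _).lin_mul _).sX_mul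
  · fin_cases i <;> fin_cases j
    · refine (congrArg (PolyUpTo s N) f2).mpr ((hl _ _ _ _ _ _).sub ?_)
      rw [mul_assoc, mul_assoc]
      exact ((h _ _ _ _).lin_mul _).sX_mul.C_mul _
    · refine (congrArg (PolyUpTo s N) f4).mpr (PolyUpTo.sub ?_ (hl _ _ _ _ _ _))
      rw [mul_assoc]
      exact (((h _ _ _ _).lin_mul _).add ((h _ _ _ _).lin_mul _)).sX_mul.C_mul _
    · exact (congrArg (PolyUpTo s N) f6).mpr (hl _ _ _ _ _ _).neg
    · refine (congrArg (PolyUpTo s N) f8).mpr (((hl _ _ _ _ _ _).sub ?_).add ?_)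
      · rw [sq, mul_assoc, mul_assoc]
        exact (h _ _ _ _).sX_mul.sX_mul.C_mul _
      · rw [mul_assoc, mul_assoc]
        exact ((h _ _ _ _).lin_mul _).sX_mul.C_mul _

variable {B : MatSeries 2 (Module.End ℂ M)} {ξ : M} {ξ' : Module.Dual ℂ M}
  {m : Fin 2 → PowerSeries ℂ} {N : PowerSeries ℂ} {p R : Polynomial ℂ}

theorem slice_coordDual_vPlus_vMinus (φ : Module.Dual ℂ M) : slice (coordDual 0 φ) vPlus = φ ∧
    slice (coordDual 0 φ) vMinus = 0 ∧ slice (coordDual 1 φ) vPlus = 0 ∧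
    slice (coordDual 1 φ) vMinus = φ := by
  simp [slice_coordDual, vPlus, vMinus]

/-- A vector of `L(a, b) ⊗ M` that is killed by `b₁₂(u)` is a multiple of `v⁺ ⊗ ξ`. -/
theorem IsExtremalPair.ker_evalTensor (h : IsExtremalPair s B ξ ξ' m N p R) (hs : s 0 ≠ s 1)
    {a b : ℂ} (hab : a + b ≠ 0) (h2 : a ≠ 0 → p.eval (-a⁻¹) ≠ 0) (h0 : a = 0 → R.eval (-1) ≠ 0)
    (z : (Fin 2 → ℂ) ⊗[ℂ] M) (hz : ∀ ψ, matCoeff (evalTensor s a b B) 0 1 ψ z = 0) :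
    ∃ c : ℂ, z = c • (vPlus ⊗ₜ[ℂ] ξ) := by
  obtain ⟨w₁, w₂, rfl⟩ := exists_components z
  have key : ∀ ψ, lin s a * lin s (1 - a) * matCoeff B 0 1 (slice ψ vPlus) w₁
      + (PowerSeries.C (a + b) * sX s * (lin s a * matCoeff B 0 0 (slice ψ vPlus) w₂
          + lin s (-a) * matCoeff B 1 1 (slice ψ vPlus) w₂)
        - lin s (a - 1) * lin s (-a) * matCoeff B 0 1 (slice ψ vMinus) w₂) = 0 := by
    intro ψ
    have e := hz ψ
    rw [matCoeff_add_right] at e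
    rw [← (matCoeff_evalTensor B w₁ hs a b ψ).2.2.1, ← (matCoeff_evalTensor B w₂ hs a b ψ).2.2.2.1,
      ← mul_add, e, mul_zero]
  obtain ⟨c, rfl⟩ : ∃ c : ℂ, w₂ = c • ξ := by
    refine h.ker w₂ fun φ => ?_
    have e := key (coordDual 1 φ)
    obtain ⟨-, -, h3, h4⟩ := slice_coordDual_vPlus_vMinus φ
    simp only [h3, h4, matCoeff_zero_left, mul_zero, add_zero, zero_sub, zero_add,
      neg_eq_zero, mul_eq_zero, lin_ne_zero, false_or] at e
    exact e
  have key2 : ∀ φ, lin s a * lin s (1 - a) * matCoeff B 0 1 φ w₁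
      + PowerSeries.C ((a + b) * c * φ ξ) * sX s * (lin s a * m 0 + lin s (-a) * m 1) = 0 := by
    intro φ
    have e := key (coordDual 0 φ)
    obtain ⟨h3, h4, -, -⟩ := slice_coordDual_vPlus_vMinus φ
    rw [h3, h4, matCoeff_zero_left, matCoeff_smul_right, matCoeff_smul_right, h.weight,
      h.weight] at e
    rw [map_mul, map_mul]
    linear_combination e
  have hc : (a + b) * c * ξ' ξ = 0 := h.evaluation h2 h0 (key2 ξ')
  rw [h.pairing, mul_one] at hc
  have hc' : c = 0 := (mul_eq_zero.1 hc).resolve_left hab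
  subst hc'
  obtain ⟨d, rfl⟩ : ∃ d : ℂ, w₁ = d • ξ := by
    refine h.ker w₁ fun φ => ?_
    have e := key2 φ
    simpa [lin_ne_zero] using e
  exact ⟨d, by simp⟩

/-- A functional on `L(a, b) ⊗ M` that kills the image of `b₂₁(u)` is a multiple of the functional
that corresponds to `v⁺ ⊗ ξ`. -/
theorem IsExtremalPair.coker_evalTensor (h : IsExtremalPair s B ξ ξ' m N p R) (hs : s 0 ≠ s 1)
    {a b : ℂ} (h2 : b + 1 ≠ 0 → p.eval (-(b + 1)⁻¹) ≠ 0) (h0 : b + 1 = 0 → R.eval (-1) ≠ 0)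
    (ψ : Module.Dual ℂ ((Fin 2 → ℂ) ⊗[ℂ] M))
    (hψ : ∀ z, matCoeff (evalTensor s a b B) 1 0 ψ z = 0) :
    ∃ c : ℂ, ψ = c • coordDual 0 ξ' := by
  obtain ⟨c, hc⟩ : ∃ c : ℂ, slice ψ vMinus = c • ξ' := by
    refine h.coker _ fun w => ?_
    have e := (matCoeff_evalTensor B w hs a b ψ).2.2.2.2.2.1
    rw [hψ, mul_zero] at e
    simpa [lin_ne_zero] using e
  have key : ∀ w, lin s (b + 1) * lin s (1 - (b + 1)) * matCoeff B 1 0 (slice ψ vPlus) w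
      + PowerSeries.C (-(c * ξ' w)) * sX s * (lin s (b + 1) * m 0 + lin s (-(b + 1)) * m 1)
      = 0 := by
    intro w
    have e := (matCoeff_evalTensor B w hs a b ψ).2.2.2.2.1
    rw [hψ, mul_zero, hc, matCoeff_smul_left, matCoeff_smul_left, h.coweight, h.coweight] at e
    rw [sub_add_cancel_right, map_neg, map_mul]
    linear_combination -e
  have hc' := h.evaluation h2 h0 (key ξ)
  rw [h.pairing, mul_one, neg_eq_zero] at hc'
  subst hc'
  obtain ⟨d, hd⟩ : ∃ d : ℂ, slice ψ vPlus = d • ξ' := by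
    refine h.coker _ fun w => ?_
    have e := key w
    simpa [lin_ne_zero] using e
  refine ⟨d, dual_ext ?_ ?_⟩
  · rw [hd]; ext w; simp [slice, coordDual, vPlus]
  · rw [hc]; ext w; simp [slice, coordDual, vMinus]

/-- The extremal vectors of `L(a, b) ⊗ M`. -/
theorem IsExtremalPair.evalTensor (h : IsExtremalPair s B ξ ξ' m N p R) (hs : s 0 ≠ s 1)
    {a b : ℂ} (hab : a + b ≠ 0) (h2 : a ≠ 0 → p.eval (-a⁻¹) ≠ 0) (h0 : a = 0 → R.eval (-1) ≠ 0)
    (h2' : b + 1 ≠ 0 → p.eval (-(b + 1)⁻¹) ≠ 0) (h0' : b + 1 = 0 → R.eval (-1) ≠ 0) :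
    ∃ m', IsExtremalPair s (evalTensor s a b B) (vPlus ⊗ₜ[ℂ] ξ) (coordDual 0 ξ') m'
      (evalDenom s a b * N)
      ((1 + Polynomial.C (-b) * Polynomial.X) * (1 + Polynomial.C (1 - a) * Polynomial.X) * p)
      ((1 + Polynomial.C a * Polynomial.X) * (1 + Polynomial.C (b + 1) * Polynomial.X) * R) := by
  set n := evalDenom s a b with hn
  have hn0 : n ≠ 0 := evalDenom_ne_zero a b
  have hn1 : n * n⁻¹ = 1 := PowerSeries.mul_inv_cancel _ (by rw [constantCoeff_evalDenom]; simp)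
  set m' : Fin 2 → PowerSeries ℂ :=
    ![n⁻¹ * (lin s a * lin s (b + 1) * m 0 - PowerSeries.C (a + b) * sX s ^ 2 * m 1),
      n⁻¹ * (lin s (-b) * lin s (1 - a) * m 1)] with hm'
  have hm0 : n * m' 0
      = lin s a * lin s (b + 1) * m 0 - PowerSeries.C (a + b) * sX s ^ 2 * m 1 := by
    change n * (n⁻¹ * _) = _
    rw [← mul_assoc, hn1, one_mul]
  have hm1 : n * m' 1 = lin s (-b) * lin s (1 - a) * m 1 := by
    change n * (n⁻¹ * _) = _
    rw [← mul_assoc, hn1, one_mul]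
  have hd := slice_coordDual_vPlus_vMinus ξ'
  refine ⟨m', ⟨?_, ?_, ?_, ?_, ?_, h.ker_evalTensor hs hab h2 h0, h.coker_evalTensor hs h2' h0',
    ?_, mul_ne_zero hn0 h.denom, ?_, ?_⟩⟩
  · simp [coordDual, vPlus, h.pairing]
  · intro ψ
    apply mul_left_cancel₀ hn0
    rw [(matCoeff_evalTensor B ξ hs a b ψ).2.2.1, h.raising, mul_zero, mul_zero]
  · intro z
    obtain ⟨w₁, w₂, rfl⟩ := exists_components z
    apply mul_left_cancel₀ hn0
    rw [matCoeff_add_right, mul_add, (matCoeff_evalTensor B w₁ hs a b _).2.2.2.2.1,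
      (matCoeff_evalTensor B w₂ hs a b _).2.2.2.2.2.1, hd.1, hd.2.1]
    simp [matCoeff_zero_left, h.lowering]
  · intro i ψ
    have e : ψ (vPlus ⊗ₜ ξ) = slice ψ vPlus ξ := rfl
    apply mul_left_cancel₀ hn0
    rw [e]
    fin_cases i
    · change n * matCoeff _ 0 0 _ _ = n * (_ * m' 0)
      rw [(matCoeff_evalTensor B ξ hs a b ψ).1, mul_left_comm, hm0, h.raising, h.weight, h.weight]
      ring
    · change n * matCoeff _ 1 1 _ _ = n * (_ * m' 1)
      rw [(matCoeff_evalTensor B ξ hs a b ψ).2.2.2.2.2.2.1, mul_left_comm, hm1, h.raising, h.weight]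
      ring
  · intro i z
    obtain ⟨w₁, w₂, rfl⟩ := exists_components z
    have e : coordDual 0 ξ' (vPlus ⊗ₜ w₁ + vMinus ⊗ₜ w₂) = ξ' w₁ := by
      simp [coordDual, vPlus, vMinus]
    apply mul_left_cancel₀ hn0
    rw [e, matCoeff_add_right, mul_add]
    fin_cases i
    · change n * matCoeff _ 0 0 _ _ + n * matCoeff _ 0 0 _ _ = n * (_ * m' 0)
      rw [(matCoeff_evalTensor B w₁ hs a b _).1, (matCoeff_evalTensor B w₂ hs a b _).2.1,
        mul_left_comm, hm0, hd.1, hd.2.1, h.coweight, h.coweight, h.lowering, matCoeff_zero_left,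
        matCoeff_zero_left]
      ring
    · change n * matCoeff _ 1 1 _ _ + n * matCoeff _ 1 1 _ _ = n * (_ * m' 1)
      rw [(matCoeff_evalTensor B w₁ hs a b _).2.2.2.2.2.2.1,
        (matCoeff_evalTensor B w₂ hs a b _).2.2.2.2.2.2.2,
        mul_left_comm, hm1, hd.1, hd.2.1, h.coweight, h.lowering, matCoeff_zero_left,
        matCoeff_zero_left, matCoeff_zero_left]
      ring
  · intro i j ψ z
    obtain ⟨q, hq⟩ := polyUpTo_evalTensor h.poly hs a b i j ψ z
    exact ⟨q, by rw [hq]; ring⟩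
  · simp only [map_mul, polySeries_lin, ← h.second]
    linear_combination N * hm1
  · have e := h.first
    rw [map_mul, map_ofNat] at e
    simp only [map_mul, polySeries_lin, map_ofNat]
    have e3 : n * N * ((2 + sX s) * m' 0 - sX s * m' 1)
        = lin s a * lin s (b + 1) * (N * ((2 + sX s) * m 0 - sX s * m 1)) := by
      simp only [lin, map_sub, map_add, map_neg, map_one] at hm0 hm1 ⊢
      linear_combination N * (2 + sX s) * hm0 - N * sX s * hm1
    rw [e3, e]
    ring

end Extremal

/-! ### The grading operator of the twisted super Yangian -/

section Relations

variable (s ε : Fin 2 → ℤˣ)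

/-- The coefficient of `u ^ (-r)` in `b i j (u)`, for an integer `r`. -/
noncomputable def bInt (i j : Fin 2) (r : ℤ) : Twisted s ε :=
  RingQuot.mkAlgHom ℂ (TwistedRel s ε) (gen (signs ε) i j r)

theorem bInt_natCast (i j : Fin 2) (r : ℕ) : bInt s ε i j r = bCoeff s ε i j r := rfl

theorem bInt_of_neg (i j : Fin 2) {r : ℤ} (hr : r < 0) : bInt s ε i j r = 0 := by
  rw [bInt, gen, if_neg hr.ne, if_neg hr.not_gt, map_zero]

theorem bInt_zero (i j : Fin 2) :
    bInt s ε i j 0 = if i = j then algebraMap ℂ _ (signs ε i) else 0 := by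
  rw [bInt, gen, if_pos rfl]
  split_ifs
  · rw [AlgHom.commutes]
  · rw [map_zero]

theorem bCoeff_zero (i j : Fin 2) :
    bCoeff s ε i j 0 = if i = j then algebraMap ℂ _ (signs ε i) else 0 := bInt_zero s ε i j

/-- The commutation relations, for the coefficients. -/
theorem bInt_comm (i j k l : Fin 2) (r p : ℤ) :
    (bInt s ε i j (r + 2) * bInt s ε k l p
        - ((-1 : ℂ) ^ ((par s i + par s j) * (par s k + par s l))) •
          (bInt s ε k l p * bInt s ε i j (r + 2)))
      - (bInt s ε i j r * bInt s ε k l (p + 2)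
        - ((-1 : ℂ) ^ ((par s i + par s j) * (par s k + par s l))) •
          (bInt s ε k l (p + 2) * bInt s ε i j r))
      = sgn3 s i j k • ((bInt s ε k j (r + 1) * bInt s ε i l p
            - bInt s ε k j p * bInt s ε i l (r + 1))
          + (bInt s ε k j r * bInt s ε i l (p + 1) - bInt s ε k j (p + 1) * bInt s ε i l r))
        + sgn3 s i j k • (((if k = j then ∑ a, bInt s ε i a (r + 1) * bInt s ε a l p else 0)
              - (if i = l then ∑ a, bInt s ε k a p * bInt s ε a j (r + 1) else 0))
            - ((if k = j then ∑ a, bInt s ε i a r * bInt s ε a l (p + 1) else 0)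
              - (if i = l then ∑ a, bInt s ε k a (p + 1) * bInt s ε a j r else 0)))
        - (if i = j then (∑ a, bInt s ε k a r * bInt s ε a l p)
            - ∑ a, bInt s ε k a p * bInt s ε a l r else 0) := by
  have h := RingQuot.mkAlgHom_rel ℂ (TwistedRel.comm (s := s) (ε := ε) i j k l r p)
  simp only [scomm, exch, contr, prodCoeff, map_sub, map_add, map_mul, map_smul, map_sum,
    apply_ite (RingQuot.mkAlgHom ℂ (TwistedRel s ε)), map_zero] at h
  exact h

/-- The commutation relations with a coefficient of `u⁻¹`. -/
theorem bInt_one_comm (i j k l : Fin 2) (p : ℕ) :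
    bInt s ε i j 1 * bInt s ε k l p
        - ((-1 : ℂ) ^ ((par s i + par s j) * (par s k + par s l))) •
          (bInt s ε k l p * bInt s ε i j 1)
      = sgn3 s i j k • ((if k = j then (signs ε j + signs ε i) • bInt s ε i l p else 0)
          - (if i = l then (signs ε l + signs ε j) • bInt s ε k j p else 0)) := by
  have h := bInt_comm s ε i j k l (-1) p
  have hz : ∀ i j, bInt s ε i j (-1) = 0 := fun i j => bInt_of_neg s ε i j (by norm_num)
  rw [show (-1 : ℤ) + 2 = 1 by norm_num, show (-1 : ℤ) + 1 = 0 by norm_num] at h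
  simp only [hz, zero_mul, mul_zero, smul_zero, sub_zero, Finset.sum_const_zero, ite_self,
    bInt_zero, add_zero, ite_mul, mul_ite, Finset.sum_ite_eq, Finset.sum_ite_eq', Finset.mem_univ,
    if_true] at h
  rw [h, ← smul_add]
  congr 1
  simp only [Algebra.smul_def, map_add, add_mul]
  split_ifs <;> simp_all [Algebra.commutes] <;> abel

theorem sgn3_zero (k : Fin 2) : sgn3 s 0 0 k = sgn (s 0) := by
  rw [sgn3]
  rcases Int.units_eq_one_or (s 0) with h | h <;> rcases par_eq_zero_or_one s k with h' | h' <;>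
    simp [par, h, sgn] at * <;> (simp [h']; try norm_num)

/-- The coefficient of `u⁻¹` in `b₁₁(u)` acts as a grading operator: `b₁₂(u)` raises its eigenvalues
by a nonzero constant. -/
theorem one_comm_raising (p : ℕ) : bCoeff s ε 0 0 1 * bCoeff s ε 0 1 p
    = bCoeff s ε 0 1 p * bCoeff s ε 0 0 1 + (2 * sgn (s 0) * sgn (ε 0)) • bCoeff s ε 0 1 p := by
  have h := bInt_one_comm s ε 0 0 0 1 p
  rw [← two_mul, mul_assoc, pow_mul, neg_one_sq, one_pow, one_smul, sub_eq_iff_eq_add',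
    sgn3_zero] at h
  simp only [if_true, zero_ne_one, if_false, sub_zero, smul_smul] at h
  rw [← bInt_natCast, ← bInt_natCast]
  refine h.trans ?_
  congr 2
  simp only [signs]
  ring

/-- The operators `b₂₁(u)` lower the eigenvalues of the grading operator by the same constant. -/
theorem one_comm_lowering (p : ℕ) : bCoeff s ε 0 0 1 * bCoeff s ε 1 0 p
    = bCoeff s ε 1 0 p * bCoeff s ε 0 0 1 - (2 * sgn (s 0) * sgn (ε 0)) • bCoeff s ε 1 0 p := by
  have h := bInt_one_comm s ε 0 0 1 0 p
  rw [← two_mul, mul_assoc, pow_mul, neg_one_sq, one_pow, one_smul, sub_eq_iff_eq_add',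
    sgn3_zero] at h
  simp only [if_true, one_ne_zero, if_false, zero_sub, smul_smul, smul_neg, ← sub_eq_add_neg] at h
  rw [← bInt_natCast, ← bInt_natCast]
  refine h.trans ?_
  congr 2
  simp only [signs]
  ring

end Relations

/-- An operator that shifts the eigenvalues of `H` kills a vector of every invariant subspace. -/
theorem exists_killed {E : Type*} [AddCommGroup E] [Module ℂ E] [FiniteDimensional ℂ E]
    {ι : Type*} {H : Module.End ℂ E} {b : ι → Module.End ℂ E} {c : ℂ} (hc : c ≠ 0)
    (hb : ∀ r, H * b r = b r * H + c • b r) {U : Submodule ℂ E} (hU : U ≠ ⊥)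
    (hH : ∀ u ∈ U, H u ∈ U) (hbU : ∀ r, ∀ u ∈ U, b r u ∈ U) :
    ∃ u ∈ U, u ≠ 0 ∧ ∀ r, b r u = 0 := by
  by_contra! hno
  have : Nontrivial U := (Submodule.nontrivial_iff_ne_bot).2 hU
  obtain ⟨μ, hμ⟩ := Module.End.exists_eigenvalue (H.restrict hH)
  obtain ⟨u, hu⟩ := hμ.exists_hasEigenvector
  have step : ∀ n : ℕ, ∃ v ∈ U, v ≠ 0 ∧ H v = (μ + n * c) • v := by
    intro n
    induction n with
    | zero =>
      refine ⟨u, u.2, fun h => hu.2 (Subtype.ext h), ?_⟩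
      have := congrArg Subtype.val hu.apply_eq_smul
      simpa using this
    | succ n ih =>
      obtain ⟨v, hv, hv0, hHv⟩ := ih
      obtain ⟨r, hr⟩ := hno v hv hv0
      refine ⟨b r v, hbU r v hv, hr, ?_⟩
      have := LinearMap.congr_fun (hb r) v
      simp only [Module.End.mul_apply, LinearMap.add_apply, LinearMap.smul_apply, hHv,
        map_smul] at this
      rw [this, ← add_smul]
      congr 1
      push_cast
      ring
  have hinf : Set.Infinite {x | H.HasEigenvalue x} := by
    refine Set.infinite_of_injective_forall_mem (f := fun n : ℕ => μ + n * c) ?_ ?_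
    · intro m n h
      simpa [hc] using h
    · intro n
      obtain ⟨v, -, hv0, hv⟩ := step n
      exact Module.End.hasEigenvalue_of_hasEigenvector
        ⟨Module.End.mem_eigenspace_iff.2 hv, hv0⟩
  exact hinf (Module.End.finite_hasEigenvalue H)

section Irreducible

variable {s ε : Fin 2 → ℤˣ} {M : Type*} [AddCommGroup M] [Module ℂ M]
  {B : MatSeries 2 (Module.End ℂ M)} {ξ : M} {ξ' : Module.Dual ℂ M}
  {m : Fin 2 → PowerSeries ℂ} {N : PowerSeries ℂ}
  {p R : Polynomial ℂ}

theorem two_mul_sgn_ne_zero (x y : ℤˣ) : 2 * sgn x * sgn y ≠ 0 := by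
  rcases Int.units_eq_one_or x with h | h <;> rcases Int.units_eq_one_or y with h' | h' <;>
    simp [sgn, h, h']

/-- A module with unique extremal vectors is irreducible: an invariant subspace contains `ξ`, and
its annihilator, if it is not trivial, contains `ξ'`. -/
theorem IsExtremalPair.isStronglyIrreducible [FiniteDimensional ℂ M]
    (h : IsExtremalPair s B ξ ξ' m N p R) {ρ : Twisted s ε →ₐ[ℂ] Module.End ℂ M}
    (hρ : ∀ i j r, ρ (bCoeff s ε i j r) = PowerSeries.coeff r B i j) :
    IsStronglyIrreducible ρ := by
  have hξ : ξ ≠ 0 := fun h0 => by simpa [h0] using h.pairing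
  refine ⟨⟨ξ, 0, hξ⟩, fun W hW => ?_⟩
  by_cases hbot : W = ⊥
  · exact Or.inl hbot
  refine Or.inr ?_
  have hc := two_mul_sgn_ne_zero (s 0) (ε 0)
  have hξW : ξ ∈ W := by
    obtain ⟨u, huW, hu0, hu⟩ := exists_killed (H := ρ (bCoeff s ε 0 0 1))
      (b := fun r => ρ (bCoeff s ε 0 1 r)) hc (fun r => by
        rw [← map_mul, one_comm_raising, map_add, map_mul, map_smul]) hbot
      (fun u hu => hW _ u hu) (fun r u hu => hW _ u hu)
    obtain ⟨d, rfl⟩ := h.ker u fun ψ => by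
      ext r
      rw [matCoeff, PowerSeries.coeff_mk, ← hρ, hu, map_zero, map_zero]
    have hd : d ≠ 0 := fun h0 => hu0 (by rw [h0, zero_smul])
    simpa [smul_smul, inv_mul_cancel₀ hd] using W.smul_mem d⁻¹ huW
  by_contra htop
  have hann : W.dualAnnihilator ≠ ⊥ := fun h0 => htop (Subspace.dualAnnihilator_inj.1
    (by rw [h0, Submodule.dualAnnihilator_top]))
  obtain ⟨ψ, hψW, hψ0, hψ⟩ := exists_killed (H := (ρ (bCoeff s ε 0 0 1)).dualMap)
      (b := fun r => (ρ (bCoeff s ε 1 0 r)).dualMap) hc (fun r => by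
        ext ψ w
        have e := LinearMap.congr_fun (congrArg ρ (one_comm_lowering s ε r)) w
        rw [map_sub, map_mul, map_mul, map_smul] at e
        have e' := congrArg ψ e
        simp only [LinearMap.sub_apply, Module.End.mul_apply, LinearMap.smul_apply, map_sub,
          map_smul] at e'
        simp only [Module.End.mul_apply, LinearMap.dualMap_apply, LinearMap.add_apply,
          LinearMap.smul_apply, e']
        abel) hann
      (fun ψ hψ => (Submodule.mem_dualAnnihilator _).2 fun w hw =>
        (Submodule.mem_dualAnnihilator _).1 hψ _ (hW _ w hw))
      (fun r ψ hψ => (Submodule.mem_dualAnnihilator _).2 fun w hw =>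
        (Submodule.mem_dualAnnihilator _).1 hψ _ (hW _ w hw))
  obtain ⟨d, rfl⟩ := h.coker ψ fun w => by
    ext r
    rw [matCoeff, PowerSeries.coeff_mk, ← hρ]
    exact LinearMap.congr_fun (hψ r) w
  have := (Submodule.mem_dualAnnihilator _).1 hψW ξ hξW
  rw [LinearMap.smul_apply, h.pairing, smul_eq_mul, mul_one] at this
  exact hψ0 (by rw [this, zero_smul])

end Irreducible

/-! ### Extremal vectors of iterated tensor products -/

section IteratedExtremal

variable {s ε : Fin 2 → ℤˣ}

theorem rightSeries_scalarDiag {V W : Type*} [AddCommGroup V] [Module ℂ V] [AddCommGroup W]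
    [Module ℂ W] {σ : Module.End ℂ V} (hσ : σ * σ = 1) {F : MatSeries 2 (Module.End ℂ W)}
    {F' : MatSeries 2 (Module.End ℂ (V ⊗[ℂ] W))} {d : ℕ → Fin 2 → ℂ}
    (hF : ∀ r, PowerSeries.coeff r F = scalarDiag _ (d r))
    (hF' : ∀ r, PowerSeries.coeff r F' = scalarDiag _ (d r)) : rightSeries s σ F = F' := by
  ext1 r
  ext1 i j
  rw [coeff_rightSeries, hF, hF', scalarDiag, scalarDiag, Matrix.diagonal_apply,
    Matrix.diagonal_apply]
  split_ifs with h
  · subst h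
    have : σ ^ (par s i + par s i) = 1 := by rw [← two_mul, pow_mul, sq, hσ, one_pow]
    rw [this]
    ext v w
    simp
  · simp

theorem rightSeries_boundary {V W : Type*} [AddCommGroup V] [Module ℂ V] [AddCommGroup W]
    [Module ℂ W] {σ : Module.End ℂ V} (hσ : σ * σ = 1) (γ : ℂ) (h : PowerSeries ℂ) :
    rightSeries s σ (boundary (Module.End ℂ W) ε γ h)
      = boundary (Module.End ℂ (V ⊗[ℂ] W)) ε γ h :=
  rightSeries_scalarDiag hσ (coeff_boundary ε γ h) (coeff_boundary ε γ h)

/-- The action of `B(u)` on the tensor product of evaluation modules, with a boundary matrix. -/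
noncomputable def tensorReflection (s ε : Fin 2 → ℤˣ) (γ : ℂ) (h : PowerSeries ℂ)
    (L : List (ℂ × ℂ)) : MatSeries 2 (Module.End ℂ (tensorSpace L)) :=
  reflectBy (boundary _ ε γ h) (tensorEvalSeries s L)

/-- The first factor of the list acts on the tensor product of the others through the coaction. -/
theorem tensorReflection_cons (hs : s 0 ≠ s 1) (γ : ℂ) (h : PowerSeries ℂ) (q : ℂ × ℂ)
    (L : List (ℂ × ℂ)) :
    tensorReflection s ε γ h (q :: L)
      = evalTensor s q.1 q.2 (tensorReflection s ε γ h L) := by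
  have e := (tensorEvalSeries_spec hs L).1
  change reflectBy (boundary (Module.End ℂ ((Fin 2 → ℂ) ⊗[ℂ] tensorSpace L)) ε γ h)
    (tensorSeries s evalParity (evalSeries s q.1 q.2) (tensorEvalSeries s L)) = _
  rw [tensorSeries_eq, reflectBy_mul (coeff_zero_leftSeries (coeff_zero_evalSeries _ _))
    (coeff_zero_rightSeries evalParity_mul_self e),
    ← rightSeries_boundary evalParity_mul_self γ h,
    reflectBy_rightSeries evalParity_mul_self _ e]
  rfl

theorem matCoeff_boundary {M : Type*} [AddCommGroup M] [Module ℂ M] (γ : ℂ) (h : PowerSeries ℂ)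
    (i j : Fin 2) (ψ : Module.Dual ℂ M) (w : M) :
    matCoeff (boundary _ ε γ h) i j ψ w = if i = j then PowerSeries.C (ψ w) *
      (h * (PowerSeries.C (signs ε i) + PowerSeries.C γ * PowerSeries.X)) else 0 := by
  ext r
  rw [matCoeff, PowerSeries.coeff_mk, coeff_boundary, scalarDiag, Matrix.diagonal_apply]
  split_ifs with h
  · rw [PowerSeries.coeff_C_mul, Module.algebraMap_end_apply, map_smul, smul_eq_mul, mul_comm]
  · simp

end IteratedExtremal

theorem reflectBy_one {A : Type*} [Ring A] (G : MatSeries 2 A) : reflectBy G 1 = G := by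
  have h1 : inverse (1 : MatSeries 2 A) = 1 := by
    have := mul_inverse (T := (1 : MatSeries 2 A)) PowerSeries.coeff_zero_one
    rwa [one_mul] at this
  rw [reflectBy, h1, map_one, one_mul, mul_one]

/-! ### Generic parameters -/

section IteratedExtremal

variable {s ε : Fin 2 → ℤˣ}

/-- The parameters of a factor `L(a, b)` that matter for irreducibility are `a` and `b + 1`. -/
def IsNode (q : ℂ × ℂ) (c : ℂ) : Prop := c = q.1 ∨ c = q.2 + 1

/-- `∏ (1 - bᵢ t) (1 - (aᵢ - 1) t) p₀`, with `t = s₁ u⁻¹`: the second component of the highest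
weight, up to the common denominator. -/
noncomputable def secondPoly (p₀ : Polynomial ℂ) (L : List (ℂ × ℂ)) : Polynomial ℂ :=
  L.foldr (fun q p => (1 + Polynomial.C (-q.2) * Polynomial.X)
    * (1 + Polynomial.C (1 - q.1) * Polynomial.X) * p) p₀

/-- `∏ (1 + aᵢ t) (1 + (bᵢ + 1) t) R₀`, with `t = s₁ u⁻¹`: the combination `((2 + t) μ₁ - t μ₂) / 2`
of the components of the highest weight, up to the common denominator. -/
noncomputable def firstPoly (R₀ : Polynomial ℂ) (L : List (ℂ × ℂ)) : Polynomial ℂ :=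
  L.foldr (fun q p => (1 + Polynomial.C q.1 * Polynomial.X)
    * (1 + Polynomial.C (q.2 + 1) * Polynomial.X) * p) R₀

/-- Generic parameters: for two nodes `c` and `c'` of different factors `c + c' ≠ 1`, the two nodes
of a factor do not have sum `1` either, and the nodes avoid the zeros of the boundary terms. -/
structure IsGeneric (p₀ R₀ : Polynomial ℂ) (L : List (ℂ × ℂ)) : Prop where
  factor : ∀ q ∈ L, q.1 + q.2 ≠ 0
  pairwise : L.Pairwise fun q q' => ∀ c c', IsNode q c → IsNode q' c' → c + c' ≠ 1
  boundary : ∀ q ∈ L, ∀ c, IsNode q c →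
    (c ≠ 0 → p₀.eval (-c⁻¹) ≠ 0) ∧ (c = 0 → R₀.eval (-1) ≠ 0)

theorem eval_secondPoly_ne_zero {p₀ : Polynomial ℂ} {c : ℂ} (hc : c ≠ 0)
    (h₀ : p₀.eval (-c⁻¹) ≠ 0) {L : List (ℂ × ℂ)} (h : ∀ q ∈ L, ∀ c', IsNode q c' → c + c' ≠ 1) :
    (secondPoly p₀ L).eval (-c⁻¹) ≠ 0 := by
  induction L with
  | nil => exact h₀
  | cons q L ih =>
    have ih' := ih fun q' hq' => h q' (List.mem_cons_of_mem _ hq')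
    have h1 := h q List.mem_cons_self q.1 (Or.inl rfl)
    have h2 := h q List.mem_cons_self (q.2 + 1) (Or.inr rfl)
    change Polynomial.eval _ (_ * secondPoly p₀ L) ≠ 0
    simp only [Polynomial.eval_mul, Polynomial.eval_add, Polynomial.eval_one, Polynomial.eval_C,
      Polynomial.eval_X]
    refine mul_ne_zero (mul_ne_zero ?_ ?_) ih'
    · intro e
      apply h2
      field_simp at e
      linear_combination e
    · intro e
      apply h1
      field_simp at e
      linear_combination e

theorem eval_firstPoly_ne_zero {R₀ : Polynomial ℂ} (h₀ : R₀.eval (-1) ≠ 0) {L : List (ℂ × ℂ)}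
    (h : ∀ q ∈ L, ∀ c', IsNode q c' → c' ≠ 1) :
    (firstPoly R₀ L).eval (-1) ≠ 0 := by
  induction L with
  | nil => exact h₀
  | cons q L ih =>
    have ih' := ih fun q' hq' => h q' (List.mem_cons_of_mem _ hq')
    have h1 := h q List.mem_cons_self q.1 (Or.inl rfl)
    have h2 := h q List.mem_cons_self (q.2 + 1) (Or.inr rfl)
    change Polynomial.eval _ (_ * firstPoly R₀ L) ≠ 0
    simp only [Polynomial.eval_mul, Polynomial.eval_add, Polynomial.eval_one, Polynomial.eval_C,
      Polynomial.eval_X]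
    refine mul_ne_zero (mul_ne_zero ?_ ?_) ih'
    · intro e
      exact h1 (by linear_combination -e)
    · intro e
      exact h2 (by linear_combination -e)

/-- The second component of the weight of the boundary matrix, up to the factor `h`, as a
polynomial in `t = s₁ u⁻¹`. -/
noncomputable def secondBase (s ε : Fin 2 → ℤˣ) (γ : ℂ) : Polynomial ℂ :=
  Polynomial.C (sgn (ε 1)) + Polynomial.C (γ * sgn (s 0)) * Polynomial.X

/-- The combination `((2 + t) μ₁ - t μ₂) / 2` of the components of the weight of the boundary
matrix, up to the factor `h`, as a polynomial in `t = s₁ u⁻¹`. -/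
noncomputable def firstBase (s ε : Fin 2 → ℤˣ) (γ : ℂ) : Polynomial ℂ :=
  Polynomial.C (sgn (ε 0))
    + Polynomial.C (γ * sgn (s 0) + (sgn (ε 0) - sgn (ε 1)) / 2) * Polynomial.X

/-- The one-dimensional module given by the boundary matrix. -/
theorem isExtremalPair_nil {γ : ℂ} {h N : PowerSeries ℂ} (hN : N * h = 1) :
    IsExtremalPair s (boundary (Module.End ℂ ℂ) ε γ h) (1 : ℂ) LinearMap.id
      (fun i => h * (PowerSeries.C (signs ε i) + PowerSeries.C γ * PowerSeries.X)) N
      (secondBase s ε γ)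
      (firstBase s ε γ) := by
  have hX : PowerSeries.C γ * PowerSeries.X = PowerSeries.C (γ * sgn (s 0)) * sX s := by
    rw [sX, ← mul_assoc, ← map_mul, mul_assoc, sgn_mul_self, mul_one]
  refine ⟨rfl, ?_, ?_, ?_, ?_, ?_, ?_, ?_, left_ne_zero_of_mul (hN.symm ▸ one_ne_zero), ?_, ?_⟩
  · intro ψ; rw [matCoeff_boundary]; simp
  · intro ψ; rw [matCoeff_boundary]; simp
  · intro i ψ; rw [matCoeff_boundary, if_pos rfl]
  · intro i w; rw [matCoeff_boundary, if_pos rfl]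
  · intro w _; exact ⟨w, by simp⟩
  · intro ψ _
    refine ⟨ψ 1, LinearMap.ext fun w => ?_⟩
    have : ψ w = ψ (w • 1) := by simp
    rw [this, map_smul]
    simp [mul_comm]
  · intro i j ψ w
    rw [matCoeff_boundary]
    split_ifs
    · refine ⟨Polynomial.C (ψ w) * (Polynomial.C (signs ε i)
        + Polynomial.C (γ * sgn (s 0)) * Polynomial.X), ?_⟩
      rw [hX, map_mul, map_add, map_mul, polySeries_C, polySeries_C, polySeries_C, polySeries_X]
      linear_combination (-(PowerSeries.C (ψ w) * (PowerSeries.C (signs ε i)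
        + PowerSeries.C (γ * sgn (s 0)) * sX s))) * hN
    · exact ⟨0, by simp⟩
  · rw [← mul_assoc, hN, one_mul, hX, secondBase, map_add, map_mul (polySeries s), polySeries_C,
      polySeries_C, polySeries_X]
    rfl
  · simp only [hX, firstBase, map_mul, map_add, polySeries_C, polySeries_X, map_ofNat]
    have h2 : (2 : PowerSeries ℂ) * PowerSeries.C ((sgn (ε 0) - sgn (ε 1)) / 2)
        = PowerSeries.C (signs ε 0) - PowerSeries.C (signs ε 1) := by
      rw [← map_ofNat PowerSeries.C 2, ← map_mul, ← map_sub]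
      congr 1
      simp only [signs]
      ring
    simp only [signs] at *
    linear_combination ((2 + sX s) * (PowerSeries.C (sgn (ε 0))
        + PowerSeries.C γ * PowerSeries.C (sgn (s 0)) * sX s)
      - sX s * (PowerSeries.C (sgn (ε 1))
        + PowerSeries.C γ * PowerSeries.C (sgn (s 0)) * sX s)) * hN - sX s * h2

/-- For generic parameters, a tensor product of evaluation modules with a boundary matrix has a
unique highest weight vector, and so has its dual; moreover this vector is even. -/
theorem exists_isExtremalPair (hs : s 0 ≠ s 1) {γ : ℂ} {h N₀ : PowerSeries ℂ} (hN : N₀ * h = 1)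
    {L : List (ℂ × ℂ)}
    (hL : IsGeneric (secondBase s ε γ)
      (firstBase s ε γ) L) :
    ∃ ξ ξ' m N, IsExtremalPair s (tensorReflection s ε γ h L) ξ ξ' m N
      (secondPoly (secondBase s ε γ) L)
      (firstPoly (firstBase s ε γ) L) ∧
      tensorParity L ξ = ξ := by
  induction L with
  | nil =>
    refine ⟨(1 : ℂ), (LinearMap.id : Module.Dual ℂ ℂ),
      fun i => h * (PowerSeries.C (signs ε i) + PowerSeries.C γ * PowerSeries.X), N₀, ?_, rfl⟩
    have e : tensorReflection s ε γ h [] = boundary (Module.End ℂ ℂ) ε γ h := by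
      change reflectBy (boundary (Module.End ℂ ℂ) ε γ h) 1 = _
      exact reflectBy_one _
    rw [e]
    exact isExtremalPair_nil hN
  | cons q L ih =>
    obtain ⟨hp1, hp2⟩ := List.pairwise_cons.1 hL.pairwise
    obtain ⟨ξ, ξ', m, N, hξ, hσ⟩ := ih ⟨fun q' hq' => hL.factor q' (List.mem_cons_of_mem _ hq'),
      hp2, fun q' hq' => hL.boundary q' (List.mem_cons_of_mem _ hq')⟩
    have hb := hL.boundary q List.mem_cons_self
    have k2 : ∀ c, IsNode q c → c ≠ 0 →
        (secondPoly (secondBase s ε γ) L).eval (-c⁻¹) ≠ 0 := fun c hc hc0 =>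
      eval_secondPoly_ne_zero hc0 ((hb c hc).1 hc0) fun q' hq' c' hc' => hp1 q' hq' c c' hc hc'
    have k1 : ∀ c, IsNode q c → c = 0 →
        (firstPoly (firstBase s ε γ) L).eval (-1) ≠ 0 := fun c hc hc0 =>
      eval_firstPoly_ne_zero ((hb c hc).2 hc0) fun q' hq' c' hc' e =>
        hp1 q' hq' c c' hc hc' (by rw [hc0, e, zero_add])
    obtain ⟨m', hm'⟩ := hξ.evalTensor hs (hL.factor q List.mem_cons_self) (k2 _ (Or.inl rfl))
      (k1 _ (Or.inl rfl)) (k2 _ (Or.inr rfl)) (k1 _ (Or.inr rfl))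
    refine ⟨(vPlus ⊗ₜ[ℂ] ξ : (Fin 2 → ℂ) ⊗[ℂ] tensorSpace L), coordDual 0 ξ', m',
      evalDenom s q.1 q.2 * N, ?_, ?_⟩
    · rw [tensorReflection_cons hs]
      exact hm'
    · change TensorProduct.map evalParity (tensorParity L) (vPlus ⊗ₜ[ℂ] ξ) = _
      rw [TensorProduct.map_tmul, evalParity_vPlus, hσ]

end IteratedExtremal

/-! ### Highest weight modules -/

section Reordering

variable (s ε : Fin 2 → ℤˣ)

/-- The weight `j - i` of `b i j (u)`. -/
def wt (i j : Fin 2) : ℤ := (j : ℤ) - (i : ℤ)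

/-- The span of the quadratic monomials of total weight `w` in the `b i j r`, with total degree
less than `n`. -/
noncomputable def quadratic (w n : ℤ) : Submodule ℂ (Twisted s ε) :=
  Submodule.span ℂ {x | ∃ (i j k l : Fin 2) (r p : ℤ), wt i j + wt k l = w ∧ r + p < n ∧
    x = bInt s ε i j r * bInt s ε k l p}

variable {s ε}

theorem mem_quadratic {i j k l : Fin 2} {r p w n : ℤ} (hw : wt i j + wt k l = w)
    (hn : r + p < n) : bInt s ε i j r * bInt s ε k l p ∈ quadratic s ε w n :=
  Submodule.subset_span ⟨i, j, k, l, r, p, hw, hn, rfl⟩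

/-- Two generators supercommute up to quadratic monomials of smaller total degree. -/
theorem supercomm_mem_quadratic (i j k l : Fin 2) (r : ℕ) (p : ℤ) :
    bInt s ε i j r * bInt s ε k l p
        - ((-1 : ℂ) ^ ((par s i + par s j) * (par s k + par s l))) •
          (bInt s ε k l p * bInt s ε i j r) ∈ quadratic s ε (wt i j + wt k l) (r + p) := by
  -- the relation moves two units of degree from one factor to the other
  have step : ∀ r p : ℤ, (bInt s ε i j r * bInt s ε k l (p + 2)
        - ((-1 : ℂ) ^ ((par s i + par s j) * (par s k + par s l))) •
          (bInt s ε k l (p + 2) * bInt s ε i j r) ∈ quadratic s ε (wt i j + wt k l) (r + 2 + p)) →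
      (bInt s ε i j (r + 2) * bInt s ε k l p
        - ((-1 : ℂ) ^ ((par s i + par s j) * (par s k + par s l))) •
          (bInt s ε k l p * bInt s ε i j (r + 2))
            ∈ quadratic s ε (wt i j + wt k l) (r + 2 + p)) := by
    intro r p h
    have e := bInt_comm s ε i j k l r p
    rw [sub_eq_iff_eq_add] at e
    rw [e]
    have ha : ∀ {x y : Twisted s ε} {P : Prop} [Decidable P],
        (P → x ∈ quadratic s ε (wt i j + wt k l) (r + 2 + p)) →
        (if P then x else 0) ∈ quadratic s ε (wt i j + wt k l) (r + 2 + p) := by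
      intro x y P _ hx
      split_ifs with hP
      · exact hx hP
      · exact zero_mem _
    refine add_mem (sub_mem (add_mem (Submodule.smul_mem _ _ (add_mem (sub_mem ?_ ?_)
      (sub_mem ?_ ?_))) (Submodule.smul_mem _ _ (sub_mem (sub_mem (ha (y := 0) ?_) (ha (y := 0) ?_))
        (sub_mem (ha (y := 0) ?_) (ha (y := 0) ?_))))) (ha (y := 0) ?_)) h
    any_goals exact mem_quadratic (by simp only [wt]; ring) (by linarith)
    all_goals intro hx; subst hx
    any_goals exact sum_mem fun a _ => mem_quadratic (by simp only [wt]; ring) (by linarith)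
    exact sub_mem (sum_mem fun a _ => mem_quadratic (by simp only [wt]; ring) (by linarith))
      (sum_mem fun a _ => mem_quadratic (by simp only [wt]; ring) (by linarith))
  induction r using Nat.twoStepInduction generalizing p with
  | zero =>
    rw [Nat.cast_zero, bInt_zero]
    split_ifs with h
    · subst h
      rw [← two_mul, mul_assoc, pow_mul, neg_one_sq, one_pow, one_smul, Algebra.commutes, sub_self]
      exact zero_mem _
    · simp
  | one =>
    have := step (-1) p (by simp [bInt_of_neg])
    simpa using this
  | more r ih _ =>
    have := step r p (by simpa [add_assoc, add_comm, add_left_comm] using ih (p + 2))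
    simpa using this

end Reordering

section HighestWeight

variable {s ε : Fin 2 → ℤˣ} {V : Type*} [AddCommGroup V] [Module ℂ V]

/-- The images of `ζ` under the monomials of length `k` in the `b₂₁ r`. -/
noncomputable def lowered (ρ : Twisted s ε →ₐ[ℂ] Module.End ℂ V) (ζ : V) : ℕ → Submodule ℂ V
  | 0 => Submodule.span ℂ {ζ}
  | k + 1 => ⨆ r : ℕ, (lowered ρ ζ k).map (ρ (bCoeff s ε 1 0 r))

/-- The same for an integer `k`, where there are no monomials of negative length. -/
noncomputable def loweredInt (ρ : Twisted s ε →ₐ[ℂ] Module.End ℂ V) (ζ : V) (n : ℤ) :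
    Submodule ℂ V := if 0 ≤ n then lowered ρ ζ n.toNat else ⊥

variable {ρ : Twisted s ε →ₐ[ℂ] Module.End ℂ V} {ζ : V}

theorem loweredInt_natCast (n : ℕ) : loweredInt ρ ζ n = lowered ρ ζ n := by simp [loweredInt]

theorem lowering_mem {n : ℤ} {v : V} (hv : v ∈ loweredInt ρ ζ n) (r : ℕ) :
    ρ (bCoeff s ε 1 0 r) v ∈ loweredInt ρ ζ (n + 1) := by
  rw [loweredInt] at hv
  split_ifs at hv with hn
  · obtain ⟨k, rfl⟩ := Int.eq_ofNat_of_zero_le hn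
    rw [Int.toNat_natCast] at hv
    have : loweredInt ρ ζ ((k : ℤ) + 1) = lowered ρ ζ (k + 1) := loweredInt_natCast (k + 1)
    rw [this]
    exact Submodule.mem_iSup_of_mem r (Submodule.mem_map_of_mem hv)
  · rw [(Submodule.mem_bot ℂ).1 hv, map_zero]
    exact zero_mem _

/-- A vector that is killed by `b₁₂(u)` and is an eigenvector of `b₁₁(u)` and `b₂₂(u)`. -/
structure IsSingular (ρ : Twisted s ε →ₐ[ℂ] Module.End ℂ V) (μ : Fin 2 → PowerSeries ℂ) (ζ : V) :
    Prop where
  raising : ∀ r, ρ (bCoeff s ε 0 1 r) ζ = 0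
  diagonal : ∀ i r, ρ (bCoeff s ε i i r) ζ = PowerSeries.coeff r (μ i) • ζ

variable {μ : Fin 2 → PowerSeries ℂ}

/-- Every generator maps monomials of length `k` to monomials whose length is determined by the
weight of the generator. -/
theorem IsSingular.map_lowered (h : IsSingular ρ μ ζ) (k : ℕ) (i j : Fin 2) (r : ℕ) (v : V)
    (hv : v ∈ lowered ρ ζ k) : ρ (bCoeff s ε i j r) v ∈ loweredInt ρ ζ (k - wt i j) := by
  induction k using Nat.strong_induction_on generalizing i j r v with
  | _ k ihk =>
  -- the case of a lowering operator
  have h10 : ∀ r, ∀ v ∈ lowered ρ ζ k, ρ (bCoeff s ε 1 0 r) v ∈ loweredInt ρ ζ (k - wt 1 0) := by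
    intro r v hv
    rw [← loweredInt_natCast] at hv
    have := lowering_mem hv r
    simpa [wt] using this
  rcases k with _ | k
  · obtain ⟨c, rfl⟩ := Submodule.mem_span_singleton.1 hv
    rw [map_smul]
    refine Submodule.smul_mem _ _ ?_
    have hζ : ζ ∈ loweredInt ρ ζ 0 := by
      rw [← Nat.cast_zero, loweredInt_natCast]; exact Submodule.mem_span_singleton_self ζ
    by_cases hij : i = j
    · subst hij
      rw [h.diagonal]
      simpa [wt] using Submodule.smul_mem _ _ hζ
    · fin_cases i <;> fin_cases j
      · exact absurd rfl hij
      · have e : ρ (bCoeff s ε 0 1 r) ζ = 0 := h.raising r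
        change ρ (bCoeff s ε 0 1 r) ζ ∈ _
        rw [e]; exact zero_mem _
      · exact h10 r ζ (Submodule.mem_span_singleton_self ζ)
      · exact absurd rfl hij
  -- induction on the total degree of the two leftmost factors
  have main : ∀ n : ℕ, ∀ (i j : Fin 2) (r p : ℕ), r + p = n → ∀ v ∈ lowered ρ ζ k,
      ρ (bCoeff s ε i j r) (ρ (bCoeff s ε 1 0 p) v) ∈ loweredInt ρ ζ ((k + 1 : ℕ) - wt i j) := by
    intro n
    induction n using Nat.strong_induction_on with
    | _ n ihn =>
    intro i j r p hrp v hv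
    have hq := supercomm_mem_quadratic (s := s) (ε := ε) i j 1 0 r p
    have hwt : wt i j + wt 1 0 = wt i j - 1 := by simp [wt]; ring
    have key : ∀ x ∈ quadratic s ε (wt i j + wt 1 0) (r + p),
        ρ x v ∈ loweredInt ρ ζ ((k + 1 : ℕ) - wt i j) := by
      intro x hx
      refine Submodule.span_induction (p := fun x _ => ρ x v ∈ _) ?_ (by simp)
        (fun x y _ _ hx hy => by rw [map_add]; exact add_mem hx hy)
        (fun c x _ hx => by rw [map_smul]; exact Submodule.smul_mem _ _ hx) hx
      rintro _ ⟨i', j', k', l', a, b, hw, hab, rfl⟩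
      rw [map_mul, Module.End.mul_apply]
      rcases lt_or_ge a 0 with ha | ha
      · rw [bInt_of_neg s ε _ _ ha, map_zero]; exact zero_mem _
      rcases lt_or_ge b 0 with hb | hb
      · rw [bInt_of_neg s ε _ _ hb, map_zero, LinearMap.zero_apply, map_zero]; exact zero_mem _
      obtain ⟨a, rfl⟩ := Int.eq_ofNat_of_zero_le ha
      obtain ⟨b, rfl⟩ := Int.eq_ofNat_of_zero_le hb
      rw [bInt_natCast, bInt_natCast]
      by_cases h10' : k' = 1 ∧ l' = 0
      · obtain ⟨rfl, rfl⟩ := h10'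
        have := ihn (a + b) (by omega) i' j' a b rfl v hv
        have e : wt i' j' = wt i j := by linarith
        rwa [e] at this
      · have hn : (k : ℤ) - wt k' l' ≤ k := by
          fin_cases k' <;> fin_cases l' <;> simp [wt] at h10' ⊢
        have h1 := ihk k (by omega) k' l' b v hv
        rw [loweredInt] at h1
        split_ifs at h1 with h0
        · obtain ⟨k₁, hk₁⟩ := Int.eq_ofNat_of_zero_le h0
          rw [hk₁, Int.toNat_natCast] at h1
          have h2 := ihk k₁ (by omega) i' j' a _ h1
          have e : (k₁ : ℤ) - wt i' j' = (k + 1 : ℕ) - wt i j := by push_cast; linarith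
          rwa [e] at h2
        · rw [(Submodule.mem_bot ℂ).1 h1, map_zero]; exact zero_mem _
    have h1 := key _ hq
    rw [map_sub, map_smul, map_mul, map_mul, LinearMap.sub_apply, LinearMap.smul_apply,
      Module.End.mul_apply, Module.End.mul_apply] at h1
    have h2 : ρ (bInt s ε 1 0 p) (ρ (bInt s ε i j r) v)
        ∈ loweredInt ρ ζ ((k + 1 : ℕ) - wt i j) := by
      have := lowering_mem (ihk k (by omega) i j r v hv) p
      have e : (k : ℤ) - wt i j + 1 = (k + 1 : ℕ) - wt i j := by push_cast; ring
      rwa [e] at this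
    have := add_mem h1 (Submodule.smul_mem _
      ((-1 : ℂ) ^ ((par s i + par s j) * (par s 1 + par s 0))) h2)
    rwa [sub_add_cancel] at this
  have hv' : v ∈ ⨆ r : ℕ, (lowered ρ ζ k).map (ρ (bCoeff s ε 1 0 r)) := hv
  refine Submodule.iSup_induction _ (motive := fun v => ρ (bCoeff s ε i j r) v ∈ _) hv' ?_
    (by simp) (fun x y hx hy => by rw [map_add]; exact add_mem hx hy)
  rintro p _ ⟨v, hv, rfl⟩
  exact main _ i j r p rfl v hv

/-- A subspace that is stable under the generators is invariant. -/
theorem isInvariant_of_generators {W : Submodule ℂ V}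
    (hW : ∀ i j r, ∀ v ∈ W, ρ (bCoeff s ε i j r) v ∈ W) : IsInvariant ρ W := by
  intro x
  obtain ⟨y, rfl⟩ := RingQuot.mkAlgHom_surjective ℂ (TwistedRel s ε) x
  induction y using FreeAlgebra.induction with
  | grade0 c =>
    intro v hv
    rw [AlgHom.commutes, AlgHom.commutes, Module.algebraMap_end_apply]
    exact W.smul_mem c hv
  | grade1 g =>
    obtain ⟨i, j, r⟩ := g
    have e : RingQuot.mkAlgHom ℂ (TwistedRel s ε) (FreeAlgebra.ι ℂ (i, j, r))
        = bCoeff s ε i j (r + 1) := by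
      rw [bCoeff, gen, if_neg (by positivity), if_pos (by positivity)]
      simp
    rw [e]
    exact hW i j (r + 1)
  | mul a b ha hb =>
    intro v hv
    rw [map_mul, map_mul]
    exact ha _ (hb _ hv)
  | add a b ha hb =>
    intro v hv
    rw [map_add, map_add]
    exact W.add_mem (ha _ hv) (hb _ hv)

/-- The monomials in the lowering operators, applied to a singular vector, span a submodule. -/
theorem IsSingular.isInvariant (h : IsSingular ρ μ ζ) :
    IsInvariant ρ (⨆ k, lowered ρ ζ k) := by
  refine isInvariant_of_generators fun i j r v hv => ?_
  refine Submodule.iSup_induction _ (motive := fun v => ρ (bCoeff s ε i j r) v ∈ _) hv ?_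
    (by simp) (fun x y hx hy => by rw [map_add]; exact add_mem hx hy)
  intro k v hv
  have := h.map_lowered k i j r v hv
  rw [loweredInt] at this
  split_ifs at this
  · exact Submodule.mem_iSup_of_mem _ this
  · rw [(Submodule.mem_bot ℂ).1 this]; exact zero_mem _

theorem mem_iSup_lowered : ζ ∈ ⨆ k, lowered ρ ζ k :=
  Submodule.mem_iSup_of_mem 0 (Submodule.mem_span_singleton_self ζ)

/-- The grading operator detects the length of the monomials in the lowering operators. -/
theorem IsSingular.lowered_le_eigenspace (h : IsSingular ρ μ ζ) (k : ℕ) :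
    lowered ρ ζ k ≤ (ρ (bCoeff s ε 0 0 1)).eigenspace
      (PowerSeries.coeff 1 (μ 0) - k * (2 * sgn (s 0) * sgn (ε 0))) := by
  induction k with
  | zero =>
    rw [lowered, Submodule.span_singleton_le_iff_mem, Module.End.mem_eigenspace_iff, h.diagonal]
    simp
  | succ k ih =>
    refine iSup_le fun r => ?_
    rintro _ ⟨v, hv, rfl⟩
    have hv' := Module.End.mem_eigenspace_iff.1 (ih hv)
    have e := LinearMap.congr_fun (congrArg ρ (one_comm_lowering s ε r)) v
    rw [map_sub, map_mul, map_mul, map_smul, LinearMap.sub_apply, LinearMap.smul_apply,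
      Module.End.mul_apply, Module.End.mul_apply, hv', map_smul, ← sub_smul] at e
    rw [Module.End.mem_eigenspace_iff, e]
    congr 1
    push_cast
    ring

/-- In the module generated by a singular vector, the vectors of the same weight for `b₁₁ 1` are
its multiples. -/
theorem IsSingular.mem_span (h : IsSingular ρ μ ζ) {v : V} (hv : v ∈ ⨆ k, lowered ρ ζ k)
    (hH : ρ (bCoeff s ε 0 0 1) v = PowerSeries.coeff 1 (μ 0) • v) :
    v ∈ Submodule.span ℂ {ζ} := by
  set H := ρ (bCoeff s ε 0 0 1)
  set c := PowerSeries.coeff 1 (μ 0)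
  have hle : (⨆ k, lowered ρ ζ k) ≤ lowered ρ ζ 0 ⊔ ⨆ (x) (_ : x ≠ c), H.eigenspace x := by
    refine iSup_le fun k => ?_
    rcases k with _ | k
    · exact le_sup_left
    · refine le_trans ?_ le_sup_right
      refine (h.lowered_le_eigenspace (k + 1)).trans
        (le_iSup₂_of_le (c - (k + 1 : ℕ) * (2 * sgn (s 0) * sgn (ε 0))) ?_ le_rfl)
      intro e
      have h1 : ((k + 1 : ℕ) : ℂ) * (2 * sgn (s 0) * sgn (ε 0)) = 0 := by linear_combination -e
      exact mul_ne_zero (Nat.cast_ne_zero.2 k.succ_ne_zero) (two_mul_sgn_ne_zero _ _) h1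
  obtain ⟨a, ha, b, hb, rfl⟩ := Submodule.mem_sup.1 (hle hv)
  have ha' : a ∈ H.eigenspace c := by
    have := h.lowered_le_eigenspace 0 ha
    simpa using this
  have hb' : b ∈ H.eigenspace c := by
    have := sub_mem (Module.End.mem_eigenspace_iff.2 hH) ha'
    simpa using this
  have hb0 : b = 0 := Submodule.disjoint_def.1 (Module.End.eigenspaces_iSupIndep H c) b hb' hb
  rw [hb0, add_zero]
  exact ha

end HighestWeight

/-! ### Isomorphisms between highest weight modules -/

section Intertwiner

variable {s ε : Fin 2 → ℤˣ} {V W : Type*} [AddCommGroup V] [Module ℂ V] [AddCommGroup W]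
  [Module ℂ W]

/-- The parity operator preserves the submodule generated by a homogeneous singular vector. -/
theorem lowered_stable {ρ : Twisted s ε →ₐ[ℂ] Module.End ℂ V} {σ : Module.End ℂ V} {ζ : V} {c : ℂ}
    (hσ : ∀ r, σ * ρ (bCoeff s ε 1 0 r) = c • (ρ (bCoeff s ε 1 0 r) * σ))
    (hζ : σ ζ ∈ Submodule.span ℂ {ζ}) :
    ∀ v ∈ ⨆ k, lowered ρ ζ k, σ v ∈ ⨆ k, lowered ρ ζ k := by
  have hk : ∀ k, ∀ v ∈ lowered ρ ζ k, σ v ∈ lowered ρ ζ k := by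
    intro k
    induction k with
    | zero =>
      intro v hv
      obtain ⟨d, rfl⟩ := Submodule.mem_span_singleton.1 hv
      rw [map_smul]
      exact Submodule.smul_mem _ _ hζ
    | succ k ih =>
      intro v hv
      have hv' : v ∈ ⨆ r : ℕ, (lowered ρ ζ k).map (ρ (bCoeff s ε 1 0 r)) := hv
      refine Submodule.iSup_induction _ (motive := fun v => σ v ∈ lowered ρ ζ (k + 1)) hv' ?_
        (by simp) (fun x y hx hy => by rw [map_add]; exact add_mem hx hy)
      rintro r _ ⟨w, hw, rfl⟩
      have e := LinearMap.congr_fun (hσ r) w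
      rw [Module.End.mul_apply] at e
      rw [e]
      exact Submodule.smul_mem _ _
        (Submodule.mem_iSup_of_mem r (Submodule.mem_map_of_mem (ih w hw)))
  intro v hv
  exact Submodule.iSup_induction _ (motive := fun v => σ v ∈ _) hv
    (fun k v hv => Submodule.mem_iSup_of_mem k (hk k v hv)) (by simp)
    (fun x y hx hy => by rw [map_add]; exact add_mem hx hy)

/-- The direct sum of two modules. -/
noncomputable def prodRep (ρ : Twisted s ε →ₐ[ℂ] Module.End ℂ V)
    (ρ' : Twisted s ε →ₐ[ℂ] Module.End ℂ W) : Twisted s ε →ₐ[ℂ] Module.End ℂ (V × W) :=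
  (LinearMap.prodMapAlgHom ℂ V W).comp (ρ.prod ρ')

variable {ρ : Twisted s ε →ₐ[ℂ] Module.End ℂ V} {ρ' : Twisted s ε →ₐ[ℂ] Module.End ℂ W}
  {σ : Module.End ℂ V} {σ' : Module.End ℂ W} {μ : Fin 2 → PowerSeries ℂ} {η : V} {ξ : W}

theorem prodRep_apply (x : Twisted s ε) (v : V) (w : W) :
    prodRep ρ ρ' x (v, w) = (ρ x v, ρ' x w) := rfl

theorem IsHighestWeightVector.isSingular (h : IsHighestWeightVector ρ μ η) : IsSingular ρ μ η :=
  ⟨h.raising 0 1 (by decide), h.diagonal⟩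

theorem IsSingular.prodRep (h : IsSingular ρ μ η) (h' : IsSingular ρ' μ ξ) :
    IsSingular (prodRep ρ ρ') μ (η, ξ) :=
  ⟨fun r => by rw [prodRep_apply, h.raising, h'.raising]; rfl,
    fun i r => by rw [prodRep_apply, h.diagonal, h'.diagonal]; rfl⟩

/-- A highest weight vector is homogeneous. -/
theorem IsHighestWeightVector.exists_parity (hσ : IsSuperModule s (bCoeff s ε) σ ρ)
    (h : IsHighestWeightVector ρ μ η) : ∃ δ : ℂ, (δ = 1 ∨ δ = -1) ∧ σ η = δ • η := by
  have htop : (⨆ k, lowered ρ η k) = ⊤ := h.generates _ h.isSingular.isInvariant mem_iSup_lowered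
  have hmem : σ η ∈ Submodule.span ℂ {η} := by
    refine h.isSingular.mem_span (by rw [htop]; trivial) ?_
    have e := LinearMap.congr_fun (hσ.homogeneous 0 0 1) η
    rw [← two_mul, pow_mul, neg_one_sq, one_pow, one_smul, Module.End.mul_apply,
      Module.End.mul_apply, h.diagonal, map_smul] at e
    exact e.symm
  obtain ⟨δ, hδ⟩ := Submodule.mem_span_singleton.1 hmem
  refine ⟨δ, ?_, hδ.symm⟩
  have e := LinearMap.congr_fun hσ.sq η
  rw [Module.End.mul_apply, ← hδ, map_smul, ← hδ, smul_smul, Module.End.one_apply] at e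
  have e' : (δ * δ - 1) • η = 0 := by rw [sub_smul, e, one_smul, sub_self]
  rcases smul_eq_zero.1 e' with e' | e'
  · exact mul_self_eq_one_iff.1 (sub_eq_zero.1 e')
  · exact absurd e' h.ne_zero

/-- Two irreducible modules with singular vectors of the same weight are isomorphic: the
submodule of their direct sum that is generated by the sum of these vectors is the graph of an
isomorphism. -/
theorem exists_intertwiner (hσ : IsSuperModule s (bCoeff s ε) σ ρ) (hρ : IsSuperIrreducible σ ρ)
    (hη : IsHighestWeightVector ρ μ η) (hσ' : IsSuperModule s (bCoeff s ε) σ' ρ')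
    (hρ' : IsStronglyIrreducible ρ') (hξ : IsSingular ρ' μ ξ) (hξ0 : ξ ≠ 0) (hξσ : σ' ξ = ξ) :
    ∃ f : V ≃ₗ[ℂ] W, (∀ x v, f (ρ x v) = ρ' x (f v)) ∧
      ((∀ v, f (σ v) = σ' (f v)) ∨ (∀ v, f (σ v) = -σ' (f v))) := by
  obtain ⟨δ, hδ, hση⟩ := hη.exists_parity hσ
  have hδ2 : δ * δ = 1 := by rcases hδ with rfl | rfl <;> norm_num
  have hζ := hη.isSingular.prodRep hξ
  set U := ⨆ k, lowered (prodRep ρ ρ') (η, ξ) k with hU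
  have hUinv : IsInvariant (prodRep ρ ρ') U := hζ.isInvariant
  have hζU : (η, ξ) ∈ U := mem_iSup_lowered
  have hUσ : ∀ u ∈ U, ((δ • σ).prodMap σ') u ∈ U := by
    refine lowered_stable (c := (-1) ^ (par s 1 + par s 0)) (fun r => ?_) ?_
    · refine LinearMap.ext fun ⟨v, w⟩ => ?_
      have e := LinearMap.congr_fun (hσ.homogeneous 1 0 r) v
      have e' := LinearMap.congr_fun (hσ'.homogeneous 1 0 r) w
      simp only [Module.End.mul_apply, LinearMap.smul_apply] at e e'
      simp only [Module.End.mul_apply, LinearMap.smul_apply, prodRep_apply, LinearMap.prodMap_apply,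
        e, e', map_smul, Prod.smul_mk, smul_comm δ]
    · rw [LinearMap.prodMap_apply, LinearMap.smul_apply, hση, smul_smul, hδ2, one_smul, hξσ]
      exact Submodule.mem_span_singleton_self _
  -- a vector of `U` with one vanishing component vanishes
  have hH : ∀ u : V × W, u ∈ U → prodRep ρ ρ' (bCoeff s ε 0 0 1) u = PowerSeries.coeff 1 (μ 0) • u →
      ∃ c : ℂ, c • (η, ξ) = u := fun u hu hu' =>
    Submodule.mem_span_singleton.1 (hζ.mem_span hu hu')
  have hK : U.comap (LinearMap.inl ℂ V W) = ⊥ := by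
    refine (hρ.2 _ (fun v hv => ?_) (fun x v hv => ?_)).resolve_right fun htop => ?_
    · have := U.smul_mem δ (hUσ _ hv)
      simpa [smul_smul, hδ2] using this
    · have := hUinv x _ hv
      simpa [prodRep_apply] using this
    · have h1 : (η, (0 : W)) ∈ U := by
        have : η ∈ U.comap (LinearMap.inl ℂ V W) := by rw [htop]; trivial
        exact this
      obtain ⟨c, hc⟩ := hH _ h1 (by
        rw [prodRep_apply, hη.diagonal, map_zero, Prod.smul_mk, smul_zero])
      rw [Prod.smul_mk, Prod.mk.injEq] at hc
      rcases smul_eq_zero.1 hc.2 with rfl | h0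
      · exact hη.ne_zero (by simpa using hc.1.symm)
      · exact hξ0 h0
  have hK' : U.comap (LinearMap.inr ℂ V W) = ⊥ := by
    refine (hρ'.2 _ (fun x v hv => ?_)).resolve_right fun htop => ?_
    · have := hUinv x _ hv
      simpa [prodRep_apply] using this
    · have h1 : ((0 : V), ξ) ∈ U := by
        have : ξ ∈ U.comap (LinearMap.inr ℂ V W) := by rw [htop]; trivial
        exact this
      obtain ⟨c, hc⟩ := hH _ h1 (by
        rw [prodRep_apply, hξ.diagonal, map_zero, Prod.smul_mk, smul_zero])
      rw [Prod.smul_mk, Prod.mk.injEq] at hc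
      rcases smul_eq_zero.1 hc.1 with rfl | h0
      · exact hξ0 (by simpa using hc.2.symm)
      · exact hη.ne_zero h0
  have hT : U.map (LinearMap.fst ℂ V W) = ⊤ := by
    refine hη.generates _ ?_ (Submodule.mem_map_of_mem (f := LinearMap.fst ℂ V W) hζU)
    rintro x _ ⟨u, hu, rfl⟩
    exact ⟨_, hUinv x u hu, rfl⟩
  have hT' : U.map (LinearMap.snd ℂ V W) = ⊤ := by
    refine (hρ'.2 _ ?_).resolve_left fun hbot => ?_
    · rintro x _ ⟨u, hu, rfl⟩
      exact ⟨_, hUinv x u hu, rfl⟩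
    · have := Submodule.mem_map_of_mem (f := LinearMap.snd ℂ V W) hζU
      rw [hbot] at this
      exact hξ0 ((Submodule.mem_bot ℂ).1 this)
  let p₁ : U →ₗ[ℂ] V := LinearMap.fst ℂ V W ∘ₗ U.subtype
  let p₂ : U →ₗ[ℂ] W := LinearMap.snd ℂ V W ∘ₗ U.subtype
  have b₁ : Function.Bijective p₁ := by
    constructor
    · refine (injective_iff_map_eq_zero p₁).2 fun ⟨⟨v, w⟩, hu⟩ h0 => ?_
      obtain rfl : v = 0 := h0
      have : w ∈ U.comap (LinearMap.inr ℂ V W) := hu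
      rw [hK', Submodule.mem_bot] at this
      subst this
      rfl
    · intro v
      obtain ⟨u, hu, rfl⟩ := (by rw [hT]; trivial : v ∈ U.map (LinearMap.fst ℂ V W))
      exact ⟨⟨u, hu⟩, rfl⟩
  have b₂ : Function.Bijective p₂ := by
    constructor
    · refine (injective_iff_map_eq_zero p₂).2 fun ⟨⟨v, w⟩, hu⟩ h0 => ?_
      obtain rfl : w = 0 := h0
      have : v ∈ U.comap (LinearMap.inl ℂ V W) := hu
      rw [hK, Submodule.mem_bot] at this
      subst this
      rfl
    · intro w
      obtain ⟨u, hu, rfl⟩ := (by rw [hT']; trivial : w ∈ U.map (LinearMap.snd ℂ V W))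
      exact ⟨⟨u, hu⟩, rfl⟩
  let f := (LinearEquiv.ofBijective p₁ b₁).symm.trans (LinearEquiv.ofBijective p₂ b₂)
  have hf : ∀ u ∈ U, f u.1 = u.2 := fun u hu => by
    have e : (LinearEquiv.ofBijective p₁ b₁).symm u.1 = ⟨u, hu⟩ :=
      (LinearEquiv.symm_apply_eq _).2 rfl
    rw [LinearEquiv.trans_apply, e]
    rfl
  have hv : ∀ v, (v, f v) ∈ U := fun v => by
    obtain ⟨⟨u, hu⟩, rfl⟩ := b₁.2 v
    change (u.1, f u.1) ∈ U
    rw [hf u hu]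
    exact hu
  refine ⟨f, fun x v => hf _ (hUinv x _ (hv v)), ?_⟩
  have hs : ∀ v, δ • f (σ v) = σ' (f v) := fun v => by
    rw [← map_smul]
    exact hf _ (hUσ _ (hv v))
  rcases hδ with rfl | rfl
  · exact Or.inl fun v => by rw [← hs, one_smul]
  · exact Or.inr fun v => by rw [← hs, neg_smul, one_smul, neg_neg]

end Intertwiner

/-! ### Highest weights up to rescaling -/

section Rescaling

variable {s ε : Fin 2 → ℤˣ} {V W : Type*} [AddCommGroup V] [Module ℂ V] [AddCommGroup W]
  [Module ℂ W] {ρ : Twisted s ε →ₐ[ℂ] Module.End ℂ V} {ρ' : Twisted s ε →ₐ[ℂ] Module.End ℂ W}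
  {σ : Module.End ℂ V} {σ' : Module.End ℂ W} {μ m : Fin 2 → PowerSeries ℂ} {η : V} {ξ : W}

theorem IsSingular.constantCoeff (h : IsSingular ρ μ η) (h0 : η ≠ 0) (i : Fin 2) :
    PowerSeries.constantCoeff (μ i) = signs ε i := by
  have e := h.diagonal i 0
  rw [bCoeff_zero, if_pos rfl, AlgHom.commutes, Module.algebraMap_end_apply,
    PowerSeries.coeff_zero_eq_constantCoeff_apply] at e
  exact (smul_left_injective ℂ h0 e).symm

/-- The unitary condition on the second component of a highest weight; there is no such condition on
the first one, as `b₁₂(u)` need not kill the vectors `b₂₁(-u) η`. -/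
theorem IsSingular.unitary (h : IsSingular ρ μ η) (h0 : η ≠ 0) :
    μ 1 * PowerSeries.evalNegHom (μ 1) = 1 := by
  ext r
  have e := congrArg (fun F : MatSeries 2 (Twisted s ε) => ρ (PowerSeries.coeff r F 1 1) η)
    (series_bCoeff_unitary s ε)
  rw [coeff_mul_negHom, map_sum, LinearMap.sum_apply] at e
  have e' : ∀ n ∈ Finset.HasAntidiagonal.antidiagonal r,
      ρ (((-1 : ℂ) ^ n.2) • ∑ a, PowerSeries.coeff n.1 (series (bCoeff s ε)) 1 a
        * PowerSeries.coeff n.2 (series (bCoeff s ε)) a 1) η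
      = (PowerSeries.coeff n.1 (μ 1)
        * PowerSeries.coeff n.2 (PowerSeries.evalNegHom (μ 1))) • η := by
    intro n _
    simp only [coeff_series, Fin.sum_univ_two, map_smul, map_add, map_mul, LinearMap.smul_apply,
      LinearMap.add_apply, Module.End.mul_apply, h.raising, h.diagonal, map_zero, zero_add,
      smul_smul, PowerSeries.evalNegHom, PowerSeries.coeff_rescale]
    congr 1
    ring
  rw [Finset.sum_congr rfl e', ← Finset.sum_smul, ← PowerSeries.coeff_mul] at e
  refine smul_left_injective ℂ h0 ?_
  dsimp only
  rw [e, PowerSeries.coeff_one, PowerSeries.coeff_one]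
  split_ifs <;> simp

theorem tildeWeight_zero (s : Fin 2 → ℤˣ) (μ : Fin 2 → PowerSeries ℂ) : tildeWeight s μ 0
    = (2 * uVar - HahnSeries.C (sgn (s 1))) * HahnSeries.ofPowerSeries ℤ ℂ (μ 0)
      + HahnSeries.C (sgn (s 1)) * HahnSeries.ofPowerSeries ℤ ℂ (μ 1) := by
  have : Finset.Ioi (0 : Fin 2) = {1} := by decide
  rw [tildeWeight, this, Finset.sum_singleton, Finset.sum_singleton]

theorem tildeWeight_one (s : Fin 2 → ℤˣ) (μ : Fin 2 → PowerSeries ℂ) : tildeWeight s μ 1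
    = 2 * uVar * HahnSeries.ofPowerSeries ℤ ℂ (μ 1) := by
  have : Finset.Ioi (1 : Fin 2) = ∅ := by decide
  rw [tildeWeight, this, Finset.sum_empty, Finset.sum_empty, map_zero, sub_zero, add_zero]

theorem uVar_ne_zero : uVar ≠ 0 := HahnSeries.single_ne_zero one_ne_zero

theorem uVar_mul_X : uVar * HahnSeries.ofPowerSeries ℤ ℂ PowerSeries.X = 1 := by
  rw [HahnSeries.ofPowerSeries_X, uVar, HahnSeries.single_mul_single]
  simp

theorem C_eq_ofPowerSeries (c : ℂ) :
    (HahnSeries.C c : LaurentSeries ℂ) = HahnSeries.ofPowerSeries ℤ ℂ (PowerSeries.C c) :=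
  (HahnSeries.ofPowerSeries_C c).symm

theorem two_uVar_sub_ne_zero (c : ℂ) : 2 * uVar - HahnSeries.C c ≠ 0 := by
  intro h
  have h1 : HahnSeries.ofPowerSeries ℤ ℂ (2 - PowerSeries.C c * PowerSeries.X) = 0 := by
    rw [map_sub, map_mul, ← C_eq_ofPowerSeries, map_ofNat]
    linear_combination HahnSeries.ofPowerSeries ℤ ℂ PowerSeries.X * h - 2 * uVar_mul_X
  rw [map_eq_zero_iff _ HahnSeries.ofPowerSeries_injective] at h1
  have h2 := congrArg PowerSeries.constantCoeff h1
  rw [map_sub, map_mul, PowerSeries.constantCoeff_X, mul_zero, sub_zero, map_zero, map_ofNat] at h2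
  exact two_ne_zero h2

theorem two_uVar_ne_zero : 2 * uVar ≠ 0 := by
  simpa using two_uVar_sub_ne_zero 0

/-- Highest weights with the same ratio are proportional. -/
theorem mul_eq_mul_of_ratio (hμ : μ 1 ≠ 0) (hm : m 1 ≠ 0)
    (h : tildeWeight s μ 0 / tildeWeight s μ 1 = tildeWeight s m 0 / tildeWeight s m 1) :
    μ 0 * m 1 = m 0 * μ 1 := by
  have hμ' : HahnSeries.ofPowerSeries ℤ ℂ (μ 1) ≠ 0 :=
    (map_ne_zero_iff _ HahnSeries.ofPowerSeries_injective).2 hμ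
  have hm' : HahnSeries.ofPowerSeries ℤ ℂ (m 1) ≠ 0 :=
    (map_ne_zero_iff _ HahnSeries.ofPowerSeries_injective).2 hm
  rw [tildeWeight_one, tildeWeight_one, div_eq_div_iff
    (mul_ne_zero two_uVar_ne_zero hμ') (mul_ne_zero two_uVar_ne_zero hm'),
    tildeWeight_zero, tildeWeight_zero] at h
  refine HahnSeries.ofPowerSeries_injective (Γ := ℤ) ?_
  rw [map_mul, map_mul]
  refine mul_left_cancel₀ (mul_ne_zero two_uVar_ne_zero
    (two_uVar_sub_ne_zero (sgn (s 1)))) ?_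
  linear_combination h

/-- A module is determined, up to almost isomorphism, by the ratio of its highest weight. -/
theorem almostIsomorphic_of_ratio (hσ : IsSuperModule s (bCoeff s ε) σ ρ)
    (hρ : IsSuperIrreducible σ ρ) (hη : IsHighestWeightVector ρ μ η)
    (hσ' : IsSuperModule s (bCoeff s ε) σ' ρ') (hρ' : IsStronglyIrreducible ρ')
    (hξ : IsSingular ρ' m ξ) (hξ0 : ξ ≠ 0) (hξσ : σ' ξ = ξ)
    (h : tildeWeight s μ 0 / tildeWeight s μ 1 = tildeWeight s m 0 / tildeWeight s m 1) :
    AlmostIsomorphic σ ρ σ' ρ' := by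
  have cμ := hη.isSingular.constantCoeff hη.ne_zero 1
  have cm := hξ.constantCoeff hξ0 1
  have hε := signs_mul_self ε 1
  have hε0 : signs ε 1 ≠ 0 := left_ne_zero_of_mul (hε.symm ▸ one_ne_zero)
  have hμ1 : μ 1 ≠ 0 := fun h0 => hε0 (by rw [← cμ, h0, map_zero])
  have hm1 : m 1 ≠ 0 := fun h0 => hε0 (by rw [← cm, h0, map_zero])
  have hprop := mul_eq_mul_of_ratio hμ1 hm1 h
  have hinv : m 1 * (m 1)⁻¹ = 1 := PowerSeries.mul_inv_cancel _ (by rw [cm]; exact hε0)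
  set k := μ 1 * (m 1)⁻¹ with hk
  have hk1 : k * m 1 = μ 1 := by rw [hk]; linear_combination μ 1 * hinv
  have hk0 : k * m 0 = μ 0 := by rw [hk]; linear_combination (-(m 1)⁻¹) * hprop + μ 0 * hinv
  have hkc : PowerSeries.constantCoeff k = 1 := by
    have := congrArg PowerSeries.constantCoeff hk1
    rw [map_mul, cm, cμ] at this
    exact mul_right_cancel₀ hε0 (by rw [this, one_mul])
  have hkk : k * PowerSeries.evalNegHom k = 1 := by
    have u1 := hη.isSingular.unitary hη.ne_zero
    have u2 := hξ.unitary hξ0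
    rw [← hk1, map_mul] at u1
    linear_combination u1 - k * PowerSeries.evalNegHom k * u2
  obtain ⟨M, hM⟩ := exists_rescaling (s := s) (ε := ε) hkc hkk
  have hρM : ∀ i j r, ρ'.comp (M : Twisted s ε →ₐ[ℂ] Twisted s ε) (bCoeff s ε i j r)
      = ∑ n ∈ Finset.HasAntidiagonal.antidiagonal r,
        PowerSeries.coeff n.1 k • ρ' (bCoeff s ε i j n.2) := by
    intro i j r
    change ρ' (M _) = _
    rw [hM, map_sum]
    exact Finset.sum_congr rfl fun n _ => map_smul _ _ _
  have hs' : IsSuperModule s (bCoeff s ε) σ' (ρ'.comp (M : Twisted s ε →ₐ[ℂ] Twisted s ε)) := by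
    refine ⟨hσ'.sq, fun i j r => ?_⟩
    rw [hρM, Finset.mul_sum, Finset.sum_mul, Finset.smul_sum]
    refine Finset.sum_congr rfl fun n _ => ?_
    rw [mul_smul_comm, smul_mul_assoc, hσ'.homogeneous, smul_comm]
  have hirr : IsStronglyIrreducible (ρ'.comp (M : Twisted s ε →ₐ[ℂ] Twisted s ε)) := by
    refine ⟨hρ'.1, fun U hU => hρ'.2 U fun x v hv => ?_⟩
    have := hU (M.symm x) v hv
    change ρ' (M _) v ∈ U at this
    rwa [AlgEquiv.apply_symm_apply] at this
  have hsing : IsSingular (ρ'.comp (M : Twisted s ε →ₐ[ℂ] Twisted s ε)) μ ξ := by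
    refine ⟨fun r => ?_, fun i r => ?_⟩
    · rw [hρM, LinearMap.sum_apply]
      exact Finset.sum_eq_zero fun n _ => by rw [LinearMap.smul_apply, hξ.raising, smul_zero]
    · have hki : k * m i = μ i := by fin_cases i <;> assumption
      rw [hρM, LinearMap.sum_apply, ← hki, PowerSeries.coeff_mul, Finset.sum_smul]
      exact Finset.sum_congr rfl fun n _ => by
        rw [LinearMap.smul_apply, hξ.diagonal, smul_smul]
  obtain ⟨f, hf, hf'⟩ := exists_intertwiner hσ hρ hη hs' hirr hsing hξ0 hξσ
  exact ⟨k, M, f, hkc, hkk, hM, hf, hf'⟩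

/-- The first vector of an extremal pair is singular. -/
theorem IsExtremalPair.isSingular {B : MatSeries 2 (Module.End ℂ W)} {ξ' : Module.Dual ℂ W}
    {N : PowerSeries ℂ} {p R : Polynomial ℂ} (h : IsExtremalPair s B ξ ξ' m N p R)
    (hρ : ∀ i j r, ρ' (bCoeff s ε i j r) = PowerSeries.coeff r B i j) : IsSingular ρ' m ξ := by
  refine ⟨fun r => ?_, fun i r => ?_⟩
  · refine (Module.forall_dual_apply_eq_zero_iff ℂ _).1 fun ψ => ?_
    have := congrArg (PowerSeries.coeff r) (h.raising ψ)
    rwa [matCoeff, PowerSeries.coeff_mk, map_zero, ← hρ] at this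
  · refine sub_eq_zero.1 ((Module.forall_dual_apply_eq_zero_iff ℂ _).1 fun ψ => ?_)
    have := congrArg (PowerSeries.coeff r) (h.weight i ψ)
    rw [matCoeff, PowerSeries.coeff_mk, PowerSeries.coeff_C_mul, ← hρ] at this
    rw [map_sub, this, map_smul, smul_eq_mul, mul_comm, sub_self]

/-- The ratio of the highest weight, as a quotient of polynomials in `t = s₁ u⁻¹`. -/
theorem IsExtremalPair.ratio (hs : s 0 ≠ s 1) {B : MatSeries 2 (Module.End ℂ W)}
    {ξ' : Module.Dual ℂ W} {N : PowerSeries ℂ} {p R : Polynomial ℂ}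
    (h : IsExtremalPair s B ξ ξ' m N p R) :
    tildeWeight s m 0 / tildeWeight s m 1 = HahnSeries.ofPowerSeries ℤ ℂ (polySeries s R)
      / HahnSeries.ofPowerSeries ℤ ℂ (polySeries s p) := by
  have hN : HahnSeries.ofPowerSeries ℤ ℂ N ≠ 0 :=
    (map_ne_zero_iff _ HahnSeries.ofPowerSeries_injective).2 h.denom
  have e1 := congrArg (HahnSeries.ofPowerSeries ℤ ℂ) h.first
  have e2 := congrArg (HahnSeries.ofPowerSeries ℤ ℂ) h.second
  rw [map_mul (polySeries s), map_ofNat] at e1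
  simp only [map_mul, map_sub, map_add, sX, ← C_eq_ofPowerSeries, map_ofNat] at e1 e2
  have e0 : 2 * uVar * HahnSeries.ofPowerSeries ℤ ℂ (polySeries s R)
      = HahnSeries.ofPowerSeries ℤ ℂ N * tildeWeight s m 0 := by
    rw [tildeWeight_zero, sgn_one_eq_neg hs, map_neg]
    linear_combination (-uVar) * e1 + HahnSeries.ofPowerSeries ℤ ℂ N * HahnSeries.C (sgn (s 0))
      * (HahnSeries.ofPowerSeries ℤ ℂ (m 0) - HahnSeries.ofPowerSeries ℤ ℂ (m 1)) * uVar_mul_X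
  rw [tildeWeight_one, ← mul_div_mul_left _ _ hN, ← e0, ← e2,
    ← mul_div_mul_left (HahnSeries.ofPowerSeries ℤ ℂ (polySeries s R)) _ two_uVar_ne_zero]
  congr 1
  ring

end Rescaling

/-! ### Parameters -/

section Parameters

/-- The list of the pairs `(c i, c (i + k) - 1)`, with nodes `c 1, …, c (2 k)`. -/
noncomputable def pairsOf (k : ℕ) (c : ℕ → ℂ) : List (ℂ × ℂ) :=
  (List.range' 1 k).map fun i => (c i, c (i + k) - 1)

theorem prod_map_range' {R : Type*} [CommMonoid R] (k : ℕ) (F : ℕ → R) :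
    ((List.range' 1 k).map F).prod = ∏ i ∈ Finset.range k, F (i + 1) := by
  induction k with
  | zero => simp
  | succ k ih =>
    rw [List.range'_1_concat, List.map_append, List.prod_append, ih, Finset.prod_range_succ]
    simp [add_comm]

theorem prod_range_pairs {R : Type*} [CommMonoid R] (k : ℕ) (F : ℕ → R) :
    ∏ i ∈ Finset.range k, (F (i + 1) * F (i + 1 + k)) = ∏ i ∈ Finset.range (2 * k), F (i + 1) := by
  rw [Finset.prod_mul_distrib, two_mul, Finset.prod_range_add]
  congr 1
  exact Finset.prod_congr rfl fun i _ => by congr 1; ring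

theorem firstPoly_pairsOf (R₀ : Polynomial ℂ) (k : ℕ) (c : ℕ → ℂ) :
    firstPoly R₀ (pairsOf k c)
      = (∏ i ∈ Finset.range (2 * k), (1 + Polynomial.C (c (i + 1)) * Polynomial.X)) * R₀ := by
  have h : ∀ L : List (ℂ × ℂ), firstPoly R₀ L = (L.map fun q =>
      (1 + Polynomial.C q.1 * Polynomial.X)
        * (1 + Polynomial.C (q.2 + 1) * Polynomial.X)).prod * R₀ := by
    intro L
    induction L with
    | nil => simp [firstPoly]
    | cons q L ih => rw [List.map_cons, List.prod_cons, mul_assoc, ← ih]; rfl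
  rw [h, pairsOf, List.map_map, prod_map_range',
    ← prod_range_pairs k fun i => (1 + Polynomial.C (c i) * Polynomial.X)]
  simp

theorem secondPoly_pairsOf (p₀ : Polynomial ℂ) (k : ℕ) (c : ℕ → ℂ) :
    secondPoly p₀ (pairsOf k c)
      = (∏ i ∈ Finset.range (2 * k), (1 + Polynomial.C (1 - c (i + 1)) * Polynomial.X)) * p₀ := by
  have h : ∀ L : List (ℂ × ℂ), secondPoly p₀ L = (L.map fun q =>
      (1 + Polynomial.C (1 - q.1) * Polynomial.X)
        * (1 + Polynomial.C (-q.2) * Polynomial.X)).prod * p₀ := by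
    intro L
    induction L with
    | nil => simp [secondPoly]
    | cons q L ih =>
      rw [List.map_cons, List.prod_cons, mul_assoc, ← ih,
        mul_comm (1 + Polynomial.C (1 - q.1) * Polynomial.X)]
      rfl
  rw [h, pairsOf, List.map_map, prod_map_range',
    ← prod_range_pairs k fun i => (1 + Polynomial.C (1 - c i) * Polynomial.X)]
  refine congrArg (· * p₀) (Finset.prod_congr rfl fun i _ => ?_)
  simp only [Function.comp_apply, neg_sub]

/-- Factors formed from a list of nodes are generic if no two of the nodes have sum `1`. -/
theorem isGeneric_pairsOf {p₀ R₀ : Polynomial ℂ} {k : ℕ} {c : ℕ → ℂ}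
    (hc : ∀ i j, 1 ≤ i → i ≤ 2 * k → 1 ≤ j → j ≤ 2 * k → i ≠ j → c i + c j ≠ 1)
    (hb : ∀ i, 1 ≤ i → i ≤ 2 * k →
      (c i ≠ 0 → p₀.eval (-(c i)⁻¹) ≠ 0) ∧ (c i = 0 → R₀.eval (-1) ≠ 0)) :
    IsGeneric p₀ R₀ (pairsOf k c) := by
  -- the nodes of the factor at `i` are `c i` and `c (i + k)`
  have hn : ∀ i z, IsNode (c i, c (i + k) - 1) z → z = c i ∨ z = c (i + k) := fun i z hz =>
    hz.imp id fun h => by rw [h]; ring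
  refine ⟨fun q hq => ?_, ?_, fun q hq z hz => ?_⟩
  · obtain ⟨i, hi, rfl⟩ := List.mem_map.1 hq
    obtain ⟨h1, h2⟩ := List.mem_range'_1.1 hi
    have := hc i (i + k) h1 (by omega) (by omega) (by omega) (by omega)
    intro h
    exact this (by linear_combination h)
  · rw [pairsOf, List.pairwise_map]
    refine List.Pairwise.imp_of_mem (R := (· < ·)) ?_ List.pairwise_lt_range'
    intro i j hi hj hij z z' hz hz'
    obtain ⟨h1, h2⟩ := List.mem_range'_1.1 hi
    obtain ⟨h3, h4⟩ := List.mem_range'_1.1 hj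
    rcases hn i z hz with rfl | rfl <;> rcases hn j z' hz' with rfl | rfl <;>
      exact hc _ _ (by omega) (by omega) (by omega) (by omega) (by omega)
  · obtain ⟨i, hi, rfl⟩ := List.mem_map.1 hq
    obtain ⟨h1, h2⟩ := List.mem_range'_1.1 hi
    rcases hn i z hz with rfl | rfl <;> exact hb _ (by omega) (by omega)

/-- The nodes for equal signs: `a 1, …, a l`, followed by `1/2`. -/
noncomputable def nodesEq (l : ℕ) (a : ℕ → ℂ) (i : ℕ) : ℂ := if i ≤ l then a i else 1 / 2

/-- The nodes for different signs; the last one belongs to the one-dimensional module. They are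
`a 1, …, a l`, but for even `l` the value `1/2` is inserted before the last one. -/
noncomputable def nodesNe (l : ℕ) (a : ℕ → ℂ) (i : ℕ) : ℂ :=
  if Even l then
    (if i = l then 1 / 2 else if i = l + 1 then (if l = 0 then 1 / 2 else a l) else a i)
  else a i

theorem pairsEq_eq (l : ℕ) (a : ℕ → ℂ) : pairsEq l a = pairsOf ((l + 1) / 2) (nodesEq l a) := by
  rw [pairsEq, pairsOf]
  refine List.map_congr_left fun i hi => ?_
  obtain ⟨h1, h2⟩ := List.mem_range'_1.1 hi
  have hil : i ≤ l := by omega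
  simp only [nodesEq, if_pos hil]
  rw [Prod.mk.injEq]
  refine ⟨rfl, ?_⟩
  by_cases h : Odd l ∧ i = (l + 1) / 2
  · obtain ⟨m, hm⟩ := h.1
    rw [if_pos h, if_neg (by omega)]
    norm_num
  · rw [if_neg h, if_pos]
    by_contra hlt
    refine h ⟨?_, by omega⟩
    rw [Nat.odd_iff]
    omega

theorem pairsNe_eq (l : ℕ) (a : ℕ → ℂ) : pairsNe l a = pairsOf (l / 2) (nodesNe l a) := by
  rw [pairsNe, pairsOf]
  refine List.map_congr_left fun i hi => ?_
  obtain ⟨h1, h2⟩ := List.mem_range'_1.1 hi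
  rw [nodesNe, nodesNe, Prod.mk.injEq]
  by_cases h : Even l
  · obtain ⟨m, hm⟩ := id h
    rw [if_pos h, if_pos h, if_neg (by omega), if_neg (by omega)]
    refine ⟨rfl, ?_⟩
    by_cases hi' : i = l / 2
    · rw [if_pos ⟨h, hi'⟩, if_pos (by omega)]; norm_num
    · rw [if_neg (fun h => hi' h.2), if_neg (by omega), if_neg (by omega)]
  · rw [if_neg h, if_neg h, if_neg fun h' => h h'.1]
    exact ⟨rfl, rfl⟩

theorem gammaParam_eq (s ε : Fin 2 → ℤˣ) (l : ℕ) (a : ℕ → ℂ) : gammaParam s ε l a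
    = sgn (ε 0) * sgn (s 0) * (nodesNe l a (2 * (l / 2) + 1) - 1) := by
  rw [gammaParam, nodesNe]
  by_cases h : Even l
  · obtain ⟨m, hm⟩ := id h
    rw [show 2 * (l / 2) + 1 = l + 1 by omega, if_pos h, if_neg (Nat.succ_ne_self l), if_pos rfl]
  · have h' := Nat.not_even_iff.1 h
    rw [if_neg h, if_neg (by omega)]
    congr 3
    omega

variable {l : ℕ} {a : ℕ → ℂ}

/-- The added node `1/2` does no harm, as no `a i` is `1/2` itself. -/
theorem nodesEq_add_ne (ha : ∀ i j, 1 ≤ i → i ≤ l → 1 ≤ j → j ≤ l → a i + a j ≠ 1) (i j : ℕ)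
    (hi : 1 ≤ i) (hi' : i ≤ 2 * ((l + 1) / 2)) (hj : 1 ≤ j) (hj' : j ≤ 2 * ((l + 1) / 2))
    (hij : i ≠ j) : nodesEq l a i + nodesEq l a j ≠ 1 := by
  rw [nodesEq, nodesEq]
  split_ifs with h1 h2 h2
  · exact ha i j hi h1 hj h2
  · intro h
    exact ha i i hi h1 hi h1 (by linear_combination 2 * h)
  · intro h
    exact ha j j hj h2 hj h2 (by linear_combination 2 * h)
  · omega

theorem nodesNe_add_ne (ha : ∀ i j, 1 ≤ i → i ≤ l → 1 ≤ j → j ≤ l → a i + a j ≠ 1) (i j : ℕ)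
    (hi : 1 ≤ i) (hi' : i ≤ 2 * (l / 2) + 1) (hj : 1 ≤ j) (hj' : j ≤ 2 * (l / 2) + 1)
    (hij : i ≠ j) : nodesNe l a i + nodesNe l a j ≠ 1 := by
  by_cases h : Even l
  · -- a node is `1/2`, at the place `l`, or one of the numbers `a 1, …, a l`
    have hn : ∀ i, 1 ≤ i → i ≤ 2 * (l / 2) + 1 → (l = 0 ∧ i = 1) ∨ (i = l ∧ nodesNe l a i = 1 / 2) ∨
        (i ≠ l ∧ ∃ i', 1 ≤ i' ∧ i' ≤ l ∧ nodesNe l a i = a i') := by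
      intro i hi hi'
      rw [nodesNe, if_pos h]
      rcases Nat.eq_zero_or_pos l with rfl | hl
      · exact Or.inl ⟨rfl, by omega⟩
      refine Or.inr ?_
      split_ifs with h1 h2 h3
      · exact Or.inl ⟨h1, rfl⟩
      · omega
      · exact Or.inr ⟨h1, l, by omega, le_rfl, rfl⟩
      · exact Or.inr ⟨h1, i, hi, by omega, rfl⟩
    rcases hn i hi hi' with h1 | ⟨h1, e1⟩ | ⟨h1, i', hi1, hi2, e1⟩ <;>
      rcases hn j hj hj' with h2 | ⟨h2, e2⟩ | ⟨h2, j', hj1, hj2, e2⟩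
    any_goals omega
    · rw [e1, e2]
      intro h
      exact ha j' j' hj1 hj2 hj1 hj2 (by linear_combination 2 * h)
    · rw [e1, e2]
      intro h
      exact ha i' i' hi1 hi2 hi1 hi2 (by linear_combination 2 * h)
    · rw [e1, e2]
      exact ha i' j' hi1 hi2 hj1 hj2
  · have h' := Nat.not_even_iff.1 h
    rw [nodesNe, nodesNe, if_neg h, if_neg h]
    exact ha i j hi (by omega) hj (by omega)

/-- If `a i + a j = 1`, then `-s₁ a i` is a common zero of `P(u)` and `P(-u - s₁)`. -/
theorem add_ne_one_of_isCoprime {c : ℂ} {P : Polynomial ℂ}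
    (hP : P = ∏ i ∈ Finset.Icc 1 l, (Polynomial.X + Polynomial.C (c * a i)))
    (hcop : IsCoprime P (P.comp (-Polynomial.X - Polynomial.C c))) (i j : ℕ) (hi : 1 ≤ i)
    (hi' : i ≤ l) (hj : 1 ≤ j) (hj' : j ≤ l) : a i + a j ≠ 1 := by
  intro h
  have hroot : ∀ i, 1 ≤ i → i ≤ l → P.eval (-(c * a i)) = 0 := by
    intro i hi hi'
    rw [hP, Polynomial.eval_prod]
    exact Finset.prod_eq_zero (Finset.mem_Icc.2 ⟨hi, hi'⟩) (by simp)
  obtain ⟨x, y, hxy⟩ := hcop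
  have e := congrArg (Polynomial.eval (-(c * a i))) hxy
  rw [Polynomial.eval_add, Polynomial.eval_mul, Polynomial.eval_mul, hroot i hi hi',
    Polynomial.eval_comp] at e
  have e' : Polynomial.eval (-(c * a i)) (-Polynomial.X - Polynomial.C c) = -(c * a j) := by
    simp only [Polynomial.eval_sub, Polynomial.eval_neg, Polynomial.eval_X, Polynomial.eval_C]
    linear_combination c * h
  rw [e', hroot j hj hj'] at e
  simp at e

end Parameters

/-! ### Ratios of highest weights -/

section Ratio

variable (s : Fin 2 → ℤˣ)

/-- The Laurent series of `(1 + x t) / (1 + (1 - x) t)`, with `t = s₁ u⁻¹`. -/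
noncomputable def nodeRatio (x : ℂ) : LaurentSeries ℂ :=
  HahnSeries.ofPowerSeries ℤ ℂ (lin s x) / HahnSeries.ofPowerSeries ℤ ℂ (lin s (1 - x))

/-- The added nodes `1/2` do not change the ratio. -/
theorem nodeRatio_half : nodeRatio s (1 / 2) = 1 := by
  rw [nodeRatio, show (1 : ℂ) - 1 / 2 = 1 / 2 by norm_num]
  exact div_self ((map_ne_zero_iff _ HahnSeries.ofPowerSeries_injective).2 (lin_ne_zero _))

theorem nodeRatio_eq (x : ℂ) : nodeRatio s x
    = -(uVar + HahnSeries.C (sgn (s 0) * x))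
      / (-uVar - HahnSeries.C (sgn (s 0)) + HahnSeries.C (sgn (s 0) * x)) := by
  have e : ∀ x, uVar * HahnSeries.ofPowerSeries ℤ ℂ (lin s x)
      = uVar + HahnSeries.C (sgn (s 0) * x) := by
    intro x
    simp only [lin, sX, map_add, map_mul, map_one, ← C_eq_ofPowerSeries]
    linear_combination HahnSeries.C (sgn (s 0)) * HahnSeries.C x * uVar_mul_X
  rw [nodeRatio, ← mul_div_mul_left _ _ uVar_ne_zero, e, e, ← neg_div_neg_eq]
  congr 1
  rw [mul_sub, mul_one, map_sub]
  ring

/-- The prescribed ratio is the product of the ratios of the nodes `a 1, …, a l`. -/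
theorem prod_nodeRatio {l : ℕ} {a : ℕ → ℂ} {P : Polynomial ℂ}
    (hP : P = ∏ i ∈ Finset.Icc 1 l, (Polynomial.X + Polynomial.C (sgn (s 0) * a i))) :
    (-1) ^ P.natDegree * polyRatio (sgn (s 0)) P
      = ∏ i ∈ Finset.range l, nodeRatio s (a (i + 1)) := by
  have hIcc : Finset.Icc 1 l = (Finset.range l).map (addRightEmbedding 1) := by
    rw [Finset.range_eq_Ico, Finset.map_add_right_Ico]
    ext i
    simp only [Finset.mem_Icc, Finset.mem_Ico]
    omega
  rw [hIcc, Finset.prod_map] at hP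
  have hdeg : P.natDegree = l := by
    rw [hP, Polynomial.natDegree_prod_of_monic _ _ fun i _ => Polynomial.monic_X_add_C _,
      Finset.sum_congr rfl fun i _ => Polynomial.natDegree_X_add_C _]
    simp
  rw [hdeg, polyRatio, hP, map_prod, map_prod, ← Finset.prod_div_distrib]
  have hc : (-1 : LaurentSeries ℂ) ^ l = ∏ i ∈ Finset.range l, (-1) := by simp
  rw [hc, ← Finset.prod_mul_distrib]
  refine Finset.prod_congr rfl fun i _ => ?_
  simp only [nodeRatio_eq, addRightEmbedding_apply, map_add, Polynomial.aeval_X,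
    Polynomial.aeval_C]
  rw [show ∀ c : ℂ, algebraMap ℂ (LaurentSeries ℂ) c = HahnSeries.C c from fun c => by
    rw [HahnSeries.algebraMap_apply']; exact HahnSeries.ofPowerSeries_C c]
  ring

theorem prod_nodeRatio_nodesEq (l : ℕ) (a : ℕ → ℂ) :
    ∏ i ∈ Finset.range (2 * ((l + 1) / 2)), nodeRatio s (nodesEq l a (i + 1))
      = ∏ i ∈ Finset.range l, nodeRatio s (a (i + 1)) := by
  have h : ∏ i ∈ Finset.range l, nodeRatio s (nodesEq l a (i + 1))
      = ∏ i ∈ Finset.range l, nodeRatio s (a (i + 1)) :=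
    Finset.prod_congr rfl fun i hi => by
      rw [nodesEq, if_pos (Nat.succ_le_of_lt (Finset.mem_range.1 hi))]
  rcases Nat.even_or_odd l with ⟨m, hm⟩ | ⟨m, hm⟩
  · rw [show 2 * ((l + 1) / 2) = l by omega, h]
  · rw [show 2 * ((l + 1) / 2) = l + 1 by omega, Finset.prod_range_succ, h, nodesEq,
      if_neg (by omega), nodeRatio_half, mul_one]

theorem prod_nodeRatio_nodesNe (l : ℕ) (a : ℕ → ℂ) :
    ∏ i ∈ Finset.range (2 * (l / 2) + 1), nodeRatio s (nodesNe l a (i + 1))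
      = ∏ i ∈ Finset.range l, nodeRatio s (a (i + 1)) := by
  by_cases hl : Even l
  · rw [show 2 * (l / 2) + 1 = l + 1 by obtain ⟨m, hm⟩ := hl; omega]
    rcases l with _ | l
    · simpa [nodesNe] using nodeRatio_half s
    · have h : ∏ i ∈ Finset.range l, nodeRatio s (nodesNe (l + 1) a (i + 1))
          = ∏ i ∈ Finset.range l, nodeRatio s (a (i + 1)) :=
        Finset.prod_congr rfl fun i hi => by
          have := Finset.mem_range.1 hi
          rw [nodesNe, if_pos hl, if_neg (by omega), if_neg (by omega)]
      rw [Finset.prod_range_succ, Finset.prod_range_succ, Finset.prod_range_succ, h]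
      simp only [nodesNe, if_pos hl, if_true, if_neg (Nat.succ_ne_zero l),
        if_neg (Nat.succ_ne_self (l + 1)), nodeRatio_half, mul_one]
  · have h' := Nat.not_even_iff.1 hl
    rw [show 2 * (l / 2) + 1 = l by omega]
    exact Finset.prod_congr rfl fun i _ => by rw [nodesNe, if_neg hl]

/-- The ratio of the highest weight, when both of its polynomials are split. -/
theorem ratio_prod {ε : Fin 2 → ℤˣ} (n : ℕ) (c : ℕ → ℂ) :
    HahnSeries.ofPowerSeries ℤ ℂ (polySeries s
        ((∏ i ∈ Finset.range n, (1 + Polynomial.C (c (i + 1)) * Polynomial.X))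
          * Polynomial.C (sgn (ε 0))))
      / HahnSeries.ofPowerSeries ℤ ℂ (polySeries s
        ((∏ i ∈ Finset.range n, (1 + Polynomial.C (1 - c (i + 1)) * Polynomial.X))
          * Polynomial.C (sgn (ε 1))))
      = HahnSeries.C (sgn (ε 0) * sgn (ε 1)) * ∏ i ∈ Finset.range n, nodeRatio s (c (i + 1)) := by
  have hε : HahnSeries.C (sgn (ε 1)) * HahnSeries.C (sgn (ε 1)) = (1 : LaurentSeries ℂ) := by
    rw [← map_mul, sgn_mul_self, map_one]
  have hε0 := left_ne_zero_of_mul (hε.symm ▸ one_ne_zero)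
  simp only [map_mul, map_prod, polySeries_C, polySeries_lin, ← C_eq_ofPowerSeries, nodeRatio,
    Finset.prod_div_distrib]
  rw [mul_div_mul_comm, mul_comm]
  congr 1
  rw [div_eq_iff hε0, mul_assoc, hε, mul_one]

end Ratio

/-! ### The two families of modules -/

section Families

variable {s ε : Fin 2 → ℤˣ}

theorem opMap_boundary {A A' : Type*} [Ring A] [Algebra ℂ A] [Ring A'] [Algebra ℂ A']
    (f : A →ₐ[ℂ] A') (γ : ℂ) (h : PowerSeries ℂ) :
    opMap (f : A →+* A') (boundary A ε γ h) = boundary A' ε γ h := by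
  ext r i j
  rw [coeff_opMap, coeff_boundary, coeff_boundary, scalarDiag, scalarDiag, Matrix.diagonal_apply,
    Matrix.diagonal_apply]
  split_ifs
  · exact f.commutes _
  · exact map_zero _

/-- The restriction of a module along the homomorphism `B(u) ↦ T(u) G T(-u)⁻¹`. -/
theorem IsTwistedEmbedding.comp_apply {φ : Twisted s ε →ₐ[ℂ] Yangian s}
    (hφ : IsTwistedEmbedding φ) {A : Type*} [Ring A] [Algebra ℂ A] {τ : Yangian s →ₐ[ℂ] A}
    {T : MatSeries 2 A} (hτ : ∀ i j r, τ (tCoeff s i j r) = PowerSeries.coeff r T i j)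
    (i j : Fin 2) (r : ℕ) :
    τ.comp φ (bCoeff s ε i j r) = PowerSeries.coeff r (reflectBy (boundary A ε 0 1) T) i j := by
  have hT : opMap (τ : Yangian s →+* A) (series (tCoeff s)) = T := by
    ext r i j
    rw [coeff_opMap, coeff_series]
    exact hτ i j r
  rw [AlgHom.comp_apply, hφ, reflect_eq, ← boundary_one, ← hT, ← opMap_boundary τ,
    ← opMap_reflectBy _ (coeff_zero_series_tCoeff s), coeff_opMap]
  rfl

theorem isSuperModule_of_reflectBy {A : Type*} [Ring A] [Algebra ℂ A] {V : Type*} [AddCommGroup V]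
    [Module ℂ V] {σ : Module.End ℂ V} (hσ : σ * σ = 1) {T : MatSeries 2 (Module.End ℂ V)}
    (h0 : PowerSeries.coeff 0 T = 1) (hT : IsHomogeneous s σ T) {γ : ℂ} {h : PowerSeries ℂ}
    {x : Fin 2 → Fin 2 → ℕ → A} {ρ : A →ₐ[ℂ] Module.End ℂ V}
    (hρ : ∀ i j r, ρ (x i j r) = PowerSeries.coeff r (reflectBy (boundary _ ε γ h) T) i j) :
    IsSuperModule s x σ ρ := by
  refine ⟨hσ, fun i j r => ?_⟩
  rw [hρ]
  exact hT.reflectBy h0 (fun n => ⟨_, coeff_boundary ε γ h n⟩) i j r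

theorem length_pairsOf (k : ℕ) (c : ℕ → ℂ) : (pairsOf k c).length = k := by simp [pairsOf]

/-- For equal signs, generic nodes `c 1, …, c (2 k)` give an irreducible module whose highest weight
has the ratio of these nodes. -/
theorem exists_module_of_eq (hs : s 0 ≠ s 1) (hε : ε 0 = ε 1)
    {φ : Twisted s ε →ₐ[ℂ] Yangian s} (hφ : IsTwistedEmbedding φ) {k : ℕ} {c : ℕ → ℂ}
    (hc : ∀ i j, 1 ≤ i → i ≤ 2 * k → 1 ≤ j → j ≤ 2 * k → i ≠ j → c i + c j ≠ 1) :
    ∃ τ : Yangian s →ₐ[ℂ] Module.End ℂ (tensorSpace (pairsOf k c)),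
      IsEvalTensorModule (pairsOf k c) τ ∧
      IsSuperModule s (tCoeff s) (tensorParity (pairsOf k c)) τ ∧
      IsSuperModule s (bCoeff s ε) (tensorParity (pairsOf k c)) (τ.comp φ) ∧
      IsStronglyIrreducible (τ.comp φ) ∧
      ∃ (m : Fin 2 → PowerSeries ℂ) (ξ : tensorSpace (pairsOf k c)),
        IsSingular (τ.comp φ) m ξ ∧ ξ ≠ 0 ∧ tensorParity (pairsOf k c) ξ = ξ ∧
        tildeWeight s m 0 / tildeWeight s m 1
          = ∏ i ∈ Finset.range (2 * k), nodeRatio s (c (i + 1)) := by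
  obtain ⟨h0, hT, hh⟩ := tensorEvalSeries_spec hs (pairsOf k c)
  obtain ⟨τ, hτ⟩ := exists_yangian_hom h0 hT
  have hτφ := hφ.comp_apply hτ
  have e1 : secondBase s ε 0 = Polynomial.C (sgn (ε 1)) := by simp [secondBase]
  have e0 : firstBase s ε 0 = Polynomial.C (sgn (ε 0)) := by simp [firstBase, hε]
  have hsgn : ∀ x : ℤˣ, sgn x ≠ 0 := fun x =>
    left_ne_zero_of_mul ((sgn_mul_self x).symm ▸ one_ne_zero)
  have hgen : IsGeneric (secondBase s ε 0) (firstBase s ε 0) (pairsOf k c) := by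
    refine isGeneric_pairsOf hc fun i _ _ => ⟨fun _ => ?_, fun _ => ?_⟩
    · rw [e1, Polynomial.eval_C]; exact hsgn _
    · rw [e0, Polynomial.eval_C]; exact hsgn _
  obtain ⟨ξ, ξ', m, N, hξ, hξσ⟩ := exists_isExtremalPair hs (one_mul 1) hgen
  refine ⟨τ, hτ, ⟨tensorParity_mul_self _, fun i j r => ?_⟩,
    isSuperModule_of_reflectBy (tensorParity_mul_self _) h0 hh hτφ,
    hξ.isStronglyIrreducible hτφ, m, ξ, hξ.isSingular hτφ, fun h => ?_, hξσ, ?_⟩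
  · rw [hτ]; exact hh i j r
  · simpa [h] using hξ.pairing
  · rw [hξ.ratio hs, e0, e1, firstPoly_pairsOf, secondPoly_pairsOf, ratio_prod, hε, sgn_mul_self,
      map_one, one_mul]

/-- For different signs, generic nodes `c 1, …, c (2 k + 1)` give an irreducible module, where the
last node belongs to the one-dimensional module. -/
theorem exists_module_of_ne (hs : s 0 ≠ s 1) (hε : ε 0 ≠ ε 1) {k : ℕ} {c : ℕ → ℂ}
    (hc : ∀ i j, 1 ≤ i → i ≤ 2 * k + 1 → 1 ≤ j → j ≤ 2 * k + 1 → i ≠ j → c i + c j ≠ 1) {γ : ℂ}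
    (hγ : γ = sgn (ε 0) * sgn (s 0) * (c (2 * k + 1) - 1)) :
    ∃ (τ : Yangian s →ₐ[ℂ] Module.End ℂ (tensorSpace (pairsOf k c)))
      (χ : Twisted s ε →ₐ[ℂ] Module.End ℂ ℂ)
      (ω : Twisted s ε →ₐ[ℂ] Module.End ℂ (tensorSpace (pairsOf k c) ⊗[ℂ] ℂ)),
      IsEvalTensorModule (pairsOf k c) τ ∧
      IsSuperModule s (tCoeff s) (tensorParity (pairsOf k c)) τ ∧
      IsOneDimModule γ χ ∧ IsSuperModule s (bCoeff s ε) 1 χ ∧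
      IsTensorModule (tensorParity (pairsOf k c)) τ χ ω ∧
      IsSuperModule s (bCoeff s ε) (TensorProduct.map (tensorParity (pairsOf k c)) 1) ω ∧
      IsStronglyIrreducible ω ∧
      ∃ (m : Fin 2 → PowerSeries ℂ) (ξ : tensorSpace (pairsOf k c) ⊗[ℂ] ℂ),
        IsSingular ω m ξ ∧ ξ ≠ 0 ∧ TensorProduct.map (tensorParity (pairsOf k c)) 1 ξ = ξ ∧
        tildeWeight s m 0 / tildeWeight s m 1
          = -∏ i ∈ Finset.range (2 * k + 1), nodeRatio s (c (i + 1)) := by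
  set L := pairsOf k c
  set z := c (2 * k + 1) with hz
  obtain ⟨h0, hT, hh⟩ := tensorEvalSeries_spec hs L
  have hσ := tensorParity_mul_self L
  obtain ⟨τ, hτ⟩ := exists_yangian_hom h0 hT
  -- the scalar factor of the one-dimensional module
  set N₀ : PowerSeries ℂ := 1 - PowerSeries.C γ * PowerSeries.X with hN₀
  have hN₀c : PowerSeries.constantCoeff N₀ = 1 := by simp [hN₀]
  have hN : N₀ * N₀⁻¹ = 1 := PowerSeries.mul_inv_cancel _ (by rw [hN₀c]; exact one_ne_zero)
  have hinv : PowerSeries.constantCoeff N₀⁻¹ = 1 := by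
    rw [PowerSeries.constantCoeff_inv, hN₀c, inv_one]
  have hneg : PowerSeries.evalNegHom N₀ = 1 + PowerSeries.C γ * PowerSeries.X := by
    rw [hN₀, map_sub, map_mul, evalNegHom_C, map_one, PowerSeries.evalNegHom_X]
    ring
  have hu : (N₀⁻¹ * PowerSeries.evalNegHom N₀⁻¹) *
      ((1 - PowerSeries.C γ * PowerSeries.X) * (1 + PowerSeries.C γ * PowerSeries.X)) = 1 := by
    have hN' := congrArg PowerSeries.evalNegHom hN
    rw [map_mul, map_one] at hN'
    rw [← hneg, ← hN₀]
    linear_combination PowerSeries.evalNegHom N₀⁻¹ * PowerSeries.evalNegHom N₀ * hN + hN'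
  obtain ⟨χ, hχ⟩ := exists_twisted_hom_reflectBy (s := s) (ε := ε) (A := Module.End ℂ ℂ) (T := 1)
    PowerSeries.coeff_zero_one isRTT_one hinv hu
  obtain ⟨ρ, hρ⟩ := exists_twisted_hom_reflectBy (ε := ε) h0 hT hinv hu
  have hω : ∀ i j r, (onLeft (tensorSpace L) ℂ).comp ρ (bCoeff s ε i j r) = PowerSeries.coeff r
      (reflectBy (boundary _ ε γ N₀⁻¹)
        (leftSeries (tensorSpace L) ℂ (tensorEvalSeries s L))) i j := by
    intro i j r
    rw [leftSeries, ← opMap_boundary (onLeft (tensorSpace L) ℂ), ← opMap_reflectBy _ h0,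
      coeff_opMap, AlgHom.comp_apply, hρ]
    rfl
  have hχ' : ∀ i j r, χ (bCoeff s ε i j r)
      = PowerSeries.coeff r (boundary (Module.End ℂ ℂ) ε γ N₀⁻¹) i j := fun i j r => by
    rw [hχ, reflectBy_one]
  -- the value of `γ` makes the boundary terms those of the single node `z`
  have hε' : sgn (ε 1) = -sgn (ε 0) := sgn_one_eq_neg hε
  have hγs : γ * sgn (s 0) = sgn (ε 0) * (z - 1) := by
    rw [hγ]
    linear_combination sgn (ε 0) * (z - 1) * sgn_mul_self (s 0)
  have e1 : secondBase s ε γ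
      = (1 + Polynomial.C (1 - z) * Polynomial.X) * Polynomial.C (sgn (ε 1)) := by
    rw [secondBase, hγs, hε']
    simp only [map_neg, map_mul, map_sub, map_one]
    ring
  have e0 : firstBase s ε γ
      = (1 + Polynomial.C z * Polynomial.X) * Polynomial.C (sgn (ε 0)) := by
    rw [firstBase, hγs, hε', show sgn (ε 0) * (z - 1) + (sgn (ε 0) - -sgn (ε 0)) / 2
      = z * sgn (ε 0) by ring, map_mul]
    ring
  have hsgn : ∀ x : ℤˣ, sgn x ≠ 0 := fun x =>
    left_ne_zero_of_mul ((sgn_mul_self x).symm ▸ one_ne_zero)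
  have hgen : IsGeneric (secondBase s ε γ) (firstBase s ε γ) L := by
    refine isGeneric_pairsOf (fun i j h1 h2 h3 h4 => hc i j h1 (by omega) h3 (by omega))
      fun i h1 h2 => ?_
    have hi := hc i (2 * k + 1) h1 (by omega) (by omega) le_rfl (by omega)
    rw [← hz] at hi
    constructor
    · intro h0
      rw [e1]
      simp only [Polynomial.eval_mul, Polynomial.eval_add, Polynomial.eval_one, Polynomial.eval_C,
        Polynomial.eval_X]
      refine mul_ne_zero (fun h => hi ?_) (hsgn _)
      field_simp at h
      linear_combination h
    · intro h0
      rw [e0]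
      simp only [Polynomial.eval_mul, Polynomial.eval_add, Polynomial.eval_one, Polynomial.eval_C,
        Polynomial.eval_X]
      refine mul_ne_zero (fun h => hi ?_) (hsgn _)
      linear_combination h0 - h
  obtain ⟨ξ, ξ', m, N, hξ, hξσ⟩ := exists_isExtremalPair hs hN hgen
  have hirr := hξ.isStronglyIrreducible hρ
  have hsing := hξ.isSingular hρ
  have hξ0 : ξ ≠ 0 := fun h => by simpa [h] using hξ.pairing
  have hrid : ∀ x v, TensorProduct.rid ℂ (tensorSpace L) ((onLeft (tensorSpace L) ℂ).comp ρ x v)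
      = ρ x (TensorProduct.rid ℂ (tensorSpace L) v) := by
    intro x v
    induction v using TensorProduct.induction_on with
    | zero => simp
    | tmul v w => rw [AlgHom.comp_apply, onLeft_tmul]; simp
    | add v w hv hw => rw [map_add, map_add, hv, hw, map_add, map_add]
  -- the tensor product with the one-dimensional module is the module `ρ` on `tensorSpace L`
  refine ⟨τ, χ, (onLeft (tensorSpace L) ℂ).comp ρ, hτ, ⟨hσ, fun i j r => ?_⟩, fun i j r => ?_,
    ⟨one_mul 1, fun i j r => ?_⟩, fun i j r => ?_,
    isSuperModule_of_reflectBy ?_ (coeff_zero_leftSeries h0) (hh.leftSeries 1) hω, ⟨?_, ?_⟩,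
    m, ξ ⊗ₜ 1, ⟨fun r => ?_, fun i r => ?_⟩, fun h => ?_, ?_, ?_⟩
  · rw [hτ]; exact hh i j r
  · rw [hχ', coeff_boundary, scalarDiag, Matrix.diagonal_apply]
    split_ifs
    · rw [Algebra.algebraMap_eq_smul_one, mul_comm]; rfl
    · rw [zero_smul]
  · rw [hχ']
    exact IsHomogeneous.of_scalarDiag (fun n => ⟨_, coeff_boundary ε γ N₀⁻¹ n⟩) i j r
  · have hτ' : (series fun i j r => τ (tCoeff s i j r)) = tensorEvalSeries s L := by
      ext r i j
      rw [coeff_series, hτ]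
    have hχ'' : (series fun i j r => χ (bCoeff s ε i j r))
        = boundary (Module.End ℂ ℂ) ε γ N₀⁻¹ := by
      ext1 r
      ext1 i j
      rw [coeff_series, hχ']
    rw [hω, hτ', hχ'', coidealSeries_eq hh h0, rightSeries_boundary hσ]
    rfl
  · rw [← TensorProduct.map_mul, hσ, one_mul, TensorProduct.map_one]
  · have := hirr.1
    exact (TensorProduct.rid ℂ (tensorSpace L)).toEquiv.nontrivial
  · intro W hW
    have := hirr.2 (W.map (TensorProduct.rid ℂ (tensorSpace L)).toLinearMap) (by
      rintro x _ ⟨v, hv, rfl⟩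
      exact ⟨_, hW x v hv, hrid x v⟩)
    rcases this with h | h
    · exact Or.inl (Submodule.map_injective_of_injective
        (TensorProduct.rid ℂ (tensorSpace L)).injective (h.trans (Submodule.map_bot _).symm))
    · refine Or.inr (Submodule.map_injective_of_injective
        (TensorProduct.rid ℂ (tensorSpace L)).injective (h.trans ?_))
      rw [Submodule.map_top, LinearEquiv.range]
  · rw [AlgHom.comp_apply, onLeft_tmul, hsing.raising, TensorProduct.zero_tmul]
  · rw [AlgHom.comp_apply, onLeft_tmul, hsing.diagonal, TensorProduct.smul_tmul']
  · have := congrArg (TensorProduct.rid ℂ (tensorSpace L)) h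
    rw [TensorProduct.rid_tmul, one_smul, map_zero] at this
    exact hξ0 this
  · rw [TensorProduct.map_tmul, hξσ]; rfl
  · rw [hξ.ratio hs, e0, e1, firstPoly_pairsOf, secondPoly_pairsOf, ← mul_assoc, ← mul_assoc,
      ← Finset.prod_range_succ (fun i => 1 + Polynomial.C (c (i + 1)) * Polynomial.X),
      ← Finset.prod_range_succ (fun i => 1 + Polynomial.C (1 - c (i + 1)) * Polynomial.X),
      ratio_prod, hε', mul_neg, sgn_mul_self, map_neg, map_one, neg_one_mul]

end Families

end TwistedSuperYangian

theorem mainTheorem6 (s ε : Fin 2 → ℤˣ) (hs : s 0 ≠ s 1) (l : ℕ) (a : ℕ → ℂ)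
    (P : Polynomial ℂ)
    (hP : P = ∏ i ∈ Finset.Icc 1 l,
      (Polynomial.X + Polynomial.C (sgn (s 0) * a i)))
    (hcop : IsCoprime P
      (P.comp (-Polynomial.X - Polynomial.C (sgn (s 0))))) :
    ∃ φ : Twisted s ε →ₐ[ℂ] Yangian s,
      IsTwistedEmbedding φ ∧
      -- the case of equal signs
      (ε 0 = ε 1 →
        ∃ τ : Yangian s →ₐ[ℂ]
            Module.End ℂ (tensorSpace (pairsEq l a)),
          IsEvalTensorModule (pairsEq l a) τ ∧
          IsSuperModule s (tCoeff s)
            (tensorParity (pairsEq l a)) τ ∧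
          IsSuperModule s (bCoeff s ε)
            (tensorParity (pairsEq l a)) (τ.comp φ) ∧
          IsStronglyIrreducible (τ.comp φ) ∧
          ∀ (V : Type*) [AddCommGroup V] [Module ℂ V] [FiniteDimensional ℂ V]
            (σ : Module.End ℂ V)
            (ρ : Twisted s ε →ₐ[ℂ] Module.End ℂ V)
            (μ : Fin 2 → PowerSeries ℂ) (η : V),
            IsSuperModule s (bCoeff s ε) σ ρ →
            IsSuperIrreducible σ ρ →
            IsHighestWeightVector ρ μ η →
            tildeWeight s μ 0 / tildeWeight s μ 1 =
              (-1) ^ P.natDegree *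
                polyRatio (sgn (s 0)) P →
            AlmostIsomorphic σ ρ
              (tensorParity (pairsEq l a))
              (τ.comp φ) ∧
            Module.finrank ℂ V = 2 ^ ((l + 1) / 2)) ∧
      -- the case of different signs
      (ε 0 ≠ ε 1 →
        ∃ (τ : Yangian s →ₐ[ℂ]
            Module.End ℂ (tensorSpace (pairsNe l a)))
          (χ : Twisted s ε →ₐ[ℂ] Module.End ℂ ℂ)
          (ω : Twisted s ε →ₐ[ℂ]
            Module.End ℂ (TensorProduct ℂ
              (tensorSpace (pairsNe l a)) ℂ)),
          IsEvalTensorModule (pairsNe l a) τ ∧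
          IsSuperModule s (tCoeff s)
            (tensorParity (pairsNe l a)) τ ∧
          IsOneDimModule (gammaParam s ε l a) χ ∧
          IsSuperModule s (bCoeff s ε) 1 χ ∧
          IsTensorModule
            (tensorParity (pairsNe l a)) τ χ ω ∧
          IsSuperModule s (bCoeff s ε)
            (TensorProduct.map
              (tensorParity (pairsNe l a)) 1) ω ∧
          IsStronglyIrreducible ω ∧
          ∀ (V : Type*) [AddCommGroup V] [Module ℂ V] [FiniteDimensional ℂ V]
            (σ : Module.End ℂ V)
            (ρ : Twisted s ε →ₐ[ℂ] Module.End ℂ V)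
            (μ : Fin 2 → PowerSeries ℂ) (η : V),
            IsSuperModule s (bCoeff s ε) σ ρ →
            IsSuperIrreducible σ ρ →
            IsHighestWeightVector ρ μ η →
            tildeWeight s μ 0 / tildeWeight s μ 1 =
              (-1) ^ (P.natDegree + 1) *
                polyRatio (sgn (s 0)) P →
            AlmostIsomorphic σ ρ
              (TensorProduct.map
                (tensorParity (pairsNe l a)) 1) ω ∧
            Module.finrank ℂ V = 2 ^ (l / 2)) := by
  have hne := add_ne_one_of_isCoprime hP hcop
  obtain ⟨φ, hφ⟩ := exists_twisted_embedding s ε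
  refine ⟨φ, hφ, fun hε => ?_, fun hε => ?_⟩
  · rw [pairsEq_eq]
    obtain ⟨τ, h1, h2, h3, h4, m, ξ, hξ, hξ0, hξσ, hm⟩ :=
      exists_module_of_eq hs hε hφ (nodesEq_add_ne hne)
    refine ⟨τ, h1, h2, h3, h4, fun V _ _ _ σ ρ μ η hσ hρ hη hμ => ?_⟩
    have hiso := almostIsomorphic_of_ratio hσ hρ hη h3 h4 hξ hξ0 hξσ
      (by rw [hμ, hm, prod_nodeRatio s hP, prod_nodeRatio_nodesEq])
    refine ⟨hiso, ?_⟩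
    obtain ⟨-, -, f, -⟩ := hiso
    rw [f.finrank_eq, finrank_tensorSpace, length_pairsOf]
  · rw [pairsNe_eq]
    obtain ⟨τ, χ, ω, h1, h2, h3, h4, h5, h6, h7, m, ξ, hξ, hξ0, hξσ, hm⟩ :=
      exists_module_of_ne hs hε (nodesNe_add_ne hne) (gammaParam_eq s ε l a)
    refine ⟨τ, χ, ω, h1, h2, h3, h4, h5, h6, h7, fun V _ _ _ σ ρ μ η hσ hρ hη hμ => ?_⟩
    have hiso := almostIsomorphic_of_ratio hσ hρ hη h6 h7 hξ hξ0 hξσ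
      (by rw [hμ, hm, prod_nodeRatio_nodesNe, ← prod_nodeRatio s hP]; ring)
    refine ⟨hiso, ?_⟩
    obtain ⟨-, -, f, -⟩ := hiso
    rw [f.finrank_eq, Module.finrank_tensorProduct, Module.finrank_self, mul_one,
      finrank_tensorSpace, length_pairsOf]
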